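/- **Setting.** Manifolds are finite-dimensional, smooth, Hausdorff and second countable. A *forced mechanical system* (FMS) $(Q,L,f)$ consists of a manifold $Q$, a smooth $L:TQ\to\mathbb R$ and a smooth $1$-form $f$ on $TQ$ that vanishes on vertical vectors. A smooth curve $q:[a,b]\to Q$ is a *trajectory* if $\int_a^b (dL+f)(\dot q(t))\big(\kappa((\delta q)'(t))\big)\,dt=0$ for every smooth $\delta q:[a,b]\to TQ$ over $q$ with $\delta q(a)=0$, $\delta q(b)=0$, where $\kappa:TTQ\to TTQ$ is the canonical involution. The system is *regular* if the second fibre derivative of $L$ is nondegenerate at every point of $TQ$; its flow $F_t(v)$ is then the velocity at time $t$ of the trajectory with velocity $v$ at time $0$. Fix smooth $\alpha^\pm:(-b,b)\to\mathbb R$ $(b>0)$ with $h\alpha^+(h)\ge 0$, $h\alpha^-(h)\le 0$ and $\alpha^+(h)-\alpha^-(h)=h$. The *exact boundary maps* are $\partial^{E\pm}_h(v)=\tau_Q(F_{\alpha^\pm(h)}(v))$, defined where both flows are, with $\tau_Q:TQ\to Q$ the projection; $\partial^{E\mp}_h=(\partial^{E-}_h,\partial^{E+}_h)$ and $\tilde\partial^{E\mp}(h,v)=(h,\partial^{E\mp}_h(v))$.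 A pair $(\mathcal U,\mathcal W)$ is *adapted* if $\mathcal U\subset\mathbb R\times TQ$ is an open neighbourhood of $\{0\}\times TQ$ contained in the domain of $\tilde\partial^{E\mp}$, $\mathcal W=\tilde\partial^{E\mp}(\mathcal U)\subset\mathbb R\times Q\times Q$ contains $\{0\}\times\Delta_Q$ (with $\Delta_Q$ the diagonal), and $\tilde\partial^{E\mp}$ is a diffeomorphism from $\mathcal U\cap\{h\neq 0\}$ onto $\mathcal W\cap\{h\ne0\}$, both open. A *discretization$_{TQ}$* $\Delta_{TQ}$ is a family of functions $L_h$ and $1$-forms $f_h$ in the $TQ$ directions, depending smoothly on $(h,v)\in\mathcal U$, such that $L_h=hL+h^2r$ and $f_h=hf+h^2\rho$ on $\mathcal U$ with $r,\rho$ continuous. A *discretization$_{Q\times Q}$* $\Delta_{Q\times Q}$ is a family $(L_{d,h},f_{d,h})$ over $\mathcal W\cap\{h\neq0\}$ whose pull-backs by $\partial^{E\mp}_h$ extend to a discretization$_{TQ}$. The two *correspond* if $L_h=L_{d,h}\circ\partial^{E\mp}_h$ and $f_h=(\partial^{E\mp}_h)^*f_{d,h}$ on $\mathcal U\cap\{h\neq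 0\}$. *Discrete systems.* A *discrete tangent bundle* of $Q_0$ is a manifold $\mathcal V$ with $\dim\mathcal V=2\dim Q_0$ and submersions $\partial^\pm:\mathcal V\to Q_0$ such that $(\partial^-,\partial^+)$ is an immersion and each $(q,q)$, $q\in Q_0$, has exactly one preimage under $(\partial^-,\partial^+)$. An *FDMS$_{TQ}$* $(Q_0,\mathcal V,L,f)$ is a discrete tangent bundle $\mathcal V$ of $Q_0$ with a smooth function $L$ and a smooth $1$-form $f$ on $\mathcal V$. An *FDMS$_{Q\times Q}$* $(Q_0,W,L_d,f_d)$ is an open neighbourhood $W\subset Q_0\times Q_0$ of the diagonal with a smooth function $L_d$ and a smooth $1$-form $f_d$ on $W$. A *trajectory* (of length $2$) of the first is a pair $(v,\tilde v)\in\mathcal V^2$ with $\partial^+v=\partial^-\tilde v$ and $(dL+f)(v)(\delta v)+(dL+f)(\tilde v)(\delta\tilde v)=0$ whenever $T\partial^+\delta v=T\partial^-\delta\tilde v$, $T\partial^-\delta v=0$, $T\partial^+\delta\tilde v=0$. A trajectory of the second is a triple $(q_0,q_1,q_2)$ with $(q_0,q_1),(q_1,q_2)\in W$ and $(dL_d+f_d)(q_0,q_1)(0,\delta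 q_1)+(dL_d+f_d)(q_1,q_2)(\delta q_1,0)=0$ for all $\delta q_1$. *Critical problems.* A critical problem is a manifold $\mathcal C$ with a smooth $1$-form $\sigma$ and a smooth submersion $g$; $m\in\mathcal C$ is *critical* if $\sigma(m)$ vanishes on $\ker T_mg$. Four problems are associated to the above (subscripts of $p$ list the components kept). * To an FDMS$_{TQ}$: $\mathcal C^{\mathcal V}=\{(v,\tilde v)\in\mathcal V^2:\partial^+v=\partial^-\tilde v\}$, $\sigma=p_1^*(dL+f)+p_2^*(dL+f)$, $g=(\partial^-v,\partial^+\tilde v)$. * To an FDMS$_{Q\times Q}$: $\mathcal C^{W}=\{(q_0,q_1,q_2):(q_0,q_1),(q_1,q_2)\in W\}$, $\sigma=p_{12}^*(dL_d+f_d)+p_{23}^*(dL_d+f_d)$, $g=(q_0,q_2)$. * To $\Delta_{TQ}$: $\mathcal C^*=\{(h,v,\tilde v):h\ne0,\ (h,v),(h,\tilde v)\in\mathcal U,\ \partial^{E+}_hv=\partial^{E-}_h\tilde v\}$, $\sigma=p_{12}^*\mu+p_{13}^*\mu$ with $\mu(h,v)(\delta h,\delta v)=(dL_h+f_h)(v)(\delta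 v)$, $g=(h,\partial^{E-}_hv,\partial^{E+}_h\tilde v)$. * To $\Delta_{Q\times Q}$: $\mathcal C^*_{Q\times Q}=\{(h,q_0,q_1,q_2):h\neq0,\ (h,q_0,q_1),(h,q_1,q_2)\in\mathcal W\}$, $\sigma=p_{123}^*\mu_d+p_{134}^*\mu_d$ with $\mu_d(h,q,q')(\delta h,\delta q,\delta q')=(dL_{d,h}+f_{d,h})(q,q')(\delta q,\delta q')$, $g=(h,q_0,q_2)$. **Theorem.** Let $(Q,L,f)$ be a regular FMS and $\alpha^\pm$ as above. Adapted pairs exist. Let $(\mathcal U,\mathcal W)$ be an adapted pair. The relation "correspond" is a bijection between discretizations$_{TQ}$ and discretizations$_{Q\times Q}$. Let $Q_0\subset Q$ be open and relatively compact. There is $a>0$ such that $(h,q,q)\in\mathcal W$ for all $|h|<a$ and $q\in Q_0$. Fix any such $a$, let $0<|h|<a$, and put $$\mathcal V^E_h=\{v:(h,v)\in\mathcal U,\ \partial^{E\mp}_h(v)\in Q_0\times Q_0\},\qquad \mathcal W^E_h=\{(q,q')\in Q_0\times Q_0:(h,q,q')\in\mathcal W\}.$$ 1. $\partial^{E\mp}_h$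 restricts to a diffeomorphism from $\mathcal V^E_h$ onto $\mathcal W^E_h$, both open, and $(L,f)=\big(L_d\circ\partial^{E\mp}_h,(\partial^{E\mp}_h)^*f_d\big)$ is a bijective correspondence between the FDMSs$_{TQ}$ $(Q_0,(\mathcal V^E_h,\partial^{E\pm}_h),L,f)$ and the FDMSs$_{Q\times Q}$ $(Q_0,\mathcal W^E_h,L_d,f_d)$. If $\Delta_{TQ}$ and $\Delta_{Q\times Q}$ correspond, then $\Sigma_h=(Q_0,\mathcal V^E_h,L_h,f_h)$ and $\Sigma_{Q\times Q,h}=(Q_0,\mathcal W^E_h,L_{d,h},f_{d,h})$ are an FDMS$_{TQ}$ and an FDMS$_{Q\times Q}$, and they correspond (so passing to the fixed-$h$ systems commutes with the two correspondences). 2. Let $\Delta_{TQ}$ and $\Delta_{Q\times Q}$ correspond. The four problems associated to $\Delta_{TQ}$, $\Delta_{Q\times Q}$, $\Sigma_h$, $\Sigma_{Q\times Q,h}$ are critical problems, and 1. $(h,v,\tilde v)\mapsto(v,\tilde v)$ is a bijection from the critical points of $\Delta_{TQ}$ in $\{h\}\times\mathcal C^{\mathcal V^E_h}$ onto the critical points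 of $\Sigma_h$; 2. $(h,q_0,q_1,q_2)\mapsto(q_0,q_1,q_2)$ is a bijection from the critical points of $\Delta_{Q\times Q}$ in $\{h\}\times\mathcal C^{\mathcal W^E_h}$ onto the critical points of $\Sigma_{Q\times Q,h}$; 3. $(h',v,\tilde v)\mapsto(h',\partial^{E-}_{h'}(v),\partial^{E+}_{h'}(v),\partial^{E+}_{h'}(\tilde v))$ is a bijection from the critical points of $\Delta_{TQ}$ onto those of $\Delta_{Q\times Q}$, and it restricts to a bijection from those in $\{h\}\times\mathcal C^{\mathcal V^E_h}$ onto those in $\{h\}\times\mathcal C^{\mathcal W^E_h}$; 4. $(v,\tilde v)\mapsto(\partial^{E-}_h(v),\partial^{E+}_h(v),\partial^{E+}_h(\tilde v))$ is a bijection from the critical points of $\Sigma_h$ onto those of $\Sigma_{Q\times Q,h}$; 5. the same map is a bijection from the trajectories of $\Sigma_h$ onto the trajectories of $\Sigma_{Q\times Q,h}$. -/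

import Mathlib

open Set Filter Topology
open scoped Manifold ContDiff

noncomputable section

namespace ForcedDiscrete

/-! ### One-forms on manifolds -/

section Forms

variable {E : Type*} [NormedAddCommGroup E] [NormedSpace ℝ E]
  {H : Type*} [TopologicalSpace H] (I : ModelWithCorners ℝ E H)
  {M : Type*} [TopologicalSpace M] [ChartedSpace H M]
  {E' : Type*} [NormedAddCommGroup E'] [NormedSpace ℝ E']
  {H' : Type*} [TopologicalSpace H'] (J : ModelWithCorners ℝ E' H')
  {N : Type*} [TopologicalSpace N] [ChartedSpace H' N]

/-- A (not necessarily smooth) `1`-form on `M`. -/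
abbrev OneForm (M : Type*) [TopologicalSpace M] [ChartedSpace H M] :=
  (x : M) → TangentSpace I x →L[ℝ] ℝ

/-- The pull-back `g^* α`, that is `(g^* α)(x)(δx) = α(g x)(T_x g (δx))`. -/
def pullback (g : M → N) (α : OneForm J N) : OneForm I M :=
  fun x => (α (g x)).comp (mfderiv I J g x)

/-- For a time dependent form `α_h` on `M`, the form on `ℝ × M` given by
`(h, x)(δh, δx) ↦ α_h(x)(δx)`, i.e. the corresponding section of `p₂^* T^*M`. -/
def timeForm (α : ℝ → OneForm I M) : OneForm (𝓘(ℝ, ℝ).prod I) (ℝ × M) :=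
  fun p => (α p.1 p.2).comp (mfderiv (𝓘(ℝ, ℝ).prod I) I (Prod.snd : ℝ × M → M) p)

variable [IsManifold I ∞ M]

/-- Smoothness of a `1`-form on an open set `s`.  A section `α` of the cotangent bundle of a finite
dimensional manifold is smooth exactly when the fibrewise linear function `δx ↦ α(x)(δx)` on the
tangent bundle is smooth. -/
def SmoothFormOn (α : OneForm I M) (s : Set M) : Prop :=
  ContMDiffOn I.tangent 𝓘(ℝ, ℝ) ∞ (fun ξ : TangentBundle I M => α ξ.proj ξ.2)
    {ξ : TangentBundle I M | ξ.proj ∈ s}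

/-- Smoothness over an open set `s ⊆ ℝ × M` of a section of `p₂^* T^*M → ℝ × M`. -/
def SmoothFormFamilyOn (α : ℝ → OneForm I M) (s : Set (ℝ × M)) : Prop :=
  ContMDiffOn (𝓘(ℝ, ℝ).prod I.tangent) 𝓘(ℝ, ℝ) ∞
    (fun p : ℝ × TangentBundle I M => α p.1 p.2.proj p.2.2)
    {p : ℝ × TangentBundle I M | (p.1, p.2.proj) ∈ s}

/-- Continuity over a set `s ⊆ ℝ × M` of a section of `p₂^* T^*M → ℝ × M`. -/
def ContinuousFormFamilyOn (α : ℝ → OneForm I M) (s : Set (ℝ × M)) : Prop :=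
  ContinuousOn (fun p : ℝ × TangentBundle I M => α p.1 p.2.proj p.2.2)
    {p : ℝ × TangentBundle I M | (p.1, p.2.proj) ∈ s}

end Forms

/-! ### Velocities, diffeomorphisms between open sets, critical problems -/

section Geometry

variable {E : Type*} [NormedAddCommGroup E] [NormedSpace ℝ E]
  {H : Type*} [TopologicalSpace H] (I : ModelWithCorners ℝ E H)
  {M : Type*} [TopologicalSpace M] [ChartedSpace H M]
  {E' : Type*} [NormedAddCommGroup E'] [NormedSpace ℝ E']
  {H' : Type*} [TopologicalSpace H'] (J : ModelWithCorners ℝ E' H')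
  {N : Type*} [TopologicalSpace N] [ChartedSpace H' N]

/-- The velocity `c'(t)` of a curve, as a point of the tangent bundle. -/
def velocity (c : ℝ → M) (t : ℝ) : TangentBundle I M :=
  ⟨c t, mfderiv 𝓘(ℝ, ℝ) I c t (1 : ℝ)⟩

/-- The velocity at `t` of a curve defined on `s` (for instance a closed interval). -/
def velocityWithin (c : ℝ → M) (s : Set ℝ) (t : ℝ) : TangentBundle I M :=
  ⟨c t, mfderivWithin 𝓘(ℝ, ℝ) I c s t (1 : ℝ)⟩

/-- `f` restricts to a smooth diffeomorphism from the open set `s` onto the open set `t`. -/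
def IsDiffeoOn (f : M → N) (s : Set M) (t : Set N) : Prop :=
  IsOpen s ∧ IsOpen t ∧ BijOn f s t ∧ ContMDiffOn I J ∞ f s ∧
    ∃ g : N → M, ContMDiffOn J I ∞ g t ∧ InvOn g f s t

/-- `S` is an embedded submanifold: locally the zero set of a smooth submersion to some `ℝᵏ`. -/
def IsEmbeddedSubmanifold (S : Set M) : Prop :=
  ∀ x ∈ S, ∃ (k : ℕ) (O : Set M) (Φ : M → EuclideanSpace ℝ (Fin k)), IsOpen O ∧ x ∈ O ∧
    ContMDiffOn I 𝓘(ℝ, EuclideanSpace ℝ (Fin k)) ∞ Φ O ∧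
    (∀ y ∈ O, Function.Surjective (mfderiv I 𝓘(ℝ, EuclideanSpace ℝ (Fin k)) Φ y)) ∧
    S ∩ O = {y ∈ O | Φ y = 0}

/-- The tangent space `T_x S ⊆ T_x M` of a submanifold `S ⊆ M`: the velocities of smooth curves
in `S` through `x`. -/
def tangentSet (S : Set M) (x : M) : Set (TangentSpace I x) :=
  {ξ | ∃ c : ℝ → M, ContMDiffAt 𝓘(ℝ, ℝ) I ∞ c 0 ∧ (∀ᶠ t in 𝓝 (0 : ℝ), c t ∈ S) ∧
    velocity I c 0 = ⟨x, ξ⟩}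

/-- The data `(α, g)` of a critical problem over a submanifold `carrier` of an ambient manifold
`M`; the form and the map are given on `M` and only their restrictions to `carrier` matter.  The
distribution of the problem is `ker (T (g|_carrier))`. -/
structure CriticalProblem (M : Type*) [TopologicalSpace M] [ChartedSpace H M] (N : Type*) where
  /-- the manifold on which the problem is posed -/
  carrier : Set M
  /-- the `1`-form -/
  form : OneForm I M
  /-- the submersion -/
  map : M → N

namespace CriticalProblem

variable {I}

/-- The distribution `ker (T (g|_carrier))` at `m`. -/
def distribution (P : CriticalProblem I M N) (m : M) : Set (TangentSpace I m) :=
  {ξ | ξ ∈ tangentSet I P.carrier m ∧ mfderiv I J P.map m ξ = 0}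

/-- `m` is a critical point of the problem at `n`. -/
def IsCriticalPointAt (P : CriticalProblem I M N) (n : N) (m : M) : Prop :=
  m ∈ P.carrier ∧ P.map m = n ∧ ∀ ξ ∈ P.distribution J m, P.form m ξ = 0

/-- The set of all critical points of the problem. -/
def criticalPoints (P : CriticalProblem I M N) : Set M :=
  {m | ∃ n, P.IsCriticalPointAt J n m}

/-- The carrier is a submanifold, the form is smooth, and the map restricts to a smooth
submersion of the carrier. -/
def IsCriticalProblem [IsManifold I ∞ M] (P : CriticalProblem I M N) : Prop :=
  IsEmbeddedSubmanifold I P.carrier ∧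
  (∃ O : Set M, IsOpen O ∧ P.carrier ⊆ O ∧ SmoothFormOn I P.form O) ∧
  ∀ m ∈ P.carrier, ContMDiffAt I J ∞ P.map m ∧
    ∀ η : TangentSpace J (P.map m), ∃ ξ ∈ tangentSet I P.carrier m, mfderiv I J P.map m ξ = η

end CriticalProblem

end Geometry

/-! ### Pairs (Lagrangian, force) and correspondences -/

section LagrangianForce

variable {E : Type*} [NormedAddCommGroup E] [NormedSpace ℝ E]
  {H : Type*} [TopologicalSpace H] (I : ModelWithCorners ℝ E H)
  {E' : Type*} [NormedAddCommGroup E'] [NormedSpace ℝ E']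
  {H' : Type*} [TopologicalSpace H'] (J : ModelWithCorners ℝ E' H')

/-- A discrete Lagrangian together with a discrete force on (a part of) `X`. -/
structure LagForce (X : Type*) [TopologicalSpace X] [ChartedSpace H X] where
  /-- the Lagrangian -/
  lag : X → ℝ
  /-- the force -/
  force : OneForm I X

namespace LagForce

variable {I} {X : Type*} [TopologicalSpace X] [ChartedSpace H X]
  {Y : Type*} [TopologicalSpace Y] [ChartedSpace H' Y]

/-- The form `μ = dL + f`. -/
def mu (D : LagForce I X) : OneForm I X := fun x => mvfderiv I D.lag x + D.force x

/-- Two pairs agree on `s`. -/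
def EqOn (s : Set X) (D D' : LagForce I X) : Prop :=
  ∀ x ∈ s, D.lag x = D'.lag x ∧ D.force x = D'.force x

variable (I) in
/-- The pull-back `(L ∘ φ, φ^* f)`. -/
def comap (φ : X → Y) (D : LagForce J Y) : LagForce I X where
  lag := D.lag ∘ φ
  force := pullback I J φ D.force

/-- Lagrangian and force are smooth on the open set `s`. -/
def SmoothOn [IsManifold I ∞ X] (D : LagForce I X) (s : Set X) : Prop :=
  ContMDiffOn I 𝓘(ℝ, ℝ) ∞ D.lag s ∧ SmoothFormOn I D.force s

end LagForce

/-- `R` is a bijective correspondence between the objects satisfying `PA` (up to `eqA`) and those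
satisfying `PB` (up to `eqB`). -/
def IsCorrespondence {A B : Type*} (PA : A → Prop) (PB : B → Prop) (eqA : A → A → Prop)
    (eqB : B → B → Prop) (R : A → B → Prop) : Prop :=
  (∀ a, PA a → ∃ b, PB b ∧ R a b) ∧ (∀ b, PB b → ∃ a, PA a ∧ R a b) ∧
  (∀ a b b', PA a → PB b → PB b' → R a b → R a b' → eqB b b') ∧
  (∀ a a' b, PA a → PA a' → PB b → R a b → R a' b → eqA a a')

end LagrangianForce

/-! ### Discrete tangent bundles and forced discrete mechanical systems -/

section DiscreteSystems

variable {E : Type*} [NormedAddCommGroup E] [NormedSpace ℝ E]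
  {H : Type*} [TopologicalSpace H] (I : ModelWithCorners ℝ E H)
  {E' : Type*} [NormedAddCommGroup E'] [NormedSpace ℝ E']
  {H' : Type*} [TopologicalSpace H'] (J : ModelWithCorners ℝ E' H')

/-- The data `(Q₀, (𝒱, ∂⁺, ∂⁻), L, f)` of a forced discrete mechanical system, where `Q₀` is an open
submanifold of `Q` and `𝒱` is an open submanifold of `X`; all maps are given on `X` and only their
restrictions to `𝒱` matter. -/
structure DiscreteSystem (X : Type*) [TopologicalSpace X] [ChartedSpace H X] (Q : Type*) where
  /-- the configuration space -/
  base : Set Q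
  /-- the manifold underlying the discrete tangent bundle -/
  bundle : Set X
  /-- the boundary map `∂⁺` -/
  dPlus : X → Q
  /-- the boundary map `∂⁻` -/
  dMinus : X → Q
  /-- discrete Lagrangian and force -/
  data : LagForce I X

variable {X : Type*} [TopologicalSpace X] [ChartedSpace H X]
  {Q : Type*} [TopologicalSpace Q] [ChartedSpace H' Q]

namespace DiscreteSystem

variable {I}

/-- `(𝒱, ∂⁺, ∂⁻)` is a discrete tangent bundle of `Q₀`. -/
def IsDiscreteTangentBundle (S : DiscreteSystem I X Q) : Prop :=
  IsOpen S.base ∧ IsOpen S.bundle ∧ Module.finrank ℝ E = 2 * Module.finrank ℝ E' ∧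
  MapsTo S.dPlus S.bundle S.base ∧ MapsTo S.dMinus S.bundle S.base ∧
  ContMDiffOn I J ∞ S.dPlus S.bundle ∧ ContMDiffOn I J ∞ S.dMinus S.bundle ∧
  (∀ v ∈ S.bundle, Function.Surjective (mfderiv I J S.dPlus v) ∧
    Function.Surjective (mfderiv I J S.dMinus v) ∧
    ∀ ξ : TangentSpace I v, mfderiv I J S.dPlus v ξ = 0 → mfderiv I J S.dMinus v ξ = 0 → ξ = 0) ∧
  ∀ q ∈ S.base, ∃! v, v ∈ S.bundle ∧ S.dPlus v = q ∧ S.dMinus v = q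

/-- The data form a forced discrete mechanical system. -/
def IsFDMS [IsManifold I ∞ X] (S : DiscreteSystem I X Q) : Prop :=
  S.IsDiscreteTangentBundle J ∧ S.data.SmoothOn S.bundle

/-- `v_0, …, v_n` (a discrete path of length `n + 1`) is a trajectory: it is critical for all
infinitesimal variations with fixed endpoints.  An infinitesimal variation of the path consists of
vectors `δv_k` with `T∂⁺(δv_k) = T∂⁻(δv_{k+1})`. -/
def IsTrajectory (S : DiscreteSystem I X Q) {n : ℕ} (v : Fin (n + 1) → X) : Prop :=
  (∀ k, v k ∈ S.bundle) ∧ (∀ k : Fin n, S.dPlus (v k.castSucc) = S.dMinus (v k.succ)) ∧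
  ∀ δ : (k : Fin (n + 1)) → TangentSpace I (v k),
    (∀ k : Fin n, tangentMap I J S.dPlus ⟨v k.castSucc, δ k.castSucc⟩ =
      tangentMap I J S.dMinus ⟨v k.succ, δ k.succ⟩) →
    mfderiv I J S.dMinus (v 0) (δ 0) = 0 →
    mfderiv I J S.dPlus (v (Fin.last n)) (δ (Fin.last n)) = 0 →
    ∑ k, S.data.mu (v k) (δ k) = 0

/-- The critical problem on the space of discrete paths of length two
`{(v, ṽ) ∈ 𝒱 × 𝒱 | ∂⁺ v = ∂⁻ ṽ}`, with form `p₁^* μ + p₂^* μ` and map `(∂⁻ v, ∂⁺ ṽ)`. -/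
def criticalProblem (S : DiscreteSystem I X Q) :
    CriticalProblem (I.prod I) (X × X) (Q × Q) where
  carrier := {p | p.1 ∈ S.bundle ∧ p.2 ∈ S.bundle ∧ S.dPlus p.1 = S.dMinus p.2}
  form := fun p => pullback (I.prod I) I Prod.fst S.data.mu p +
    pullback (I.prod I) I Prod.snd S.data.mu p
  map := fun p => (S.dMinus p.1, S.dPlus p.2)

end DiscreteSystem

/-- The data `(Q₀, W, L_d, f_d)` of a forced discrete mechanical system on `Q₀ × Q₀`, where `Q₀` is
an open submanifold of `Q`. -/
structure DiscreteSystemQQ (Q : Type*) [TopologicalSpace Q] [ChartedSpace H' Q] where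
  /-- the configuration space -/
  base : Set Q
  /-- the domain of the discrete Lagrangian and the discrete force -/
  domain : Set (Q × Q)
  /-- discrete Lagrangian and force -/
  data : LagForce (J.prod J) (Q × Q)

namespace DiscreteSystemQQ

variable {J}

/-- The data form a forced discrete mechanical system on `Q₀ × Q₀`. -/
def IsFDMS [IsManifold J ∞ Q] (S : DiscreteSystemQQ J Q) : Prop :=
  IsOpen S.base ∧ IsOpen S.domain ∧ S.domain ⊆ S.base ×ˢ S.base ∧
  (∀ q ∈ S.base, (q, q) ∈ S.domain) ∧ S.data.SmoothOn S.domain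

/-- `q_0, …, q_n` is a trajectory (discrete Lagrange–D'Alembert principle). -/
def IsTrajectory (S : DiscreteSystemQQ J Q) {n : ℕ} (q : Fin (n + 1) → Q) : Prop :=
  (∀ k : Fin n, (q k.castSucc, q k.succ) ∈ S.domain) ∧
  ∀ δ : (k : Fin (n + 1)) → TangentSpace J (q k), δ 0 = 0 → δ (Fin.last n) = 0 →
    ∑ k : Fin n, S.data.mu (q k.castSucc, q k.succ)
      ((δ k.castSucc, δ k.succ) : E' × E') = 0

/-- The critical problem on the space of discrete paths `(q₀, q₁, q₂)`, with form
`p₀₁^* μ + p₁₂^* μ` and map `(q₀, q₂)`. -/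
def criticalProblem (S : DiscreteSystemQQ J Q) :
    CriticalProblem (J.prod (J.prod J)) (Q × Q × Q) (Q × Q) where
  carrier := {r | (r.1, r.2.1) ∈ S.domain ∧ (r.2.1, r.2.2) ∈ S.domain}
  form := fun r =>
    pullback (J.prod (J.prod J)) (J.prod J) (fun s : Q × Q × Q => (s.1, s.2.1)) S.data.mu r +
    pullback (J.prod (J.prod J)) (J.prod J) (fun s : Q × Q × Q => (s.2.1, s.2.2)) S.data.mu r
  map := fun r => (r.1, r.2.2)

end DiscreteSystemQQ

end DiscreteSystems

/-! ### Forced mechanical systems, their trajectories and their flow -/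

section Continuous

variable {E : Type*} [NormedAddCommGroup E] [NormedSpace ℝ E]
  {Q : Type*} [TopologicalSpace Q] [ChartedSpace E Q] [IsManifold 𝓘(ℝ, E) ∞ Q]

/-- The canonical involution `κ : TTQ → TTQ`, `(q, q̇, δq, δq̇) ↦ (q, δq, q̇, δq̇)` in the
coordinates induced by the preferred chart of `Q` at `q`.  (In Mathlib the tangent spaces at `q` and
at all points of `T_q Q` are written in exactly these coordinates.) -/
def canonicalInvolution
    (w : TangentBundle 𝓘(ℝ, E).tangent (TangentBundle 𝓘(ℝ, E) Q)) :
    TangentBundle 𝓘(ℝ, E).tangent (TangentBundle 𝓘(ℝ, E) Q) :=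
  let ξ : E × E := w.2
  ⟨⟨w.proj.proj, (ξ.1 : E)⟩, ((w.proj.2, ξ.2) : E × E)⟩

variable (E Q) in
/-- A forced mechanical system `(Q, L, f)`. -/
structure ForcedMechanicalSystem where
  /-- the Lagrangian -/
  lag : TangentBundle 𝓘(ℝ, E) Q → ℝ
  /-- the force -/
  force : OneForm 𝓘(ℝ, E).tangent (TangentBundle 𝓘(ℝ, E) Q)
  smooth_lag : ContMDiff 𝓘(ℝ, E).tangent 𝓘(ℝ, ℝ) ∞ lag
  smooth_force : SmoothFormOn 𝓘(ℝ, E).tangent force univ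
  /-- the force vanishes on vertical vectors -/
  horizontal : ∀ (v : TangentBundle 𝓘(ℝ, E) Q) (ξ : TangentSpace 𝓘(ℝ, E).tangent v),
    mfderiv 𝓘(ℝ, E).tangent 𝓘(ℝ, E)
      (fun u : TangentBundle 𝓘(ℝ, E) Q => u.proj) v ξ = 0 → force v ξ = 0

namespace ForcedMechanicalSystem

variable (S : ForcedMechanicalSystem E Q)

/-- Regularity: at each `v ∈ TQ` the second fibre derivative `𝔽²L(v)` is nondegenerate. -/
def IsRegular : Prop :=
  ∀ (q : Q) (v u : E),
    (∀ w : E, fderiv ℝ (fderiv ℝ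
      (fun z : E => S.lag (⟨q, z⟩ : TangentBundle 𝓘(ℝ, E) Q))) v u w = 0) → u = 0

/-- The pair `(L, f)` on `TQ`. -/
def lagForce : LagForce 𝓘(ℝ, E).tangent (TangentBundle 𝓘(ℝ, E) Q) := ⟨S.lag, S.force⟩

/-- The path `q : [a, b] → Q` is a trajectory: `∫_a^b (dL + f)(q'(t))(κ((δq)'(t))) dt = 0` for all
smooth infinitesimal variations `δq` over `q` with fixed endpoints.  Since `T τ_Q ∘ κ = τ_{TQ}`, the
base point of `κ((δq)'(t))` is `q'(t)`. -/
def IsTrajectory (q : ℝ → Q) (a b : ℝ) : Prop :=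
  ContMDiffOn 𝓘(ℝ, ℝ) 𝓘(ℝ, E) ∞ q (Icc a b) ∧
  ∀ δq : ℝ → TangentBundle 𝓘(ℝ, E) Q,
    ContMDiffOn 𝓘(ℝ, ℝ) 𝓘(ℝ, E).tangent ∞ δq (Icc a b) →
    (∀ t ∈ Icc a b, (δq t).proj = q t) → (δq a).2 = 0 → (δq b).2 = 0 →
    ∫ t in a..b,
      S.lagForce.mu
        (canonicalInvolution (velocityWithin 𝓘(ℝ, E).tangent δq (Icc a b) t)).proj
        (canonicalInvolution (velocityWithin 𝓘(ℝ, E).tangent δq (Icc a b) t)).2 = 0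

/-- Some trajectory of the system, defined on an open interval containing `0` and `t`, has velocity
`v` at time `0` and velocity `w` at time `t`. -/
def FlowRel (t : ℝ) (v w : TangentBundle 𝓘(ℝ, E) Q) : Prop :=
  ∃ (c d : ℝ) (q : ℝ → Q), 0 ∈ Ioo c d ∧ t ∈ Ioo c d ∧
    ContMDiffOn 𝓘(ℝ, ℝ) 𝓘(ℝ, E) ∞ q (Ioo c d) ∧
    (∀ a b, c < a → a < b → b < d → S.IsTrajectory q a b) ∧
    velocity 𝓘(ℝ, E) q 0 = v ∧ velocity 𝓘(ℝ, E) q t = w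

/-- The domain `U^{X_{L,f}} ⊆ ℝ × TQ` of the flow of the system. -/
def flowDomain : Set (ℝ × TangentBundle 𝓘(ℝ, E) Q) := {p | ∃ w, S.FlowRel p.1 p.2 w}

open Classical in
/-- The flow `F^{X_{L,f}}_t(v)` on `TQ`: the velocity at time `t` of the trajectory with velocity `v`
at time `0`.  (Outside of the domain of the flow the value is irrelevant.) -/
def flow (t : ℝ) (v : TangentBundle 𝓘(ℝ, E) Q) : TangentBundle 𝓘(ℝ, E) Q :=
  if h : ∃ w, S.FlowRel t v w then h.choose else v

end ForcedMechanicalSystem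

/-! ### The exact discretization of `TQ` -/

/-- The functions `α⁺, α⁻ : (-a, a) → ℝ` of a discretization of `TQ`. -/
structure BoundaryTimes where
  /-- half the length of the domain -/
  radius : ℝ
  /-- the function `α⁺` -/
  plus : ℝ → ℝ
  /-- the function `α⁻` -/
  minus : ℝ → ℝ
  radius_pos : 0 < radius
  smooth_plus : ContDiffOn ℝ ∞ plus (Ioo (-radius) radius)
  smooth_minus : ContDiffOn ℝ ∞ minus (Ioo (-radius) radius)
  plus_sign : ∀ h ∈ Ioo (-radius) radius, 0 ≤ h * plus h
  minus_sign : ∀ h ∈ Ioo (-radius) radius, h * minus h ≤ 0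
  sub_eq : ∀ h ∈ Ioo (-radius) radius, plus h - minus h = h

namespace ForcedMechanicalSystem

variable (S : ForcedMechanicalSystem E Q) (B : BoundaryTimes)

/-- The domain `U^E ⊆ ℝ × ℝ × TQ` of the exact discretization. -/
def exactDomain : Set (ℝ × ℝ × TangentBundle 𝓘(ℝ, E) Q) :=
  {p | (p.1, p.2.2) ∈ S.flowDomain ∧ (p.2.1, p.2.2) ∈ S.flowDomain}

/-- The exact discretization `ψ^E(h, t, v) = τ_Q(F_t(v))`. -/
def exactPsi (_h t : ℝ) (v : TangentBundle 𝓘(ℝ, E) Q) : Q := (S.flow t v).proj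

/-- The exact boundary map `∂^{E+}_h`. -/
def dPlus (h : ℝ) (v : TangentBundle 𝓘(ℝ, E) Q) : Q := S.exactPsi h (B.plus h) v

/-- The exact boundary map `∂^{E-}_h`. -/
def dMinus (h : ℝ) (v : TangentBundle 𝓘(ℝ, E) Q) : Q := S.exactPsi h (B.minus h) v

/-- The map `∂^{E∓}_h = (∂^{E-}_h, ∂^{E+}_h)`. -/
def dPair (h : ℝ) (v : TangentBundle 𝓘(ℝ, E) Q) : Q × Q := (S.dMinus B h v, S.dPlus B h v)

/-- The map `(h, v) ↦ (h, ∂^{E∓}_h(v))`. -/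
def dPairTilde (p : ℝ × TangentBundle 𝓘(ℝ, E) Q) : ℝ × Q × Q := (p.1, S.dPair B p.1 p.2)

/-- The common domain of the exact boundary maps. -/
def boundaryDomain : Set (ℝ × TangentBundle 𝓘(ℝ, E) Q) :=
  {p | p.1 ∈ Ioo (-B.radius) B.radius ∧ (p.1, B.plus p.1, p.2) ∈ S.exactDomain ∧
    (p.1, B.minus p.1, p.2) ∈ S.exactDomain}

/-- `𝒰 ⊆ ℝ × TQ` and `𝒲 ⊆ ℝ × Q × Q` are sets identified, off `h = 0`, by the exact boundary maps:
`𝒰` is an open neighbourhood of `{0} × TQ` in the domain of the boundary maps, `𝒲` contains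
`{0} × Δ_Q` and is the image of `𝒰`, and `(h, v) ↦ (h, ∂^{E∓}_h(v))` is a diffeomorphism between the
open parts where `h ≠ 0`. -/
def IsAdaptedPair (U : Set (ℝ × TangentBundle 𝓘(ℝ, E) Q)) (W : Set (ℝ × Q × Q)) : Prop :=
  IsOpen U ∧ (∀ v, (0, v) ∈ U) ∧ U ⊆ S.boundaryDomain B ∧
  (∀ q, (0, q, q) ∈ W) ∧ S.dPairTilde B '' U = W ∧
  IsDiffeoOn (𝓘(ℝ, ℝ).prod 𝓘(ℝ, E).tangent) (𝓘(ℝ, ℝ).prod (𝓘(ℝ, E).prod 𝓘(ℝ, E)))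
    (S.dPairTilde B) {p ∈ U | p.1 ≠ 0} {p ∈ W | p.1 ≠ 0}

/-! ### Discretizations of a forced mechanical system -/

/-- `(Q, ψ^E, L_h, f_h)`, with `L_h` and `f_h` defined over `U`, is a discretization of the system:
both are smooth, `L_h = h L + O(h²)` and `f_h = h f + O(h²)`. -/
def IsDiscretization (U : Set (ℝ × TangentBundle 𝓘(ℝ, E) Q))
    (Δ : ℝ → LagForce 𝓘(ℝ, E).tangent (TangentBundle 𝓘(ℝ, E) Q)) : Prop :=
  ContMDiffOn (𝓘(ℝ, ℝ).prod 𝓘(ℝ, E).tangent) 𝓘(ℝ, ℝ) ∞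
    (fun p : ℝ × TangentBundle 𝓘(ℝ, E) Q => (Δ p.1).lag p.2) U ∧
  SmoothFormFamilyOn 𝓘(ℝ, E).tangent (fun h => (Δ h).force) U ∧
  (∃ r : ℝ × TangentBundle 𝓘(ℝ, E) Q → ℝ, ContinuousOn r U ∧
    ∀ p ∈ U, (Δ p.1).lag p.2 = p.1 * S.lag p.2 + p.1 ^ 2 * r p) ∧
  ∃ ρ : ℝ → OneForm 𝓘(ℝ, E).tangent (TangentBundle 𝓘(ℝ, E) Q),
    ContinuousFormFamilyOn 𝓘(ℝ, E).tangent ρ U ∧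
    ∀ p ∈ U, (Δ p.1).force p.2 = p.1 • S.force p.2 + p.1 ^ 2 • ρ p.1 p.2

/-- The families `Δ` on `TQ` and `Δ'` on `Q × Q` correspond via the exact boundary maps over `U`,
off `h = 0`: `L_h = L_{d,h} ∘ ∂^{E∓}_h` and `f_h = (∂^{E∓}_h)^* f_{d,h}`. -/
def Corresponds (U : Set (ℝ × TangentBundle 𝓘(ℝ, E) Q))
    (Δ : ℝ → LagForce 𝓘(ℝ, E).tangent (TangentBundle 𝓘(ℝ, E) Q))
    (Δ' : ℝ → LagForce (𝓘(ℝ, E).prod 𝓘(ℝ, E)) (Q × Q)) : Prop :=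
  ∀ h : ℝ, h ≠ 0 → LagForce.EqOn {v | (h, v) ∈ U} (Δ h)
    ((Δ' h).comap 𝓘(ℝ, E).tangent (𝓘(ℝ, E).prod 𝓘(ℝ, E)) (S.dPair B h))

/-- `(Q, 𝒲, L_{d,h}, f_{d,h})`, where `𝒲` is the image of `U`, is a discretization on `Q × Q` of the
system: the pull-backs of `L_{d,h}` and `f_{d,h}` by the exact boundary maps, defined for `h ≠ 0`,
extend to smooth objects over `U` that are `h L + O(h²)` and `h f + O(h²)`. -/
def IsDiscretizationQQ (U : Set (ℝ × TangentBundle 𝓘(ℝ, E) Q))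
    (Δ' : ℝ → LagForce (𝓘(ℝ, E).prod 𝓘(ℝ, E)) (Q × Q)) : Prop :=
  ∃ ext, S.IsDiscretization U ext ∧ S.Corresponds B U ext Δ'

/-- The critical problem of a discretization on `TQ`: it is posed on
`𝒞^* = {(h, v, ṽ) | h ≠ 0, (h, v), (h, ṽ) ∈ U, ∂⁺_h v = ∂⁻_h ṽ}`, with form
`p₁₂^* μ + p₁₃^* μ`, `μ = d₂L_h + f_h`, and map `(h, ∂⁻_h v, ∂⁺_h ṽ)`. -/
def criticalProblemTQ (U : Set (ℝ × TangentBundle 𝓘(ℝ, E) Q))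
    (Δ : ℝ → LagForce 𝓘(ℝ, E).tangent (TangentBundle 𝓘(ℝ, E) Q)) :
    CriticalProblem (𝓘(ℝ, ℝ).prod (𝓘(ℝ, E).tangent.prod 𝓘(ℝ, E).tangent))
      (ℝ × TangentBundle 𝓘(ℝ, E) Q × TangentBundle 𝓘(ℝ, E) Q) (ℝ × Q × Q) where
  carrier := {p | p.1 ≠ 0 ∧ (p.1, p.2.1) ∈ U ∧ (p.1, p.2.2) ∈ U ∧
    S.dPlus B p.1 p.2.1 = S.dMinus B p.1 p.2.2}
  form := fun p =>
    pullback _ (𝓘(ℝ, ℝ).prod 𝓘(ℝ, E).tangent)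
      (fun s : ℝ × TangentBundle 𝓘(ℝ, E) Q × TangentBundle 𝓘(ℝ, E) Q => (s.1, s.2.1))
      (timeForm 𝓘(ℝ, E).tangent (fun h => (Δ h).mu)) p +
    pullback _ (𝓘(ℝ, ℝ).prod 𝓘(ℝ, E).tangent)
      (fun s : ℝ × TangentBundle 𝓘(ℝ, E) Q × TangentBundle 𝓘(ℝ, E) Q => (s.1, s.2.2))
      (timeForm 𝓘(ℝ, E).tangent (fun h => (Δ h).mu)) p
  map := fun p => (p.1, S.dMinus B p.1 p.2.1, S.dPlus B p.1 p.2.2)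

/-- The open submanifold `𝒱_h ⊆ TQ` underlying the discrete tangent bundle of `Q₀` at time step
`h`. -/
def bundleAt (U : Set (ℝ × TangentBundle 𝓘(ℝ, E) Q)) (Q₀ : Set Q) (h : ℝ) :
    Set (TangentBundle 𝓘(ℝ, E) Q) :=
  {v | (h, v) ∈ U ∧ S.dPair B h v ∈ Q₀ ×ˢ Q₀}

/-- The system `Σ_h = (Q₀, 𝒱_h, L_h, f_h)` at fixed time step `h`. -/
def systemTQ (U : Set (ℝ × TangentBundle 𝓘(ℝ, E) Q)) (Q₀ : Set Q) (h : ℝ)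
    (D : LagForce 𝓘(ℝ, E).tangent (TangentBundle 𝓘(ℝ, E) Q)) :
    DiscreteSystem 𝓘(ℝ, E).tangent (TangentBundle 𝓘(ℝ, E) Q) Q where
  base := Q₀
  bundle := S.bundleAt B U Q₀ h
  dPlus := S.dPlus B h
  dMinus := S.dMinus B h
  data := D

end ForcedMechanicalSystem

/-- The critical problem of a discretization on `Q × Q`: it is posed on
`{(h, q₀, q₁, q₂) | h ≠ 0, (h, q₀, q₁), (h, q₁, q₂) ∈ 𝒲}`, with form
`p₁₂₃^* μ + p₁₃₄^* μ`, `μ = d₂₃L_{d,h} + f_{d,h}`, and map `(h, q₀, q₂)`. -/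
def criticalProblemQQ (W : Set (ℝ × Q × Q))
    (Δ' : ℝ → LagForce (𝓘(ℝ, E).prod 𝓘(ℝ, E)) (Q × Q)) :
    CriticalProblem (𝓘(ℝ, ℝ).prod (𝓘(ℝ, E).prod (𝓘(ℝ, E).prod 𝓘(ℝ, E))))
      (ℝ × Q × Q × Q) (ℝ × Q × Q) where
  carrier := {p | p.1 ≠ 0 ∧ (p.1, p.2.1, p.2.2.1) ∈ W ∧ (p.1, p.2.2.1, p.2.2.2) ∈ W}
  form := fun p =>
    pullback _ (𝓘(ℝ, ℝ).prod (𝓘(ℝ, E).prod 𝓘(ℝ, E)))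
      (fun s : ℝ × Q × Q × Q => (s.1, (s.2.1, s.2.2.1)))
      (timeForm (𝓘(ℝ, E).prod 𝓘(ℝ, E)) (fun h => (Δ' h).mu)) p +
    pullback _ (𝓘(ℝ, ℝ).prod (𝓘(ℝ, E).prod 𝓘(ℝ, E)))
      (fun s : ℝ × Q × Q × Q => (s.1, (s.2.2.1, s.2.2.2)))
      (timeForm (𝓘(ℝ, E).prod 𝓘(ℝ, E)) (fun h => (Δ' h).mu)) p
  map := fun p => (p.1, p.2.1, p.2.2.2)

/-- The set `𝒲_h ⊆ Q₀ × Q₀` at time step `h`. -/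
def domainAt (W : Set (ℝ × Q × Q)) (Q₀ : Set Q) (h : ℝ) : Set (Q × Q) :=
  {r | (h, r) ∈ W ∧ r ∈ Q₀ ×ˢ Q₀}

/-- The system `(Q₀, 𝒲_h, L_{d,h}, f_{d,h})` on `Q₀ × Q₀` at fixed time step `h`. -/
def systemQQ (W : Set (ℝ × Q × Q)) (Q₀ : Set Q) (h : ℝ)
    (D : LagForce (𝓘(ℝ, E).prod 𝓘(ℝ, E)) (Q × Q)) : DiscreteSystemQQ 𝓘(ℝ, E) Q where
  base := Q₀
  domain := domainAt W Q₀ h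
  data := D

end Continuous

end ForcedDiscrete

end

noncomputable section

namespace ForcedDiscrete

/-! ### Smoothness of superposition operators -/

section Superposition

universe u

variable {X : Type*} [TopologicalSpace X] [CompactSpace X]

/-! The numbered claims are transport of structure, once the boundary pairs have been inverted for
`h ≠ 0` by maps depending smoothly on `h`. The analysis goes into adapted pairs and the bound on the
time step: the flow is defined only variationally and has to be shown smooth, and at `h = 0` the
boundary pair degenerates to `v ↦ (q, q)`.

Flow. In a chart of `TQ` induced from `Q`, the canonical involution exchanges two coordinates
because second derivatives of transition maps are symmetric. Integration by parts and the
fundamental lemma of the calculus of variations then identify trajectories with solutions of the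
forced Euler–Lagrange equation. Regularity solves this equation for the acceleration
(`exists_acceleration`), so trajectories become integral curves of `(x, v) ↦ (v, X(x, v))`. The
local flow is smooth by the inverse function theorem in a Banach space of curves
(`exists_smooth_local_flow`): solutions are the zeros of `γ - x - ε ∫ f(γ)`, whose derivative at `ε
= 0` is a shear. `IsRegular.exists_chart_flow` shows that for short times `FlowRel` is this flow.

Rescaling. Write `m` and `p` for the two boundary maps in a chart. The position moves from `m` to
`p` during a time interval of signed length `h`, so `(p - m) / h` is a mean velocity, and the
rescaled pair `(m, (p - m) / h)` tends to the identity as `h → 0`. Moreover, its difference from the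
identity is Lipschitz with constant `1/2` near a given point, uniformly in small `h ≠ 0`
(`rescaled_flow_estimates`). Hence for small `h ≠ 0` the map `(h, v) ↦ (h, ∂⁻v, ∂⁺v)` has invertible
derivative (`exists_hasFDerivAt_equiv_of_rescaled`), it separates points near any two given vectors
(`IsRegular.eventually_injective`), and it reaches the diagonal, because the rescaled map covers a
definite ball and so attains `(q, 0)` (`IsRegular.exists_diagonal_bound`). A compact exhaustion of
`TQ`, with a step bound for each compact set, assembles the neighbourhood `𝒰`
(`IsRegular.exists_isAdaptedPair`).

Transport. An adapted pair yields an `IsInverseFamily`, along which Lagrangians and forces are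
pulled back and forth. At `h = 0` nothing is lost, since `L_0 = 0` and `f_0 = 0` for every
discretization. On the `Q × Q` side the carriers of the critical problems are open, so criticality
is an explicit equation in the variation of the middle point, `DiscreteEquation`; the trajectory
condition and the family at a given step lead to the same equation. On the `TQ` side, paths and
their tangent vectors are carried to `Q × Q` by an isomorphism of critical problems
(`CriticalProblem.IsIso`), which transfers critical points as well as the submersion condition. -/

/-- The action of continuous families of linear maps on continuous families of vectors. -/
def familyApply (X : Type*) [TopologicalSpace X] [CompactSpace X] (V W : Type*)
    [NormedAddCommGroup V] [NormedSpace ℝ V] [NormedAddCommGroup W] [NormedSpace ℝ W] :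
    C(X, V →L[ℝ] W) →L[ℝ] C(X, V) →L[ℝ] C(X, W) :=
  LinearMap.mkContinuous₂
    (LinearMap.mk₂ ℝ
      (fun (A : C(X, V →L[ℝ] W)) (η : C(X, V)) =>
        (⟨fun s => A s (η s), A.continuous.clm_apply η.continuous⟩ : C(X, W)))
      (by intros; ext; simp) (by intros; ext; simp) (by intros; ext; simp)
      (by intros; ext; simp)) 1
    (fun A η => by
      rw [one_mul]
      refine (ContinuousMap.norm_le _ (by positivity)).2 fun s => ?_
      exact ((A s).le_opNorm _).trans (mul_le_mul (A.norm_coe_le_norm s) (η.norm_coe_le_norm s)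
        (norm_nonneg (η s)) (norm_nonneg A)))

@[simp]
theorem familyApply_apply {V W : Type*}
    [NormedAddCommGroup V] [NormedSpace ℝ V] [NormedAddCommGroup W] [NormedSpace ℝ W]
    (A : C(X, V →L[ℝ] W)) (η : C(X, V)) (s : X) : familyApply X V W A η s = A s (η s) := rfl

/-- Near the compact range of `γ` the derivative `f'` is uniformly continuous, so the mean value
inequality on balls of one radius around the points `γ s` bounds the first order remainder uniformly
in `s`. -/
theorem hasFDerivAt_superposition {V W : Type*}
    [NormedAddCommGroup V] [NormedSpace ℝ V] [NormedAddCommGroup W] [NormedSpace ℝ W]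
    (f : C(V, W)) (f' : C(V, V →L[ℝ] W)) (hf : ∀ v, HasFDerivAt f (f' v) v) (γ : C(X, V)) :
    HasFDerivAt (fun γ : C(X, V) => f.comp γ) (familyApply X V W (f'.comp γ)) γ := by
  rw [hasFDerivAt_iff_isLittleO, Asymptotics.isLittleO_iff]
  intro c hc
  have hK : IsCompact (range γ) := isCompact_range γ.continuous
  have := hK.uniformContinuousAt_of_continuousAt f' (fun v _ => f'.continuous.continuousAt)
    (Metric.dist_mem_uniformity hc)
  obtain ⟨δ, hδ, hball⟩ := Metric.mem_uniformity_dist.1 this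
  filter_upwards [Metric.ball_mem_nhds γ hδ] with η hη
  refine (ContinuousMap.norm_le _ (by positivity)).2 fun s => ?_
  have hs : ‖η s - γ s‖ ≤ ‖η - γ‖ := (η - γ).norm_coe_le_norm s
  have hlt : ‖η - γ‖ < δ := by rwa [← dist_eq_norm]
  have key : ‖f (η s) - f (γ s) - (f' (γ s)) (η s - γ s)‖ ≤ c * ‖η s - γ s‖ := by
    refine (convex_ball (γ s) δ).norm_image_sub_le_of_norm_hasFDerivWithin_le'
      (fun v _ => (hf v).hasFDerivWithinAt) (fun v hv => ?_) (Metric.mem_ball_self hδ) ?_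
    · rw [← dist_eq_norm]
      have := @hball (γ s) v (by rw [dist_comm]; exact hv) (mem_range_self s)
      rw [dist_comm]; exact this.le
    · rw [Metric.mem_ball, dist_eq_norm]; exact hs.trans_lt hlt
  simp only [ContinuousMap.sub_apply, ContinuousMap.comp_apply, familyApply_apply]
  exact key.trans (mul_le_mul_of_nonneg_left hs hc.le)

/-- The derivative is again a superposition operator, for `f'`, followed by a bounded linear map;
this gives an induction on `n`. The target varies in the induction from `W` to `V →L[ℝ] W`, which is
why both spaces share a universe. -/
theorem contDiff_superposition {V : Type u} [NormedAddCommGroup V] [NormedSpace ℝ V] (n : ℕ) :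
    ∀ {W : Type u} [NormedAddCommGroup W] [NormedSpace ℝ W] (f : C(V, W)), ContDiff ℝ n f →
      ContDiff ℝ n (fun γ : C(X, V) => f.comp γ) := by
  induction n with
  | zero =>
    intro W _ _ f _
    exact contDiff_zero.2 (ContinuousMap.continuous_postcomp f)
  | succ n ih =>
    intro W _ _ f hf
    have hf' : ContDiff ℝ n (fderiv ℝ f) := hf.fderiv_right (by norm_cast)
    let f' : C(V, V →L[ℝ] W) := ⟨fderiv ℝ f, hf'.continuous⟩
    have hd := hasFDerivAt_superposition (X := X) f f'
      (fun v => (hf.differentiable (by norm_cast) v).hasFDerivAt)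
    rw [show ((n + 1 : ℕ) : WithTop ℕ∞) = (n : WithTop ℕ∞) + 1 by norm_cast,
      contDiff_succ_iff_hasFDerivAt]
    have hB : ContDiff ℝ n (familyApply X V W) := by fun_prop
    exact ⟨fun γ => familyApply X V W (f'.comp γ),
      ContDiff.comp (g := familyApply X V W) (f := fun γ : C(X, V) => f'.comp γ)
        hB (ih f' hf'), hd⟩

end Superposition

/-! ### Smooth local flows -/

section Flow

variable {V : Type*} [NormedAddCommGroup V] [NormedSpace ℝ V]

/-- The time interval of normalised solution curves. -/
abbrev UnitTime : Type := Icc (-1 : ℝ) 1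

/-- Integration of a curve from `0`. -/
def integrateFromZero (V : Type*) [NormedAddCommGroup V] [NormedSpace ℝ V] :
    C(UnitTime, V) →L[ℝ] C(UnitTime, V) :=
  LinearMap.mkContinuous
    { toFun := fun η => ⟨fun s => ∫ τ in (0 : ℝ)..s, IccExtend (by norm_num : (-1 : ℝ) ≤ 1) η τ,
        (intervalIntegral.continuous_primitive
          (fun _ _ => η.continuous.Icc_extend'.intervalIntegrable _ _) 0).comp
          continuous_subtype_val⟩
      map_add' := fun η ζ => by
        ext s
        exact intervalIntegral.integral_add (η.continuous.Icc_extend'.intervalIntegrable _ _)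
          (ζ.continuous.Icc_extend'.intervalIntegrable _ _)
      map_smul' := fun c η => by
        ext s
        exact intervalIntegral.integral_smul c _ } 1
    (fun η => by
      rw [one_mul]
      refine (ContinuousMap.norm_le _ (norm_nonneg η)).2 fun s => ?_
      refine (intervalIntegral.norm_integral_le_of_norm_le_const (C := ‖η‖)
        (fun τ _ => η.norm_coe_le_norm _)).trans ?_
      rw [sub_zero]
      exact mul_le_of_le_one_right (norm_nonneg η) (abs_le.2 s.2))

/-- The map whose zeros in the last component are the solution curves of `γ' = ε f(γ)`,
`γ(0) = x`. -/
def solutionMap (f : C(V, V)) (p : V × ℝ × C(UnitTime, V)) : V × ℝ × C(UnitTime, V) :=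
  (p.1, p.2.1, p.2.2 - ContinuousMap.const _ p.1 -
    p.2.1 • integrateFromZero V (f.comp p.2.2))

/-- Constant curves, as a continuous linear map. -/
def constCurve (V : Type*) [NormedAddCommGroup V] [NormedSpace ℝ V] : V →L[ℝ] C(UnitTime, V) :=
  LinearMap.mkContinuous
    { toFun := fun x => ContinuousMap.const _ x
      map_add' := fun _ _ => rfl
      map_smul' := fun _ _ => rfl } 1
    (fun x => by
      rw [one_mul]
      exact (ContinuousMap.norm_le _ (norm_nonneg x)).2 fun s => le_rfl)

theorem contDiff_solutionMap {f : C(V, V)} (hf : ContDiff ℝ ∞ f) :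
    ContDiff ℝ ∞ (solutionMap f) := by
  have hN : ContDiff ℝ ∞ (fun γ : C(UnitTime, V) => f.comp γ) :=
    contDiff_infty.2 fun n => contDiff_superposition n f (hf.of_le (by exact_mod_cast le_top))
  have h2 : ContDiff ℝ ∞ (fun p : V × ℝ × C(UnitTime, V) => p.2.2) := contDiff_snd.comp contDiff_snd
  have h1 : ContDiff ℝ ∞ (fun p : V × ℝ × C(UnitTime, V) => p.2.1) := contDiff_fst.comp contDiff_snd
  exact contDiff_fst.prodMk (h1.prodMk ((h2.sub ((constCurve V).contDiff.comp contDiff_fst)).sub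
    (h1.smul ((integrateFromZero V).contDiff.comp (hN.comp h2)))))

/-- The shear `(x, ε, γ) ↦ (x, ε, γ - x - ε b)`. -/
def shear (b : C(UnitTime, V)) : (V × ℝ × C(UnitTime, V)) ≃L[ℝ] (V × ℝ × C(UnitTime, V)) where
  toFun p := (p.1, p.2.1, p.2.2 - constCurve V p.1 - p.2.1 • b)
  invFun p := (p.1, p.2.1, p.2.2 + constCurve V p.1 + p.2.1 • b)
  map_add' p q := by
    refine Prod.ext rfl (Prod.ext rfl ?_)
    simp only [Prod.snd_add, Prod.fst_add, map_add, add_smul]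
    abel
  map_smul' c p := by
    refine Prod.ext rfl (Prod.ext rfl ?_)
    simp only [Prod.smul_snd, Prod.smul_fst, map_smul, smul_sub, smul_assoc, RingHom.id_apply]
  left_inv p := by
    refine Prod.ext rfl (Prod.ext rfl ?_)
    simp only
    abel
  right_inv p := by
    refine Prod.ext rfl (Prod.ext rfl ?_)
    simp only
    abel
  continuous_toFun := by fun_prop
  continuous_invFun := by fun_prop

/-- The nonlinear term carries the factor `ε`, so at `ε = 0` its derivative in `γ` drops out and
only the invertible linear part remains. -/
theorem hasFDerivAt_solutionMap {f : C(V, V)} (hf : ContDiff ℝ ∞ f) (x : V) :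
    HasFDerivAt (solutionMap f)
      ((shear (integrateFromZero V (f.comp (ContinuousMap.const _ x))) :
        (V × ℝ × C(UnitTime, V)) ≃L[ℝ] (V × ℝ × C(UnitTime, V))) :
          (V × ℝ × C(UnitTime, V)) →L[ℝ] (V × ℝ × C(UnitTime, V)))
      (x, 0, ContinuousMap.const _ x) := by
  have hN : ContDiff ℝ ∞ (fun γ : C(UnitTime, V) => f.comp γ) :=
    contDiff_infty.2 fun n => contDiff_superposition n f (hf.of_le (by exact_mod_cast le_top))
  have hd := (hN.differentiable (by simp) (ContinuousMap.const _ x)).hasFDerivAt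
  set p₀ : V × ℝ × C(UnitTime, V) := (x, 0, ContinuousMap.const _ x)
  have h1 : HasFDerivAt (fun p : V × ℝ × C(UnitTime, V) => p.1)
      (.fst ℝ V (ℝ × C(UnitTime, V))) p₀ := hasFDerivAt_fst
  have h2 : HasFDerivAt (fun p : V × ℝ × C(UnitTime, V) => p.2.1)
      (.comp (.fst ℝ ℝ C(UnitTime, V)) (.snd ℝ V (ℝ × C(UnitTime, V)))) p₀ :=
    hasFDerivAt_fst.comp p₀ hasFDerivAt_snd
  have h3 : HasFDerivAt (fun p : V × ℝ × C(UnitTime, V) => p.2.2)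
      (.comp (.snd ℝ ℝ C(UnitTime, V)) (.snd ℝ V (ℝ × C(UnitTime, V)))) p₀ :=
    hasFDerivAt_snd.comp p₀ hasFDerivAt_snd
  have h4 := ((integrateFromZero V).hasFDerivAt.comp p₀
    (HasFDerivAt.comp (f := fun p : V × ℝ × C(UnitTime, V) => p.2.2) p₀ hd h3))
  have h5 := h1.prodMk (h2.prodMk ((h3.sub ((constCurve V).hasFDerivAt.comp p₀ h1)).sub
    (h2.smul h4)))
  refine h5.congr_fderiv ?_
  ext p s <;> simp [shear, p₀]

theorem solutionMap_eq_zero_iff {f : C(V, V)} {x : V} {ε : ℝ} {γ : C(UnitTime, V)} :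
    solutionMap f (x, ε, γ) = (x, ε, 0) ↔ ∀ s : UnitTime, γ s = x +
      ε • ∫ τ in (0 : ℝ)..s, f (IccExtend (by norm_num : (-1 : ℝ) ≤ 1) γ τ) := by
  simp only [solutionMap, Prod.mk.injEq, true_and]
  rw [sub_sub, sub_eq_zero, ContinuousMap.ext_iff]
  rfl

/-- A smooth vector field on a Banach space has a smooth local flow around each point. -/
theorem exists_smooth_local_flow [CompleteSpace V] {f : V → V} (hf : ContDiff ℝ ∞ f) (x₀ : V) :
    ∃ δ > 0, ∃ G : ℝ × V → V, ContDiffOn ℝ ∞ G (Ioo (-δ) δ ×ˢ Metric.ball x₀ δ) ∧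
      (∀ x ∈ Metric.ball x₀ δ, G (0, x) = x) ∧
      ∀ t ∈ Ioo (-δ) δ, ∀ x ∈ Metric.ball x₀ δ,
        HasDerivAt (fun s => G (s, x)) (f (G (t, x))) t := by
  obtain ⟨f, rfl⟩ : ∃ g : C(V, V), ⇑g = f := ⟨⟨f, hf.continuous⟩, rfl⟩
  have h01 : (-1 : ℝ) ≤ 1 := by norm_num
  let one : UnitTime := ⟨1, right_mem_Icc.2 h01⟩
  have hT := contDiff_solutionMap hf
  set p₀ : V × ℝ × C(UnitTime, V) := (x₀, 0, ContinuousMap.const _ x₀) with hp₀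
  have hd := hasFDerivAt_solutionMap hf x₀
  let e := hT.contDiffAt.toOpenPartialHomeomorph (solutionMap f) hd (by simp)
  have he : ∀ p, e p = solutionMap f p := fun _ => rfl
  have hmem : p₀ ∈ e.source := hT.contDiffAt.mem_toOpenPartialHomeomorph_source hd (by simp)
  -- The inverse is needed smooth on a whole neighbourhood, not only at the image of `p₀`, so the
  -- points are restricted to the open set where the derivative is invertible.
  let O : Set (V × ℝ × C(UnitTime, V)) := {p | fderiv ℝ (solutionMap f) p ∈
    range ((↑) : ((V × ℝ × C(UnitTime, V)) ≃L[ℝ] (V × ℝ × C(UnitTime, V))) → _)}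
  have hO : IsOpen O := ContinuousLinearEquiv.isOpen.preimage (hT.continuous_fderiv (by simp))
  have hp₀O : p₀ ∈ O := ⟨_, hd.fderiv.symm⟩
  obtain ⟨ρ, hρ, hball⟩ := Metric.isOpen_iff.1 (e.open_source.inter hO) p₀ ⟨hmem, hp₀O⟩
  have hep₀ : e p₀ = (x₀, 0, 0) := by
    rw [he, hp₀, solutionMap_eq_zero_iff]; simp
  have hSopen : IsOpen (e.target ∩ e.symm ⁻¹' Metric.ball p₀ ρ) :=
    e.isOpen_inter_preimage_symm Metric.isOpen_ball
  have hSmem : ((x₀, 0, 0) : V × ℝ × C(UnitTime, V)) ∈ e.target ∩ e.symm ⁻¹' Metric.ball p₀ ρ := by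
    rw [← hep₀]
    exact ⟨e.map_source hmem, by
      rw [mem_preimage, e.left_inv hmem]; exact Metric.mem_ball_self hρ⟩
  obtain ⟨δ, hδ, hδS⟩ := Metric.isOpen_iff.1 hSopen _ hSmem
  have hin : ∀ x ∈ Metric.ball x₀ δ, ∀ t ∈ Ioo (-δ) δ,
      ((x, t, 0) : V × ℝ × C(UnitTime, V)) ∈ e.target ∩ e.symm ⁻¹' Metric.ball p₀ ρ := by
    intro x hx t ht
    refine hδS ?_
    rw [Metric.mem_ball, Prod.dist_eq, Prod.dist_eq, max_lt_iff, max_lt_iff]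
    exact ⟨hx, by simpa [abs_lt] using ht, by simpa using hδ⟩
  let γ : V → ℝ → C(UnitTime, V) := fun x t => (e.symm (x, t, 0)).2.2
  have hγ : ∀ x ∈ Metric.ball x₀ δ, ∀ t ∈ Ioo (-δ) δ, e.symm (x, t, 0) = (x, t, γ x t) := by
    intro x hx t ht
    have h := e.right_inv (hin x hx t ht).1
    rw [he] at h
    exact Prod.ext (congrArg Prod.fst h :) (Prod.ext (congrArg (fun q => q.2.1) h :) rfl)
  have hsol : ∀ x ∈ Metric.ball x₀ δ, ∀ t ∈ Ioo (-δ) δ, ∀ s : UnitTime, γ x t s = x +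
      t • ∫ τ in (0 : ℝ)..s, f (IccExtend h01 (γ x t) τ) := by
    intro x hx t ht
    have h := e.right_inv (hin x hx t ht).1
    rw [hγ x hx t ht, he] at h
    exact solutionMap_eq_zero_iff.1 h
  have hscale : ∀ x ∈ Metric.ball x₀ δ, ∀ t ∈ Ioo (-δ) δ, ∀ σ : UnitTime,
      γ x (σ * t) one = γ x t σ := by
    intro x hx t ht σ
    have hmul : ∀ s : UnitTime, (σ : ℝ) * s ∈ Icc (-1 : ℝ) 1 := fun s => by
      have h1 := abs_le.2 σ.2
      have h2 := abs_le.2 s.2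
      refine abs_le.1 ?_
      rw [abs_mul]
      exact mul_le_one₀ h1 (abs_nonneg _) h2
    -- The solution with parameter `t`, slowed down by `σ`, solves the equation with parameter `σ *
    -- t`. It stays in the ball where the solution map is injective, hence it is the solution
    -- selected there.
    let ζ : C(UnitTime, V) := ⟨fun s => γ x t ⟨σ * s, hmul s⟩, by fun_prop⟩
    have ht' : (σ : ℝ) * t ∈ Ioo (-δ) δ := by
      rw [mem_Ioo, ← abs_lt] at ht ⊢
      rw [abs_mul]
      exact (mul_le_of_le_one_left (abs_nonneg _) (abs_le.2 σ.2)).trans_lt ht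
    have hb := (hin x hx t ht).2
    rw [mem_preimage, hγ x hx t ht, Metric.mem_ball, Prod.dist_eq, Prod.dist_eq, max_lt_iff,
      max_lt_iff] at hb
    have hζb : ((x, (σ : ℝ) * t, ζ) : V × ℝ × C(UnitTime, V)) ∈ Metric.ball p₀ ρ := by
      rw [Metric.mem_ball, Prod.dist_eq, Prod.dist_eq, max_lt_iff, max_lt_iff]
      refine ⟨hb.1, ?_, ?_⟩
      · refine lt_of_le_of_lt ?_ hb.2.1
        simp only [p₀, dist_zero_right, Real.norm_eq_abs, abs_mul]
        exact mul_le_of_le_one_left (abs_nonneg _) (abs_le.2 σ.2)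
      · refine lt_of_le_of_lt ?_ hb.2.2
        refine (ContinuousMap.dist_le dist_nonneg).2 fun s => ?_
        exact ContinuousMap.dist_apply_le_dist (f := γ x t) (g := ContinuousMap.const _ x₀)
          ⟨σ * s, hmul s⟩
    have hζ : solutionMap f (x, (σ : ℝ) * t, ζ) = (x, (σ : ℝ) * t, 0) := by
      rw [solutionMap_eq_zero_iff]
      intro s
      have h := hsol x hx t ht ⟨σ * s, hmul s⟩
      refine h.trans ?_
      congr 1
      have h2 := intervalIntegral.smul_integral_comp_mul_left (a := 0) (b := s)
        (fun τ => f (IccExtend h01 (γ x t) τ)) (σ : ℝ)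
      rw [mul_zero] at h2
      rw [← h2, smul_smul, mul_comm t]
      congr 1
      refine intervalIntegral.integral_congr fun τ hτ => ?_
      have hτ1 : τ ∈ Icc (-1 : ℝ) 1 :=
        (uIcc_subset_Icc (by norm_num) s.2) hτ
      have hτ2 := hmul ⟨τ, hτ1⟩
      show f (IccExtend h01 (γ x t) (σ * τ)) = f (IccExtend h01 ζ τ)
      rw [IccExtend_of_mem _ _ hτ1, IccExtend_of_mem _ _ hτ2]
      rfl
    have h3 : e.symm (x, (σ : ℝ) * t, 0) = (x, (σ : ℝ) * t, ζ) := by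
      rw [← hζ, ← he]
      exact e.left_inv (hball hζb).1
    have h4 : γ x (σ * t) = ζ := by
      simp only [γ, h3]
    rw [h4]
    show γ x t _ = _
    congr 1
    exact Subtype.ext (mul_one _)
  refine ⟨δ, hδ, fun q => γ q.2 q.1 one, ?_, ?_, ?_⟩
  · rintro ⟨t, x⟩ ⟨ht, hx⟩
    have h := hin x hx t ht
    obtain ⟨A, hA⟩ := (hball h.2).2
    have hsymm : ContDiffAt ℝ ∞ e.symm (x, t, 0) :=
      e.contDiffAt_symm h.1 (by rw [hA]; exact (hT.differentiable (by simp) _).hasFDerivAt)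
        hT.contDiffAt
    have hcomp : ContDiffAt ℝ ∞
        (fun q : ℝ × V => e.symm ((q.2, q.1, 0) : V × ℝ × C(UnitTime, V))) (t, x) :=
      ContDiffAt.comp (f := fun q : ℝ × V => ((q.2, q.1, 0) : V × ℝ × C(UnitTime, V))) (t, x) hsymm
        (contDiff_snd.prodMk (contDiff_fst.prodMk contDiff_const)).contDiffAt
    exact ((ContinuousMap.evalCLM ℝ one).contDiff.contDiffAt.comp (t, x)
      (contDiffAt_snd.comp _ (contDiffAt_snd.comp _ hcomp))).contDiffWithinAt
  · intro x hx
    have := hsol x hx 0 (by simpa using hδ) one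
    simpa using this
  · intro t ht x hx
    -- With `ε` strictly between `|t|` and `δ`, the scaling identity writes all values at times near
    -- `t` through the single curve `γ x ε` at parameter `s / ε`. The integral equation can then be
    -- differentiated by the fundamental theorem of calculus.
    obtain ⟨ε, htε, hεδ⟩ := exists_between (abs_lt.2 ht)
    have hε : 0 < ε := (abs_nonneg t).trans_lt htε
    have hε' : ε ∈ Ioo (-δ) δ := ⟨by linarith, hεδ⟩
    have hdiv : ∀ s : ℝ, |s| < ε → s / ε ∈ Icc (-1 : ℝ) 1 := fun s hs => by
      refine abs_le.1 ?_
      rw [abs_div, abs_of_pos hε, div_le_one hε]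
      exact hs.le
    have hG : ∀ s : ℝ, |s| < ε → γ x s one = IccExtend h01 (γ x ε) (s / ε) := fun s hs => by
      rw [IccExtend_of_mem _ _ (hdiv s hs), ← hscale x hx ε hε' ⟨s / ε, hdiv s hs⟩]
      simp only
      rw [div_mul_cancel₀ _ hε.ne']
    have hev : (fun s => γ x s one) =ᶠ[𝓝 t] fun s => x +
        ε • ∫ τ in (0 : ℝ)..(s / ε), f (IccExtend h01 (γ x ε) τ) := by
      filter_upwards [(isOpen_lt continuous_abs continuous_const).mem_nhds htε] with s hs
      rw [hG s hs, IccExtend_of_mem _ _ (hdiv s hs)]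
      exact hsol x hx ε hε' ⟨s / ε, hdiv s hs⟩
    have hcont : Continuous fun τ => f (IccExtend h01 (γ x ε) τ) :=
      f.continuous.comp (γ x ε).continuous.Icc_extend'
    have h1 := (hcont.integral_hasStrictDerivAt 0 (t / ε)).hasDerivAt
    have h2 := (h1.scomp t ((hasDerivAt_id t).div_const ε)).const_smul ε |>.const_add x
    refine (h2.congr_of_eventuallyEq hev).congr_deriv ?_
    rw [smul_smul, mul_one_div_cancel hε.ne', one_smul]
    exact congrArg f (hG t htε).symm

end Flow

/-! ### Local flows of vector fields on open sets -/

/-- Multiply by a bump function equal to `1` near `z`, whose support lies in a ball inside `D`; the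
product vanishes near every point outside `D`. This replaces a field on an open set by a global one
without changing it near `z`. -/
theorem exists_contDiff_eventuallyEq {V W : Type*} [NormedAddCommGroup V] [NormedSpace ℝ V]
    [FiniteDimensional ℝ V] [NormedAddCommGroup W] [NormedSpace ℝ W] {f : V → W} {D : Set V}
    (hD : IsOpen D) (hf : ContDiffOn ℝ ∞ f D) {z : V} (hz : z ∈ D) :
    ∃ g : V → W, ContDiff ℝ ∞ g ∧ g =ᶠ[𝓝 z] f := by
  obtain ⟨r, hr, hball⟩ := Metric.isOpen_iff.1 hD z hz
  let χ : ContDiffBump z := ⟨r / 4, r / 2, by linarith, by linarith⟩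
  refine ⟨fun v => χ v • f v, contDiff_iff_contDiffAt.2 fun v => ?_, ?_⟩
  · by_cases hv : v ∈ D
    · exact χ.contDiffAt.smul (hf.contDiffAt (hD.mem_nhds hv))
    · have hv' : v ∉ tsupport χ := fun h => hv (hball (Metric.closedBall_subset_ball
        (by show r / 2 < r; linarith) (χ.tsupport_eq ▸ h)))
      have : (fun v => χ v • f v) =ᶠ[𝓝 v] fun _ => 0 := by
        filter_upwards [(isClosed_tsupport χ).isOpen_compl.mem_nhds hv'] with w hw
        rw [image_eq_zero_of_notMem_tsupport hw, zero_smul]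
      exact contDiffAt_const.congr_of_eventuallyEq this
  · filter_upwards [χ.eventuallyEq_one] with v hv
    rw [hv, Pi.one_apply, one_smul]

/-- A smooth vector field on an open set has a smooth local flow inside any neighbourhood of a
point. -/
theorem exists_smooth_local_flow_on {V : Type*} [NormedAddCommGroup V] [NormedSpace ℝ V]
    [FiniteDimensional ℝ V] {f : V → V} {D : Set V} (hD : IsOpen D) (hf : ContDiffOn ℝ ∞ f D)
    {z : V} (hz : z ∈ D) :
    ∃ δ > 0, ∃ G : ℝ × V → V, ContDiffOn ℝ ∞ G (Ioo (-δ) δ ×ˢ Metric.ball z δ) ∧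
      (∀ x ∈ Metric.ball z δ, G (0, x) = x) ∧
      ∀ t ∈ Ioo (-δ) δ, ∀ x ∈ Metric.ball z δ, G (t, x) ∈ D ∧
        HasDerivAt (fun s => G (s, x)) (f (G (t, x))) t := by
  have := FiniteDimensional.complete ℝ V
  obtain ⟨g, hg, hgf⟩ := exists_contDiff_eventuallyEq hD hf hz
  obtain ⟨δ, hδ, G, hG, hG0, hGd⟩ := exists_smooth_local_flow hg z
  obtain ⟨r, hr, hball⟩ := Metric.mem_nhds_iff.1 (hgf.and (hD.mem_nhds hz))
  have h0 : ((0 : ℝ), z) ∈ Ioo (-δ) δ ×ˢ Metric.ball z δ :=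
    ⟨⟨by linarith, hδ⟩, Metric.mem_ball_self hδ⟩
  have hcont : ContinuousAt G (0, z) := hG.continuousOn.continuousAt
    ((isOpen_Ioo.prod Metric.isOpen_ball).mem_nhds h0)
  -- For short times and nearby starting points the flow stays where the extended field agrees with
  -- `f`, and inside `D`.
  have hmem : G ⁻¹' Metric.ball z r ∈ 𝓝 ((0 : ℝ), z) := by
    refine hcont.preimage_mem_nhds ?_
    rw [hG0 z (Metric.mem_ball_self hδ)]
    exact Metric.ball_mem_nhds z hr
  obtain ⟨η, hη, hηball⟩ := Metric.mem_nhds_iff.1 hmem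
  have hsub : Ioo (-min δ η) (min δ η) ×ˢ Metric.ball z (min δ η) ⊆
      Ioo (-δ) δ ×ˢ Metric.ball z δ := by
    refine prod_mono (Ioo_subset_Ioo ?_ (min_le_left _ _)) (Metric.ball_subset_ball (min_le_left _ _))
    exact neg_le_neg (min_le_left _ _)
  refine ⟨min δ η, lt_min hδ hη, G, hG.mono hsub,
    fun x hx => hG0 x (Metric.ball_subset_ball (min_le_left _ _) hx), fun t ht x hx => ?_⟩
  have hm := hsub (mk_mem_prod ht hx)
  have hb : ((t, x) : ℝ × V) ∈ Metric.ball ((0 : ℝ), z) η := by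
    rw [Metric.mem_ball, Prod.dist_eq, max_lt_iff]
    refine ⟨?_, lt_of_lt_of_le hx (min_le_right _ _)⟩
    rw [dist_zero_right, Real.norm_eq_abs, abs_lt]
    exact ⟨by linarith [ht.1, min_le_right δ η], by linarith [ht.2, min_le_right δ η]⟩
  have h := hball (hηball hb)
  exact ⟨h.2, (hGd t hm.1 x hm.2).congr_deriv h.1⟩

/-! ### The Euler–Lagrange equations with forces in a vector space -/

section Flat

variable {E : Type*} [NormedAddCommGroup E] [NormedSpace ℝ E]

/-- The fibre derivative of a Lagrangian. -/
def momentum (ℓ : E × E → ℝ) (z : E × E) : E →L[ℝ] ℝ :=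
  (fderiv ℝ ℓ z).comp (.inr ℝ E E)

/-- The defect of the forced Euler–Lagrange equation at position and velocity `z` and
acceleration `w`. -/
def eulerLagrange (ℓ : E × E → ℝ) (F : E × E → E →L[ℝ] ℝ) (z : E × E) (w : E) : E →L[ℝ] ℝ :=
  (fderiv ℝ ℓ z).comp (.inl ℝ E E) + F z - fderiv ℝ (momentum ℓ) z (z.2, w)

variable {ℓ : E × E → ℝ} {F : E × E → E →L[ℝ] ℝ} {D : Set (E × E)}

theorem contDiffOn_fderiv_of_isOpen {V W : Type*} [NormedAddCommGroup V] [NormedSpace ℝ V]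
    [NormedAddCommGroup W] [NormedSpace ℝ W] {f : V → W} {D : Set V} (hD : IsOpen D)
    (hf : ContDiffOn ℝ ∞ f D) : ContDiffOn ℝ ∞ (fderiv ℝ f) D :=
  hf.fderiv_of_isOpen hD (by simp)

theorem contDiffOn_momentum (hD : IsOpen D) (hℓ : ContDiffOn ℝ ∞ ℓ D) :
    ContDiffOn ℝ ∞ (momentum ℓ) D :=
  (contDiffOn_fderiv_of_isOpen hD hℓ).clm_comp contDiffOn_const

/-- For a regular Lagrangian the forced Euler–Lagrange equation can be solved for the
acceleration. -/
theorem exists_acceleration [FiniteDimensional ℝ E] (hD : IsOpen D) (hℓ : ContDiffOn ℝ ∞ ℓ D)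
    (hF : ContDiffOn ℝ ∞ F D)
    (hreg : ∀ z ∈ D, ∀ u : E, (∀ w, fderiv ℝ (momentum ℓ) z (0, u) w = 0) → u = 0) :
    ∃ X : E × E → E, ContDiffOn ℝ ∞ X D ∧
      ∀ z ∈ D, ∀ w, eulerLagrange ℓ F z w = 0 ↔ w = X z := by
  have := FiniteDimensional.complete ℝ E
  let A : E × E → E →L[ℝ] E →L[ℝ] ℝ := fun z => (fderiv ℝ (momentum ℓ) z).comp (.inr ℝ E E)
  let b : E × E → E →L[ℝ] ℝ := fun z => (fderiv ℝ ℓ z).comp (.inl ℝ E E) + F z -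
    (fderiv ℝ (momentum ℓ) z).comp (.inl ℝ E E) z.2
  have hp := contDiffOn_fderiv_of_isOpen hD (contDiffOn_momentum hD hℓ)
  have hA : ContDiffOn ℝ ∞ A D := hp.clm_comp contDiffOn_const
  have hb : ContDiffOn ℝ ∞ b D :=
    (((contDiffOn_fderiv_of_isOpen hD hℓ).clm_comp contDiffOn_const).add hF).sub
      ((hp.clm_comp contDiffOn_const).clm_apply contDiffOn_snd)
  -- Regularity says that the fibre Hessian is injective as a map from `E` to its dual; the two
  -- spaces have the same dimension, so it is an isomorphism. The equation is affine in the
  -- acceleration with this linear part.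
  have hequiv : ∀ z ∈ D, ∃ e : E ≃L[ℝ] (E →L[ℝ] ℝ), (e : E →L[ℝ] E →L[ℝ] ℝ) = A z := by
    intro z hz
    have hinj : Function.Injective (A z : E →ₗ[ℝ] E →L[ℝ] ℝ) := by
      rw [injective_iff_map_eq_zero]
      intro u hu
      exact hreg z hz u fun w => by
        have : A z u = 0 := hu
        exact congrArg (fun L : E →L[ℝ] ℝ => L w) this
    have hdim : Module.finrank ℝ E = Module.finrank ℝ (E →L[ℝ] ℝ) := by
      rw [(LinearMap.toContinuousLinearMap (𝕜 := ℝ) (E := E) (F' := ℝ)).symm.finrank_eq]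
      exact (Subspace.dual_finrank_eq).symm
    exact ⟨(LinearEquiv.ofInjectiveOfFinrankEq (A z : E →ₗ[ℝ] E →L[ℝ] ℝ) hinj
      hdim).toContinuousLinearEquiv, by ext; rfl⟩
  refine ⟨fun z => (A z).inverse (b z), fun z hz => ?_, fun z hz w => ?_⟩
  · obtain ⟨e, he⟩ := hequiv z hz
    have h := contDiffAt_map_inverse (𝕜 := ℝ) (n := ∞) e
    rw [he] at h
    exact ((h.comp_contDiffWithinAt z (hA z hz)).clm_apply (hb z hz))
  · obtain ⟨e, he⟩ := hequiv z hz
    have hsplit : eulerLagrange ℓ F z w = b z - e w := by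
      have h1 : ((z.2, w) : E × E) = (z.2, 0) + (0, w) := by simp
      have h2 : e w = A z w := by rw [← he]; rfl
      rw [eulerLagrange, h1, map_add, h2]
      simp only [A, b, ContinuousLinearMap.comp_apply, ContinuousLinearMap.inl_apply,
        ContinuousLinearMap.inr_apply]
      abel
    rw [hsplit, sub_eq_zero]
    simp only
    rw [← he, ContinuousLinearMap.inverse_equiv]
    constructor
    · intro h; rw [h]; simp
    · intro h; rw [h]; simp

/-- Integration by parts in the first variation. -/
theorem integral_variation (hD : IsOpen D) (hℓ : ContDiffOn ℝ ∞ ℓ D) (hF : ContDiffOn ℝ ∞ F D)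
    {x : ℝ → E} {s : Set ℝ} (hs : IsOpen s) (hx : ContDiffOn ℝ ∞ x s)
    (hxD : ∀ t ∈ s, (x t, deriv x t) ∈ D) {a b : ℝ} (hab : a < b) (hsub : Icc a b ⊆ s)
    {u : ℝ → E} (hu : ContDiffOn ℝ 1 u (Icc a b)) (ha : u a = 0) (hb : u b = 0) :
    ∫ t in a..b, (fderiv ℝ ℓ (x t, deriv x t) (u t, derivWithin u (Icc a b) t) +
        F (x t, deriv x t) (u t)) =
      ∫ t in a..b, eulerLagrange ℓ F (x t, deriv x t) (deriv (deriv x) t) (u t) := by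
  have hx1 : ContDiffOn ℝ ∞ (deriv x) s := hx.deriv_of_isOpen hs (by simp)
  have hx2 : ContDiffOn ℝ ∞ (deriv (deriv x)) s := hx1.deriv_of_isOpen hs (by simp)
  have hz : ContDiffOn ℝ ∞ (fun t => (x t, deriv x t)) s := hx.prodMk hx1
  have hu' : ContinuousOn (derivWithin u (Icc a b)) (Icc a b) :=
    hu.continuousOn_derivWithin (uniqueDiffOn_Icc hab) le_rfl
  have hp := contDiffOn_momentum hD hℓ
  have hdp := contDiffOn_fderiv_of_isOpen hD hp
  have hdℓ := contDiffOn_fderiv_of_isOpen hD hℓ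
  have hzc : ContinuousOn (fun t => (x t, deriv x t)) (Icc a b) := hz.continuousOn.mono hsub
  have hzm : MapsTo (fun t => (x t, deriv x t)) (Icc a b) D := fun t ht => hxD t (hsub ht)
  have c1 : ContinuousOn (fun t => fderiv ℝ ℓ (x t, deriv x t)
      (u t, derivWithin u (Icc a b) t) + F (x t, deriv x t) (u t)) (Icc a b) :=
    ((hdℓ.continuousOn.comp hzc hzm).clm_apply (hu.continuousOn.prodMk hu')).add
      ((hF.continuousOn.comp hzc hzm).clm_apply hu.continuousOn)
  have c2 : ContinuousOn (fun t => eulerLagrange ℓ F (x t, deriv x t) (deriv (deriv x) t) (u t))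
      (Icc a b) := by
    refine ContinuousOn.clm_apply (ContinuousOn.sub (ContinuousOn.add ?_ ?_) ?_) hu.continuousOn
    · exact (hdℓ.continuousOn.comp hzc hzm).clm_comp continuousOn_const
    · exact hF.continuousOn.comp hzc hzm
    · exact (hdp.continuousOn.comp hzc hzm).clm_apply
        ((hx1.continuousOn.mono hsub).prodMk (hx2.continuousOn.mono hsub))
  have i1 := c1.intervalIntegrable_of_Icc (μ := MeasureTheory.volume) hab.le
  have i2 := c2.intervalIntegrable_of_Icc (μ := MeasureTheory.volume) hab.le
  rw [← sub_eq_zero, ← intervalIntegral.integral_sub i1 i2]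
  -- The two integrands differ by the derivative of `momentum ℓ (x, x') u`, which vanishes at both
  -- ends together with `u`.
  have hfund := intervalIntegral.integral_eq_sub_of_hasDerivAt_of_le
    (f := fun t => momentum ℓ (x t, deriv x t) (u t)) hab.le
    ((hp.continuousOn.comp hzc hzm).clm_apply hu.continuousOn) (fun t ht => ?_) (i1.sub i2)
  · rw [hfund]; simp [ha, hb]
  · have hts : t ∈ s := hsub (Ioo_subset_Icc_self ht)
    have hsn := hs.mem_nhds hts
    have d1 : HasDerivAt (fun t => (x t, deriv x t)) (deriv x t, deriv (deriv x) t) t :=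
      ((hx.contDiffAt hsn).differentiableAt (by simp)).hasDerivAt.prodMk
        ((hx1.contDiffAt hsn).differentiableAt (by simp)).hasDerivAt
    have d2 : HasFDerivAt (momentum ℓ) (fderiv ℝ (momentum ℓ) (x t, deriv x t)) (x t, deriv x t) :=
      ((hp.contDiffAt (hD.mem_nhds (hxD t hts))).differentiableAt (by simp)).hasFDerivAt
    have d3 : HasDerivAt u (derivWithin u (Icc a b) t) t :=
      ((hu.differentiableOn (by simp) t
        (Ioo_subset_Icc_self ht)).hasDerivWithinAt).hasDerivAt (Icc_mem_nhds ht.1 ht.2)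
    have d4 : HasDerivAt (fun t => momentum ℓ (x t, deriv x t))
        (fderiv ℝ (momentum ℓ) (x t, deriv x t) (deriv x t, deriv (deriv x) t)) t :=
      HasFDerivAt.comp_hasDerivAt (l := momentum ℓ) (f := fun t => (x t, deriv x t)) t d2 d1
    have d5 := d4.clm_apply d3
    refine d5.congr_deriv ?_
    have hsp : ((u t, derivWithin u (Icc a b) t) : E × E) =
      (u t, 0) + (0, derivWithin u (Icc a b) t) := by simp
    rw [hsp, map_add]
    simp only [eulerLagrange, momentum, ContinuousLinearMap.comp_apply,
      ContinuousLinearMap.inl_apply, ContinuousLinearMap.inr_apply, sub_apply, add_apply]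
    ring

/-- The fundamental lemma of the calculus of variations for the forced Euler–Lagrange equation. -/
theorem eulerLagrange_eq_zero_of_variations (hD : IsOpen D) (hℓ : ContDiffOn ℝ ∞ ℓ D)
    (hF : ContDiffOn ℝ ∞ F D) {x : ℝ → E} {s : Set ℝ} (hs : IsOpen s) (hx : ContDiffOn ℝ ∞ x s)
    (hxD : ∀ t ∈ s, (x t, deriv x t) ∈ D) {a b : ℝ} (hab : a < b) (hsub : Icc a b ⊆ s)
    (h : ∀ u : ℝ → E, ContDiff ℝ ∞ u → u a = 0 → u b = 0 →
      ∫ t in a..b, (fderiv ℝ ℓ (x t, deriv x t) (u t, derivWithin u (Icc a b) t) +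
        F (x t, deriv x t) (u t)) = 0) :
    ∀ t ∈ Ioo a b, eulerLagrange ℓ F (x t, deriv x t) (deriv (deriv x) t) = 0 := by
  have hx1 : ContDiffOn ℝ ∞ (deriv x) s := hx.deriv_of_isOpen hs (by simp)
  have hx2 : ContDiffOn ℝ ∞ (deriv (deriv x)) s := hx1.deriv_of_isOpen hs (by simp)
  have hz : ContDiffOn ℝ ∞ (fun t => (x t, deriv x t)) s := hx.prodMk hx1
  have hzm : MapsTo (fun t => (x t, deriv x t)) s D := fun t ht => hxD t ht
  have c2 : ContinuousOn (fun t => eulerLagrange ℓ F (x t, deriv x t) (deriv (deriv x) t))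
      s := by
    refine ContinuousOn.sub (ContinuousOn.add ?_ ?_) ?_
    · exact ((contDiffOn_fderiv_of_isOpen hD hℓ).continuousOn.comp hz.continuousOn hzm).clm_comp
        continuousOn_const
    · exact hF.continuousOn.comp hz.continuousOn hzm
    · exact ((contDiffOn_fderiv_of_isOpen hD (contDiffOn_momentum hD hℓ)).continuousOn.comp
        hz.continuousOn hzm).clm_apply (hx1.continuousOn.prodMk hx2.continuousOn)
  have hIoo : Ioo a b ⊆ s := Ioo_subset_Icc_self.trans hsub
  suffices H : ∀ e : E, EqOn
      (fun t => eulerLagrange ℓ F (x t, deriv x t) (deriv (deriv x) t) e) 0 (Ioo a b) by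
    intro t ht
    ext e
    exact H e ht
  intro e
  have c3 : ContinuousOn (fun t => eulerLagrange ℓ F (x t, deriv x t) (deriv (deriv x) t) e)
      (Ioo a b) := (c2.mono hIoo).clm_apply continuousOn_const
  refine MeasureTheory.Measure.eqOn_open_of_ae_eq (μ := MeasureTheory.volume) ?_ isOpen_Ioo c3
    continuousOn_const
  rw [Filter.EventuallyEq, MeasureTheory.ae_restrict_iff' measurableSet_Ioo]
  -- The test variations are `g • e`, with `g` supported inside `(a, b)` and `e` fixed. They give
  -- vanishing almost everywhere, and continuity of the defect makes it vanish everywhere.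
  refine isOpen_Ioo.ae_eq_zero_of_integral_contDiff_smul_eq_zero
    (c3.locallyIntegrableOn measurableSet_Ioo) fun g hg _ hgs => ?_
  have ha : a ∉ tsupport g := fun h => (hgs h).1.false
  have hb : b ∉ tsupport g := fun h => (hgs h).2.false
  have hu : ContDiff ℝ ∞ (fun t => g t • e) := hg.smul contDiff_const
  have ha0 : g a • e = 0 := by rw [image_eq_zero_of_notMem_tsupport ha, zero_smul]
  have hb0 : g b • e = 0 := by rw [image_eq_zero_of_notMem_tsupport hb, zero_smul]
  have h1 := h _ hu ha0 hb0
  rw [integral_variation hD hℓ hF hs hx hxD hab hsub (hu.of_le (by simp)).contDiffOn ha0 hb0] at h1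
  rw [intervalIntegral.integral_of_le hab.le] at h1
  rw [← h1, ← MeasureTheory.setIntegral_eq_integral_of_forall_compl_eq_zero (s := Ioc a b)]
  · simp
  · intro t ht
    have : t ∉ tsupport g := fun h => ht (Ioo_subset_Ioc_self (hgs h))
    rw [image_eq_zero_of_notMem_tsupport this, zero_smul]

end Flat

/-! ### Induced charts of the tangent bundle -/

section Charts

variable {E : Type*} [NormedAddCommGroup E] [NormedSpace ℝ E]
  {Q : Type*} [TopologicalSpace Q] [ChartedSpace E Q] [IsManifold 𝓘(ℝ, E) ∞ Q]

theorem two_le_infty : (2 : WithTop ℕ∞) ≤ ∞ :=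
  WithTop.coe_le_coe.2 le_top

/-- All tangent spaces are by definition the model space, so base points and vectors can be compared
separately, without transport between fibres. -/
theorem tangentBundle_mk_eq_mk {E' H' M : Type*} [NormedAddCommGroup E'] [NormedSpace ℝ E']
    [TopologicalSpace H'] {I : ModelWithCorners ℝ E' H'} [TopologicalSpace M] [ChartedSpace H' M]
    {x y : M} (h : x = y) {a b : E'} (hab : a = b) :
    (⟨x, a⟩ : TangentBundle I M) = ⟨y, b⟩ := by
  subst h; subst hab; rfl

theorem tangentBundle_mk_eq_mk_iff {E' H' M : Type*} [NormedAddCommGroup E'] [NormedSpace ℝ E']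
    [TopologicalSpace H'] {I : ModelWithCorners ℝ E' H'} [TopologicalSpace M] [ChartedSpace H' M]
    {x y : M} {a b : E'} : (⟨x, a⟩ : TangentBundle I M) = ⟨y, b⟩ ↔ x = y ∧ a = b := by
  constructor
  · intro h
    have h1 : x = y := congrArg (fun v : TangentBundle I M => v.proj) h
    subst h1
    exact ⟨rfl, eq_of_heq (Bundle.TotalSpace.mk.inj h).2⟩
  · rintro ⟨h, h'⟩
    exact tangentBundle_mk_eq_mk h h'

/-- The chart of `TQ` induced by the preferred chart of `Q` at `q`. -/
def tchart (q : Q) : PartialEquiv (TangentBundle 𝓘(ℝ, E) Q) (E × E) :=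
  extChartAt 𝓘(ℝ, E).tangent (⟨q, 0⟩ : TangentBundle 𝓘(ℝ, E) Q)

theorem mem_tchart_source {q : Q} {v : TangentBundle 𝓘(ℝ, E) Q} :
    v ∈ (tchart q).source ↔ v.proj ∈ (chartAt E q).source := by
  rw [tchart, extChartAt_source, TangentBundle.mem_chart_source_iff]

theorem mem_tchart_target {q : Q} {z : E × E} :
    z ∈ (tchart q : PartialEquiv (TangentBundle 𝓘(ℝ, E) Q) (E × E)).target ↔
      z.1 ∈ (chartAt E q).target := by
  have h := TangentBundle.mem_chart_target_iff (I := 𝓘(ℝ, E)) (M := Q) z ⟨q, 0⟩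
  rw [tchart, extChartAt_target]
  exact ⟨fun h' => h.1 h'.1, fun h' => ⟨h.2 h', ⟨z, rfl⟩⟩⟩

theorem isOpen_tchart_source (q : Q) :
    IsOpen (tchart q : PartialEquiv (TangentBundle 𝓘(ℝ, E) Q) (E × E)).source :=
  isOpen_extChartAt_source _

theorem isOpen_tchart_target (q : Q) :
    IsOpen (tchart q : PartialEquiv (TangentBundle 𝓘(ℝ, E) Q) (E × E)).target := by
  have : (tchart q : PartialEquiv (TangentBundle 𝓘(ℝ, E) Q) (E × E)).target =
      Prod.fst ⁻¹' (chartAt E q).target := by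
    ext z; exact mem_tchart_target
  rw [this]
  exact (chartAt E q).open_target.preimage continuous_fst

theorem contMDiffOn_tchart (q : Q) : ContMDiffOn 𝓘(ℝ, E).tangent 𝓘(ℝ, E × E) ∞
    (tchart q : TangentBundle 𝓘(ℝ, E) Q → E × E) (tchart q).source := by
  rw [tchart, extChartAt_source]
  exact contMDiffOn_extChartAt

theorem contMDiffOn_tchart_symm (q : Q) : ContMDiffOn 𝓘(ℝ, E × E) 𝓘(ℝ, E).tangent ∞
    ((tchart q).symm : E × E → TangentBundle 𝓘(ℝ, E) Q)
    (tchart q : PartialEquiv (TangentBundle 𝓘(ℝ, E) Q) (E × E)).target :=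
  contMDiffOn_extChartAt_symm _

theorem tchart_apply (q : Q) (v : TangentBundle 𝓘(ℝ, E) Q) :
    tchart q v = (chartAt E q v.proj, tangentCoordChange 𝓘(ℝ, E) v.proj q v.proj v.2) := rfl

/-- The transition map from the chart at `q₀` to the chart at `q`. -/
def transition (E : Type*) [NormedAddCommGroup E] [NormedSpace ℝ E] {Q : Type*}
    [TopologicalSpace Q] [ChartedSpace E Q] (q₀ q : Q) (x : E) : E :=
  chartAt E q ((chartAt E q₀).symm x)

theorem contDiffAt_transition {q₀ q : Q} {x : E} (hx : x ∈ (chartAt E q₀).target)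
    (hq : (chartAt E q₀).symm x ∈ (chartAt E q).source) :
    ContDiffAt ℝ ∞ (transition E q₀ q) x := by
  rw [← contMDiffAt_iff_contDiffAt]
  have h1 : ContMDiffAt 𝓘(ℝ, E) 𝓘(ℝ, E) ∞ (chartAt E q₀).symm x :=
    (contMDiffOn_chart_symm (I := 𝓘(ℝ, E)) (n := ∞)).contMDiffAt
      ((chartAt E q₀).open_target.mem_nhds hx)
  have h2 : ContMDiffAt 𝓘(ℝ, E) 𝓘(ℝ, E) ∞ (chartAt E q) ((chartAt E q₀).symm x) :=
    (contMDiffOn_chart (I := 𝓘(ℝ, E)) (n := ∞)).contMDiffAt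
      ((chartAt E q).open_source.mem_nhds hq)
  exact h2.comp x h1

theorem tangentCoordChange_eq_fderiv {q₀ q : Q} {x : E} (hx : x ∈ (chartAt E q₀).target) :
    tangentCoordChange 𝓘(ℝ, E) q₀ q ((chartAt E q₀).symm x) =
      fderiv ℝ (transition E q₀ q) x := by
  rw [tangentCoordChange_def]
  simp only [mfld_simps, fderivWithin_univ]
  rw [(chartAt E q₀).right_inv hx]
  rfl

theorem tchart_symm_apply {q : Q} {z : E × E} (hz : z.1 ∈ (chartAt E q).target) :
    (tchart q).symm z = (⟨(chartAt E q).symm z.1,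
      fderiv ℝ (transition E q ((chartAt E q).symm z.1)) z.1 z.2⟩ : TangentBundle 𝓘(ℝ, E) Q) := by
  rw [← tangentCoordChange_eq_fderiv hz]
  rfl

theorem tchart_tchart_symm {q₀ q : Q} {z : E × E} (hz : z.1 ∈ (chartAt E q₀).target)
    (hq : (chartAt E q₀).symm z.1 ∈ (chartAt E q).source) :
    tchart q ((tchart q₀).symm z : TangentBundle 𝓘(ℝ, E) Q) =
      (transition E q₀ q z.1, fderiv ℝ (transition E q₀ q) z.1 z.2) := by
  refine Prod.ext rfl ?_
  rw [← tangentCoordChange_eq_fderiv hz]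
  exact tangentCoordChange_comp ⟨⟨by
    rw [extChartAt_source]; exact (chartAt E q₀).map_target hz, by
    rw [extChartAt_source]; exact mem_chart_source E _⟩, by rw [extChartAt_source]; exact hq⟩

/-- Tangent vectors at a point of `TQ` over `q` are written in the chart induced by the preferred
chart at `q`. There the map reads `(x, u) ↦ (ψ x, Dψ(x) u)` with `ψ` the transition map, and
differentiating the second entry produces the term with `D²ψ`. -/
theorem mfderiv_tchart_symm {q₀ : Q} {z : E × E} (hz : z.1 ∈ (chartAt E q₀).target) (a b : E) :
    mfderiv 𝓘(ℝ, E × E) 𝓘(ℝ, E).tangent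
      ((tchart q₀).symm : E × E → TangentBundle 𝓘(ℝ, E) Q) z ((a, b) : E × E) =
      ((fderiv ℝ (transition E q₀ ((chartAt E q₀).symm z.1)) z.1 a,
        fderiv ℝ (fderiv ℝ (transition E q₀ ((chartAt E q₀).symm z.1))) z.1 a z.2 +
        fderiv ℝ (transition E q₀ ((chartAt E q₀).symm z.1)) z.1 b) : E × E) := by
  set q := (chartAt E q₀).symm z.1
  have hzt := (isOpen_tchart_target q₀).mem_nhds (mem_tchart_target.2 hz)
  have hd : MDifferentiableAt 𝓘(ℝ, E × E) 𝓘(ℝ, E).tangent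
      ((tchart q₀).symm : E × E → TangentBundle 𝓘(ℝ, E) Q) z :=
    ((contMDiffOn_tchart_symm q₀).contMDiffAt hzt).mdifferentiableAt (by simp)
  have hq : q ∈ (chartAt E q).source := mem_chart_source E q
  have hψ : ContDiffAt ℝ ∞ (transition E q₀ q) z.1 := contDiffAt_transition hz hq
  have hev : writtenInExtChartAt 𝓘(ℝ, E × E) 𝓘(ℝ, E).tangent z
      ((tchart q₀).symm : E × E → TangentBundle 𝓘(ℝ, E) Q) =ᶠ[𝓝 z]
      fun y => (transition E q₀ q y.1, fderiv ℝ (transition E q₀ q) y.1 y.2) := by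
    have h1 : (chartAt E q₀).target ∩ (chartAt E q₀).symm ⁻¹' (chartAt E q).source ∈ 𝓝 z.1 :=
      ((chartAt E q₀).isOpen_inter_preimage_symm (chartAt E q).open_source).mem_nhds ⟨hz, hq⟩
    filter_upwards [continuous_fst.continuousAt.preimage_mem_nhds h1] with y hy
    rw [← tchart_tchart_symm hy.1 hy.2]
    rfl
  have h1 : HasFDerivAt (fun y : E × E => transition E q₀ q y.1)
      ((fderiv ℝ (transition E q₀ q) z.1).comp (.fst ℝ E E)) z :=
    HasFDerivAt.comp (f := Prod.fst) z (hψ.differentiableAt (by simp)).hasFDerivAt hasFDerivAt_fst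
  have hψ' : ContDiffAt ℝ ∞ (fderiv ℝ (transition E q₀ q)) z.1 := hψ.fderiv_right (by simp)
  have h2 : HasFDerivAt (fun y : E × E => fderiv ℝ (transition E q₀ q) y.1)
      ((fderiv ℝ (fderiv ℝ (transition E q₀ q)) z.1).comp (.fst ℝ E E)) z :=
    HasFDerivAt.comp (f := Prod.fst) z (hψ'.differentiableAt (by simp)).hasFDerivAt hasFDerivAt_fst
  have h3 := h1.prodMk (h2.clm_apply (hasFDerivAt_snd (𝕜 := ℝ) (p := z)))
  have h4 : HasMFDerivAt 𝓘(ℝ, E × E) 𝓘(ℝ, E).tangent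
      ((tchart q₀).symm : E × E → TangentBundle 𝓘(ℝ, E) Q) z _ :=
    ⟨hd.continuousAt, (h3.congr_of_eventuallyEq hev).hasFDerivWithinAt⟩
  rw [h4.mfderiv]
  refine Prod.ext (α := E) (β := E) rfl ?_
  exact add_comm _ _

/-- The canonical involution exchanges `u` and `a` in the coordinates `(x, u, a, b)` induced by
any chart. -/
theorem canonicalInvolution_tchart_symm {q₀ : Q} {x u a b : E} (hx : x ∈ (chartAt E q₀).target) :
    canonicalInvolution (⟨(tchart q₀).symm (x, u), mfderiv 𝓘(ℝ, E × E) 𝓘(ℝ, E).tangent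
        ((tchart q₀).symm : E × E → TangentBundle 𝓘(ℝ, E) Q) (x, u) ((a, b) : E × E)⟩ :
        TangentBundle 𝓘(ℝ, E).tangent (TangentBundle 𝓘(ℝ, E) Q)) =
      ⟨(tchart q₀).symm (x, a), mfderiv 𝓘(ℝ, E × E) 𝓘(ℝ, E).tangent
        ((tchart q₀).symm : E × E → TangentBundle 𝓘(ℝ, E) Q) (x, a) ((u, b) : E × E)⟩ := by
  -- Exchanging `u` and `a` changes the coordinate formula only in the term `D²ψ(a)(u)`, and
  -- symmetry of the second derivative absorbs the change.
  have hsymm := ((contDiffAt_transition (q := (chartAt E q₀).symm x) hx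
    (mem_chart_source E _)).isSymmSndFDerivAt (by
      rw [minSmoothness_of_isRCLikeNormedField]; exact two_le_infty)).eq a u
  unfold canonicalInvolution
  refine tangentBundle_mk_eq_mk ?_ ?_
  · rw [tchart_symm_apply (z := (x, a)) hx, mfderiv_tchart_symm (z := (x, u)) hx]
    rfl
  · rw [mfderiv_tchart_symm (z := (x, u)) hx, mfderiv_tchart_symm (z := (x, a)) hx,
      tchart_symm_apply (z := (x, u)) hx]
    refine Prod.ext rfl ?_
    simp only
    rw [hsymm]

/-- The velocity of a curve in `TQ` in terms of its coordinates. -/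
theorem velocityWithin_tchart_symm {q₀ : Q} {z : ℝ → E × E} {s : Set ℝ} {t : ℝ}
    (hs : UniqueDiffWithinAt ℝ s t) (hz : DifferentiableWithinAt ℝ z s t)
    (hzt : (z t).1 ∈ (chartAt E q₀).target) {c : ℝ → TangentBundle 𝓘(ℝ, E) Q}
    (hc : EqOn c (fun τ => (tchart q₀).symm (z τ)) s) (ht : t ∈ s) :
    velocityWithin 𝓘(ℝ, E).tangent c s t = ⟨(tchart q₀).symm (z t),
      mfderiv 𝓘(ℝ, E × E) 𝓘(ℝ, E).tangent
        ((tchart q₀).symm : E × E → TangentBundle 𝓘(ℝ, E) Q) (z t) (derivWithin z s t)⟩ := by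
  have hd : MDifferentiableAt 𝓘(ℝ, E × E) 𝓘(ℝ, E).tangent
      ((tchart q₀).symm : E × E → TangentBundle 𝓘(ℝ, E) Q) (z t) :=
    ((contMDiffOn_tchart_symm q₀).contMDiffAt
      ((isOpen_tchart_target q₀).mem_nhds (mem_tchart_target.2 hzt))).mdifferentiableAt (by simp)
  refine tangentBundle_mk_eq_mk (hc ht) ?_
  have h1 := mfderivWithin_congr (I := 𝓘(ℝ, ℝ)) (I' := 𝓘(ℝ, E).tangent) hc (hc ht)
  have h2 := mfderiv_comp_mfderivWithin (I := 𝓘(ℝ, ℝ)) (I' := 𝓘(ℝ, E × E))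
    (I'' := 𝓘(ℝ, E).tangent) (f := z) (s := s) t hd hz.mdifferentiableWithinAt
    hs.uniqueMDiffWithinAt
  have h3 : mfderivWithin 𝓘(ℝ, ℝ) 𝓘(ℝ, E × E) z s t (1 : ℝ) = derivWithin z s t := by
    rw [mfderivWithin_eq_fderivWithin]
    rfl
  refine (congrArg (fun L : ℝ →L[ℝ] E × E => L 1) (h1.trans h2)).trans ?_
  exact congrArg (mfderiv 𝓘(ℝ, E × E) 𝓘(ℝ, E).tangent
    ((tchart q₀).symm : E × E → TangentBundle 𝓘(ℝ, E) Q) (z t)) h3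

/-- The velocity of a curve in `Q` in terms of its coordinates. -/
theorem velocity_chart_symm {q₀ : Q} {x : ℝ → E} {t : ℝ} (hx : DifferentiableAt ℝ x t)
    (hxt : x t ∈ (chartAt E q₀).target) {c : ℝ → Q}
    (hc : c =ᶠ[𝓝 t] (fun τ => (chartAt E q₀).symm (x τ))) :
    velocity 𝓘(ℝ, E) c t = (tchart q₀).symm (x t, deriv x t) := by
  have hct : c t = (chartAt E q₀).symm (x t) := hc.eq_of_nhds
  rw [tchart_symm_apply (z := (x t, deriv x t)) hxt]
  refine tangentBundle_mk_eq_mk hct ?_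
  have hcont : ContinuousAt c t :=
    (((chartAt E q₀).continuousAt_symm hxt).comp hx.continuousAt).congr hc.symm
  have hψ := contDiffAt_transition (q := (chartAt E q₀).symm (x t)) hxt (mem_chart_source E _)
  have h1 : HasDerivAt (fun τ => transition E q₀ ((chartAt E q₀).symm (x t)) (x τ))
      (fderiv ℝ (transition E q₀ ((chartAt E q₀).symm (x t))) (x t) (deriv x t)) t :=
    HasFDerivAt.comp_hasDerivAt (l := transition E q₀ ((chartAt E q₀).symm (x t))) (f := x) t
      (hψ.differentiableAt (by simp)).hasFDerivAt hx.hasDerivAt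
  have h2 : writtenInExtChartAt 𝓘(ℝ, ℝ) 𝓘(ℝ, E) t c =ᶠ[𝓝 t]
      fun τ => transition E q₀ ((chartAt E q₀).symm (x t)) (x τ) := by
    filter_upwards [hc] with τ hτ
    show chartAt E (c t) (c τ) = _
    rw [hct, hτ]
    rfl
  have h3 : HasMFDerivAt 𝓘(ℝ, ℝ) 𝓘(ℝ, E) c t (ContinuousLinearMap.toSpanSingleton ℝ
      (fderiv ℝ (transition E q₀ ((chartAt E q₀).symm (x t))) (x t) (deriv x t))) := by
    exact ⟨hcont, (h1.congr_of_eventuallyEq h2).hasFDerivAt.hasFDerivWithinAt⟩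
  rw [h3.mfderiv]
  exact one_smul ℝ _

end Charts

/-! ### Tangent maps over open sets -/

section TangentMaps

variable {E : Type*} [NormedAddCommGroup E] [NormedSpace ℝ E]
  {H : Type*} [TopologicalSpace H] {I : ModelWithCorners ℝ E H}
  {M : Type*} [TopologicalSpace M] [ChartedSpace H M]
  {E' : Type*} [NormedAddCommGroup E'] [NormedSpace ℝ E']
  {H' : Type*} [TopologicalSpace H'] {J : ModelWithCorners ℝ E' H'}
  {N : Type*} [TopologicalSpace N] [ChartedSpace H' N]

theorem contMDiffOn_tangentMap_of_isOpen [IsManifold I ∞ M] [IsManifold J ∞ N] {f : M → N}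
    {s : Set M} (hs : IsOpen s) (hf : ContMDiffOn I J ∞ f s) :
    ContMDiffOn I.tangent J.tangent ∞ (tangentMap I J f)
      {ξ : TangentBundle I M | ξ.proj ∈ s} := by
  refine (hf.contMDiffOn_tangentMapWithin (m := ∞) (by simp) hs.uniqueMDiffOn).congr ?_
  intro ξ hξ
  rw [tangentMap, tangentMapWithin, mfderivWithin_of_isOpen hs hξ]

end TangentMaps

/-! ### Forced mechanical systems in coordinates -/

theorem fderiv_transition_self {E : Type*} [NormedAddCommGroup E] [NormedSpace ℝ E] {Q : Type*}
    [TopologicalSpace Q] [ChartedSpace E Q] {q : Q} {x : E} (hx : x ∈ (chartAt E q).target) :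
    fderiv ℝ (transition E q q) x = .id ℝ E := by
  have : transition E q q =ᶠ[𝓝 x] id := by
    filter_upwards [(chartAt E q).open_target.mem_nhds hx] with y hy
    exact (chartAt E q).right_inv hy
  rw [this.fderiv_eq, fderiv_id]

section Coordinates

variable {E : Type*} [NormedAddCommGroup E] [NormedSpace ℝ E]
  {Q : Type*} [TopologicalSpace Q] [ChartedSpace E Q] [IsManifold 𝓘(ℝ, E) ∞ Q]

theorem mdifferentiableAt_tchart_symm {q₀ : Q} {z : E × E} (hz : z.1 ∈ (chartAt E q₀).target) :
    MDifferentiableAt 𝓘(ℝ, E × E) 𝓘(ℝ, E).tangent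
      ((tchart q₀).symm : E × E → TangentBundle 𝓘(ℝ, E) Q) z :=
  ((contMDiffOn_tchart_symm q₀).contMDiffAt
    ((isOpen_tchart_target q₀).mem_nhds (mem_tchart_target.2 hz))).mdifferentiableAt (by simp)

namespace ForcedMechanicalSystem

variable (S : ForcedMechanicalSystem E Q)

/-- The Lagrangian in the chart at `q₀`. -/
def chartLag (q₀ : Q) (z : E × E) : ℝ := S.lag ((tchart q₀).symm z)

/-- The force in the chart at `q₀`. -/
def chartForce (q₀ : Q) (z : E × E) : E →L[ℝ] ℝ :=
  (S.force ((tchart q₀).symm z)).comp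
    ((mfderiv 𝓘(ℝ, E × E) 𝓘(ℝ, E).tangent
      ((tchart q₀).symm : E × E → TangentBundle 𝓘(ℝ, E) Q) z : E × E →L[ℝ] _).comp (.inl ℝ E E))

theorem contDiffOn_chartLag (q₀ : Q) : ContDiffOn ℝ ∞ (S.chartLag q₀)
    (tchart q₀ : PartialEquiv (TangentBundle 𝓘(ℝ, E) Q) (E × E)).target := by
  rw [← contMDiffOn_iff_contDiffOn]
  exact S.smooth_lag.comp_contMDiffOn (contMDiffOn_tchart_symm q₀)

/-- Smoothness of a form is phrased through its values on tangent vectors, so it is tested on the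
images of the constant fields `(u, 0)`. In finite dimension these values control the operator-valued
map. -/
theorem contDiffOn_chartForce [FiniteDimensional ℝ E] (q₀ : Q) : ContDiffOn ℝ ∞ (S.chartForce q₀)
    (tchart q₀ : PartialEquiv (TangentBundle 𝓘(ℝ, E) Q) (E × E)).target := by
  rw [contDiffOn_clm_apply]
  intro u
  rw [← contMDiffOn_iff_contDiffOn]
  have h1 : ContMDiff 𝓘(ℝ, E × E) 𝓘(ℝ, E × E).tangent ∞
      (fun z => (⟨z, ((u, 0) : E × E)⟩ : TangentBundle 𝓘(ℝ, E × E) (E × E))) :=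
    contMDiff_vectorSpace_iff_contDiff.2 contDiff_const
  have h2 := contMDiffOn_tangentMap_of_isOpen (isOpen_tchart_target q₀)
    (contMDiffOn_tchart_symm (E := E) q₀)
  have h3 := S.smooth_force.comp (h2.comp h1.contMDiffOn fun z hz => hz) fun z _ => mem_univ _
  exact h3

/-- In coordinates the projection `TQ → Q` is the first coordinate followed by the inverse chart, so
the image of `(0, w)` is vertical. -/
theorem force_tchart_symm_vertical {q₀ : Q} {z : E × E} (hz : z.1 ∈ (chartAt E q₀).target)
    (w : E) : S.force ((tchart q₀).symm z) (mfderiv 𝓘(ℝ, E × E) 𝓘(ℝ, E).tangent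
      ((tchart q₀).symm : E × E → TangentBundle 𝓘(ℝ, E) Q) z ((0, w) : E × E)) = 0 := by
  refine S.horizontal _ _ ?_
  have hd := mdifferentiableAt_tchart_symm hz
  have hp : MDifferentiableAt 𝓘(ℝ, E).tangent 𝓘(ℝ, E)
      (fun u : TangentBundle 𝓘(ℝ, E) Q => u.proj) ((tchart q₀).symm z) :=
    (Bundle.contMDiff_proj (TangentSpace 𝓘(ℝ, E) : Q → Type _) (n := 1)).mdifferentiableAt (by simp)
  have hc := mfderiv_comp z hp hd
  have hφ : MDifferentiableAt 𝓘(ℝ, E) 𝓘(ℝ, E) (chartAt E q₀).symm z.1 :=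
    ((contMDiffOn_chart_symm (I := 𝓘(ℝ, E)) (n := 1)).contMDiffAt
      ((chartAt E q₀).open_target.mem_nhds hz)).mdifferentiableAt (by simp)
  have hf : MDifferentiableAt 𝓘(ℝ, E × E) 𝓘(ℝ, E) (Prod.fst : E × E → E) z :=
    differentiableAt_fst.mdifferentiableAt
  have hc' := mfderiv_comp z hφ hf
  have h1 := congrArg (fun L : E × E →L[ℝ] E => L (0, w)) (hc.symm.trans hc')
  refine h1.trans ?_
  have h2 : mfderiv 𝓘(ℝ, E × E) 𝓘(ℝ, E) (Prod.fst : E × E → E) z ((0, w) : E × E) = (0 : E) := by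
    rw [mfderiv_eq_fderiv, fderiv_fst]
    rfl
  refine (congrArg (mfderiv 𝓘(ℝ, E) 𝓘(ℝ, E) (chartAt E q₀).symm z.1) h2).trans ?_
  exact map_zero (mfderiv 𝓘(ℝ, E) 𝓘(ℝ, E) (chartAt E q₀).symm z.1)

/-- The chain rule handles `dL`. The force sees only `u`, because `w` contributes a vertical vector.
This is the integrand of the first variation, with `w` in the role of the derivative of the
variation `u`. -/
theorem mu_tchart_symm {q₀ : Q} {z : E × E} (hz : z.1 ∈ (chartAt E q₀).target) (u w : E) :
    S.lagForce.mu ((tchart q₀).symm z) (mfderiv 𝓘(ℝ, E × E) 𝓘(ℝ, E).tangent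
      ((tchart q₀).symm : E × E → TangentBundle 𝓘(ℝ, E) Q) z ((u, w) : E × E)) =
      fderiv ℝ (S.chartLag q₀) z (u, w) + S.chartForce q₀ z u := by
  have hd := mdifferentiableAt_tchart_symm hz
  have hl : MDifferentiableAt 𝓘(ℝ, E).tangent 𝓘(ℝ, ℝ) S.lag ((tchart q₀).symm z) :=
    S.smooth_lag.mdifferentiableAt (by simp)
  have h1 : fderiv ℝ (S.chartLag q₀) z (u, w) = mvfderiv 𝓘(ℝ, E).tangent S.lag ((tchart q₀).symm z)
      (mfderiv 𝓘(ℝ, E × E) 𝓘(ℝ, E).tangent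
      ((tchart q₀).symm : E × E → TangentBundle 𝓘(ℝ, E) Q) z ((u, w) : E × E)) := by
    rw [← mfderiv_eq_fderiv]
    exact congrArg (fun L : E × E →L[ℝ] ℝ => L (u, w)) (mfderiv_comp z hl hd)
  have h2 : S.force ((tchart q₀).symm z) (mfderiv 𝓘(ℝ, E × E) 𝓘(ℝ, E).tangent
      ((tchart q₀).symm : E × E → TangentBundle 𝓘(ℝ, E) Q) z ((u, w) : E × E)) =
      S.chartForce q₀ z u := by
    have hs : mfderiv 𝓘(ℝ, E × E) 𝓘(ℝ, E).tangent
      ((tchart q₀).symm : E × E → TangentBundle 𝓘(ℝ, E) Q) z ((u, w) : E × E) =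
      mfderiv 𝓘(ℝ, E × E) 𝓘(ℝ, E).tangent
      ((tchart q₀).symm : E × E → TangentBundle 𝓘(ℝ, E) Q) z ((u, 0) : E × E) +
      mfderiv 𝓘(ℝ, E × E) 𝓘(ℝ, E).tangent
      ((tchart q₀).symm : E × E → TangentBundle 𝓘(ℝ, E) Q) z ((0, w) : E × E) := by
      have hsp : ((u, w) : E × E) = (u, 0) + (0, w) := by simp
      rw [hsp]
      exact map_add (mfderiv 𝓘(ℝ, E × E) 𝓘(ℝ, E).tangent
        ((tchart q₀).symm : E × E → TangentBundle 𝓘(ℝ, E) Q) z) _ _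
    rw [hs, map_add, S.force_tchart_symm_vertical hz w, add_zero]
    rfl
  rw [h1, ← h2]
  rfl

theorem fderiv_fderiv_slice {ℓ : E × E → ℝ} {D : Set (E × E)} (hD : IsOpen D)
    (hℓ : ContDiffOn ℝ ∞ ℓ D) {z : E × E} (hz : z ∈ D) (u w : E) :
    fderiv ℝ (fderiv ℝ (fun y => ℓ (z.1, y))) z.2 u w = fderiv ℝ (momentum ℓ) z (0, u) w := by
  have hsl : ∀ y : E, HasFDerivAt (fun y : E => (z.1, y)) (.inr ℝ E E) y := fun y =>
    hasFDerivAt_prodMk_right z.1 y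
  have hev : fderiv ℝ (fun y => ℓ (z.1, y)) =ᶠ[𝓝 z.2] fun y => momentum ℓ (z.1, y) := by
    have : (fun y : E => (z.1, y)) ⁻¹' D ∈ 𝓝 z.2 :=
      (hsl z.2).continuousAt.preimage_mem_nhds (hD.mem_nhds hz)
    filter_upwards [this] with y hy
    exact (HasFDerivAt.comp y (((hℓ.contDiffAt (hD.mem_nhds hy)).differentiableAt
      (by simp)).hasFDerivAt) (hsl y)).fderiv
  rw [hev.fderiv_eq]
  have hm : HasFDerivAt (momentum ℓ) (fderiv ℝ (momentum ℓ) (z.1, z.2)) (z.1, z.2) :=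
    ((((contDiffOn_momentum hD hℓ).contDiffAt (hD.mem_nhds hz)).differentiableAt
      (by simp))).hasFDerivAt
  have hc : HasFDerivAt (fun y => momentum ℓ (z.1, y)) _ z.2 := HasFDerivAt.comp z.2 hm (hsl z.2)
  rw [hc.fderiv]
  rfl

/-- Regularity in coordinates. -/
theorem IsRegular.chart {S : ForcedMechanicalSystem E Q} (hS : S.IsRegular) {q₀ : Q} {z : E × E}
    (hz : z.1 ∈ (chartAt E q₀).target) (u : E)
    (hu : ∀ w, fderiv ℝ (momentum (S.chartLag q₀)) z (0, u) w = 0) : u = 0 := by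
  have hD := isOpen_tchart_target (E := E) q₀
  set q := (chartAt E q₀).symm z.1 with hq
  set L : E →L[ℝ] E := fderiv ℝ (transition E q₀ q) z.1 with hL
  have hq₀ : q ∈ (chartAt E q₀).source := (chartAt E q₀).map_target hz
  have hLinj : ∀ v, tangentCoordChange 𝓘(ℝ, E) q q₀ q (L v) = v := fun v => by
    rw [hL, ← tangentCoordChange_eq_fderiv hz, tangentCoordChange_comp, tangentCoordChange_self]
    · rw [extChartAt_source]; exact hq₀
    · simp only [extChartAt_source]
      exact ⟨⟨hq₀, mem_chart_source E q⟩, hq₀⟩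
  have hLsurj : ∀ v, L (tangentCoordChange 𝓘(ℝ, E) q q₀ q v) = v := fun v => by
    rw [hL, ← tangentCoordChange_eq_fderiv hz, tangentCoordChange_comp, tangentCoordChange_self]
    · rw [extChartAt_source]; exact mem_chart_source E q
    · simp only [extChartAt_source]
      exact ⟨⟨mem_chart_source E q, hq₀⟩, mem_chart_source E q⟩
  let f : E → ℝ := fun y => S.lag (⟨q, y⟩ : TangentBundle 𝓘(ℝ, E) Q)
  have hf : ContDiff ℝ ∞ f := by
    have hm : chartAt E q q ∈ (chartAt E q).target := mem_chart_target E q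
    have : f = fun y => S.chartLag q (chartAt E q q, y) := by
      funext y
      simp only [f, chartLag]
      rw [tchart_symm_apply hm]
      congr 1
      refine (tangentBundle_mk_eq_mk ((chartAt E q).left_inv (mem_chart_source E q)) ?_).symm
      simp only [(chartAt E q).left_inv (mem_chart_source E q), fderiv_transition_self hm]
      rfl
    rw [this, ← contDiffOn_univ]
    exact (S.contDiffOn_chartLag q).comp (contDiff_const.prodMk contDiff_id).contDiffOn
      fun y _ => mem_tchart_target.2 hm
  -- On the fibre over `q` the chart Lagrangian is the intrinsic one composed with the linear
  -- isomorphism `L`. Second derivatives therefore correspond through `L`, and nondegeneracy passes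
  -- to the chart.
  have hslice : (fun y => S.chartLag q₀ (z.1, y)) = fun y => f (L y) := by
    funext y
    simp only [f, chartLag]
    rw [tchart_symm_apply (z := (z.1, y)) hz]
  have hsecond : ∀ u w, fderiv ℝ (fderiv ℝ (fun y => f (L y))) z.2 u w =
      fderiv ℝ (fderiv ℝ f) (L z.2) (L u) (L w) := by
    intro u w
    have h1 : fderiv ℝ (fun y => f (L y)) = fun y => (fderiv ℝ f (L y)).comp L := by
      funext y
      exact (HasFDerivAt.comp y ((hf.differentiable (by simp) (L y)).hasFDerivAt)
        L.hasFDerivAt).fderiv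
    have h2 : HasFDerivAt (fun y => fderiv ℝ f (L y)) ((fderiv ℝ (fderiv ℝ f) (L z.2)).comp L) z.2 :=
      HasFDerivAt.comp z.2 (((hf.fderiv_right (m := ∞) (by simp)).differentiable (by simp)
        (L z.2)).hasFDerivAt) L.hasFDerivAt
    rw [h1, (h2.clm_comp (hasFDerivAt_const L z.2)).fderiv]
    simp
  have hzero : L u = 0 := by
    refine hS q (L z.2) (L u) fun w => ?_
    have h := hu (tangentCoordChange 𝓘(ℝ, E) q q₀ q w)
    rw [← fderiv_fderiv_slice hD (S.contDiffOn_chartLag q₀) (mem_tchart_target.2 hz), hslice,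
      hsecond, hLsurj] at h
    exact h
  rw [← hLinj u, hzero, map_zero]

/-- The acceleration field in the chart at `q₀`. -/
theorem IsRegular.exists_chart_acceleration [FiniteDimensional ℝ E]
    {S : ForcedMechanicalSystem E Q} (hS : S.IsRegular) (q₀ : Q) :
    ∃ X : E × E → E, ContDiffOn ℝ ∞ X
        (tchart q₀ : PartialEquiv (TangentBundle 𝓘(ℝ, E) Q) (E × E)).target ∧
      ∀ z : E × E, z.1 ∈ (chartAt E q₀).target → ∀ w,
        eulerLagrange (S.chartLag q₀) (S.chartForce q₀) z w = 0 ↔ w = X z := by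
  obtain ⟨X, hX, hX'⟩ := exists_acceleration (isOpen_tchart_target q₀) (S.contDiffOn_chartLag q₀)
    (S.contDiffOn_chartForce q₀) fun z hz u hu => hS.chart (mem_tchart_target.1 hz) u hu
  exact ⟨X, hX, fun z hz w => hX' z (mem_tchart_target.2 hz) w⟩

/-- The integrand of the first variation in coordinates. -/
theorem variation_integrand {q₀ : Q} {q : ℝ → Q} {s : Set ℝ} (hs : IsOpen s)
    (hq : ContMDiffOn 𝓘(ℝ, ℝ) 𝓘(ℝ, E) ∞ q s) (hqs : ∀ t ∈ s, q t ∈ (chartAt E q₀).source)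
    {a b : ℝ} (hab : a < b) (hsub : Icc a b ⊆ s) {δq : ℝ → TangentBundle 𝓘(ℝ, E) Q}
    {u : ℝ → E} (hu : DifferentiableOn ℝ u (Icc a b))
    (hδ : ∀ t ∈ Icc a b, δq t = (tchart q₀).symm (chartAt E q₀ (q t), u t)) {t : ℝ}
    (ht : t ∈ Icc a b) :
    S.lagForce.mu
        (canonicalInvolution (velocityWithin 𝓘(ℝ, E).tangent δq (Icc a b) t)).proj
        (canonicalInvolution (velocityWithin 𝓘(ℝ, E).tangent δq (Icc a b) t)).2 =
      fderiv ℝ (S.chartLag q₀) (chartAt E q₀ (q t), deriv (fun τ => chartAt E q₀ (q τ)) t)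
        (u t, derivWithin u (Icc a b) t) +
      S.chartForce q₀ (chartAt E q₀ (q t), deriv (fun τ => chartAt E q₀ (q τ)) t) (u t) := by
  set x : ℝ → E := fun τ => chartAt E q₀ (q τ) with hx
  have hxs : ContDiffOn ℝ ∞ x s := by
    rw [← contMDiffOn_iff_contDiffOn]
    exact (contMDiffOn_chart (I := 𝓘(ℝ, E)) (n := ∞)).comp hq hqs
  have hxt : x t ∈ (chartAt E q₀).target := (chartAt E q₀).map_source (hqs t (hsub ht))
  have hud : UniqueDiffWithinAt ℝ (Icc a b) t := uniqueDiffOn_Icc hab t ht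
  have hxd : DifferentiableAt ℝ x t :=
    (hxs.contDiffAt (hs.mem_nhds (hsub ht))).differentiableAt (by simp)
  have hz : HasDerivWithinAt (fun τ => (x τ, u τ)) (deriv x t, derivWithin u (Icc a b) t)
      (Icc a b) t :=
    hxd.hasDerivAt.hasDerivWithinAt.prodMk (hu t ht).hasDerivWithinAt
  have hv := velocityWithin_tchart_symm (q₀ := q₀) hud hz.differentiableWithinAt hxt
    (c := δq) hδ ht
  have hdw : derivWithin (fun τ => (x τ, u τ)) (Icc a b) t =
      (deriv x t, derivWithin u (Icc a b) t) := hz.derivWithin hud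
  rw [hv.trans (tangentBundle_mk_eq_mk rfl (congrArg (mfderiv 𝓘(ℝ, E × E) 𝓘(ℝ, E).tangent
    ((tchart q₀).symm : E × E → TangentBundle 𝓘(ℝ, E) Q) (x t, u t)) hdw)),
    canonicalInvolution_tchart_symm hxt]
  exact S.mu_tchart_symm hxt (u t) _

/-- Solutions of the Euler–Lagrange equation in a chart are trajectories. -/
theorem isTrajectory_of_eulerLagrange [FiniteDimensional ℝ E] {q₀ : Q} {q : ℝ → Q} {s : Set ℝ}
    (hs : IsOpen s)
    (hq : ContMDiffOn 𝓘(ℝ, ℝ) 𝓘(ℝ, E) ∞ q s) (hqs : ∀ t ∈ s, q t ∈ (chartAt E q₀).source)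
    (hEL : ∀ t ∈ s, eulerLagrange (S.chartLag q₀) (S.chartForce q₀)
      (chartAt E q₀ (q t), deriv (fun τ => chartAt E q₀ (q τ)) t)
      (deriv (deriv fun τ => chartAt E q₀ (q τ)) t) = 0)
    {a b : ℝ} (hab : a < b) (hsub : Icc a b ⊆ s) : S.IsTrajectory q a b := by
  refine ⟨hq.mono hsub, fun δq hδq hproj ha hb => ?_⟩
  set x : ℝ → E := fun τ => chartAt E q₀ (q τ) with hx
  have hxs : ContDiffOn ℝ ∞ x s := by
    rw [← contMDiffOn_iff_contDiffOn]
    exact (contMDiffOn_chart (I := 𝓘(ℝ, E)) (n := ∞)).comp hq hqs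
  have hxt : ∀ t ∈ s, x t ∈ (chartAt E q₀).target := fun t ht => (chartAt E q₀).map_source (hqs t ht)
  let u : ℝ → E := fun t => (tchart q₀ (δq t)).2
  have hmaps : MapsTo δq (Icc a b) (tchart q₀).source := fun t ht =>
    mem_tchart_source.2 (by rw [hproj t ht]; exact hqs t (hsub ht))
  have hus : ContDiffOn ℝ ∞ u (Icc a b) := by
    have h := (contMDiffOn_tchart (E := E) q₀).comp hδq hmaps
    rw [contMDiffOn_iff_contDiffOn] at h
    exact contDiff_snd.comp_contDiffOn h
  have hδ : ∀ t ∈ Icc a b, δq t = (tchart q₀).symm (x t, u t) := fun t ht => by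
    have h := (tchart q₀).left_inv (hmaps ht)
    have h2 : tchart q₀ (δq t) = (x t, u t) := by
      refine Prod.ext ?_ rfl
      rw [tchart_apply, hproj t ht]
    rw [← h2, h]
  have hu0 : ∀ t ∈ Icc a b, (δq t).2 = 0 → u t = 0 := fun t ht h0 => by
    exact (congrArg (tangentCoordChange 𝓘(ℝ, E) (δq t).proj q₀ (δq t).proj) h0).trans
      (map_zero (tangentCoordChange 𝓘(ℝ, E) (δq t).proj q₀ (δq t).proj))
  rw [intervalIntegral.integral_congr (g := fun t => fderiv ℝ (S.chartLag q₀) (x t, deriv x t)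
      (u t, derivWithin u (Icc a b) t) + S.chartForce q₀ (x t, deriv x t) (u t))
    (fun t ht => S.variation_integrand hs hq hqs hab hsub (hus.differentiableOn (by simp)) hδ
      (by rwa [uIcc_of_le hab.le] at ht))]
  rw [integral_variation (isOpen_tchart_target q₀) (S.contDiffOn_chartLag q₀)
    (S.contDiffOn_chartForce q₀) hs hxs (fun t ht => mem_tchart_target.2 (hxt t ht)) hab hsub
    (hus.of_le (by simp)) (hu0 a (left_mem_Icc.2 hab.le) ha) (hu0 b (right_mem_Icc.2 hab.le) hb)]
  rw [intervalIntegral.integral_congr (g := fun _ => (0 : ℝ)) fun t ht => ?_]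
  · simp
  · rw [uIcc_of_le hab.le] at ht
    simp only
    rw [hEL t (hsub ht)]
    rfl

/-- Trajectories satisfy the Euler–Lagrange equation in a chart. -/
theorem eulerLagrange_of_isTrajectory [FiniteDimensional ℝ E] {q₀ : Q} {q : ℝ → Q} {s : Set ℝ}
    (hs : IsOpen s)
    (hq : ContMDiffOn 𝓘(ℝ, ℝ) 𝓘(ℝ, E) ∞ q s) (hqs : ∀ t ∈ s, q t ∈ (chartAt E q₀).source)
    {a b : ℝ} (hab : a < b) (hsub : Icc a b ⊆ s) (htr : S.IsTrajectory q a b) :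
    ∀ t ∈ Ioo a b, eulerLagrange (S.chartLag q₀) (S.chartForce q₀)
      (chartAt E q₀ (q t), deriv (fun τ => chartAt E q₀ (q τ)) t)
      (deriv (deriv fun τ => chartAt E q₀ (q τ)) t) = 0 := by
  set x : ℝ → E := fun τ => chartAt E q₀ (q τ) with hx
  have hxs : ContDiffOn ℝ ∞ x s := by
    rw [← contMDiffOn_iff_contDiffOn]
    exact (contMDiffOn_chart (I := 𝓘(ℝ, E)) (n := ∞)).comp hq hqs
  have hxt : ∀ t ∈ s, x t ∈ (chartAt E q₀).target := fun t ht => (chartAt E q₀).map_source (hqs t ht)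
  refine eulerLagrange_eq_zero_of_variations (isOpen_tchart_target q₀) (S.contDiffOn_chartLag q₀)
    (S.contDiffOn_chartForce q₀) hs hxs (fun t ht => mem_tchart_target.2 (hxt t ht)) hab hsub
    fun u hu ha hb => ?_
  let δq : ℝ → TangentBundle 𝓘(ℝ, E) Q := fun t => (tchart q₀).symm (x t, u t)
  have hδq : ContMDiffOn 𝓘(ℝ, ℝ) 𝓘(ℝ, E).tangent ∞ δq (Icc a b) :=
    (contMDiffOn_tchart_symm q₀).comp
      (contMDiffOn_iff_contDiffOn.2 ((hxs.mono hsub).prodMk hu.contDiffOn))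
      fun t ht => mem_tchart_target.2 (hxt t (hsub ht))
  have h0 : ∀ t, u t = 0 → (δq t).2 = 0 := fun t h => by
    exact (congrArg (tangentCoordChange 𝓘(ℝ, E) q₀ ((chartAt E q₀).symm (x t))
      ((chartAt E q₀).symm (x t))) h).trans (map_zero (tangentCoordChange 𝓘(ℝ, E) q₀
        ((chartAt E q₀).symm (x t)) ((chartAt E q₀).symm (x t))))
  have h1 := htr.2 δq hδq (fun t ht => (chartAt E q₀).left_inv (hqs t (hsub ht))) (h0 a ha) (h0 b hb)
  rw [← h1]
  refine intervalIntegral.integral_congr fun t ht => ?_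
  exact (S.variation_integrand hs hq hqs hab hsub ((hu.differentiable (by simp)).differentiableOn)
    (fun _ _ => rfl) (by rwa [uIcc_of_le hab.le] at ht)).symm

end ForcedMechanicalSystem

end Coordinates

/-! ### The flow in coordinates -/

section Flow

variable {E : Type*} [NormedAddCommGroup E] [NormedSpace ℝ E]
  {Q : Type*} [TopologicalSpace Q] [ChartedSpace E Q] [IsManifold 𝓘(ℝ, E) ∞ Q]

/-- Vectors over different base points are separated by the projection; vectors over one base point
lie in a common induced chart. -/
theorem t2Space_tangentBundle [T2Space Q] : T2Space (TangentBundle 𝓘(ℝ, E) Q) := by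
  refine ⟨fun v w hvw => ?_⟩
  by_cases h : v.proj = w.proj
  · have hv : v ∈ (tchart v.proj).source := mem_tchart_source.2 (mem_chart_source E v.proj)
    have hw : w ∈ (tchart v.proj).source := mem_tchart_source.2 (h ▸ mem_chart_source E v.proj)
    have hne : tchart v.proj v ≠ tchart v.proj w := fun h' => hvw ((tchart v.proj).injOn hv hw h')
    obtain ⟨O₁, O₂, hO₁, hO₂, h₁, h₂, hd⟩ := t2_separation hne
    have hc := (contMDiffOn_tchart (E := E) v.proj).continuousOn
    have ho := isOpen_tchart_source (E := E) v.proj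
    exact ⟨_, _, hc.isOpen_inter_preimage ho hO₁, hc.isOpen_inter_preimage ho hO₂, ⟨hv, h₁⟩,
      ⟨hw, h₂⟩, (hd.preimage _).mono inter_subset_right inter_subset_right⟩
  · exact separated_by_continuous
      (Bundle.contMDiff_proj (TangentSpace 𝓘(ℝ, E) : Q → Type _) (n := 0)
        (IB := 𝓘(ℝ, E))).continuous h

theorem contDiffOn_chart_comp {q₀ : Q} {q : ℝ → Q} {s : Set ℝ}
    (hq : ContMDiffOn 𝓘(ℝ, ℝ) 𝓘(ℝ, E) ∞ q s) (hqs : ∀ t ∈ s, q t ∈ (chartAt E q₀).source) :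
    ContDiffOn ℝ ∞ (fun τ => chartAt E q₀ (q τ)) s := by
  rw [← contMDiffOn_iff_contDiffOn]
  exact (contMDiffOn_chart (I := 𝓘(ℝ, E)) (n := ∞)).comp hq hqs

theorem velocity_eq_tchart_symm {q₀ : Q} {q : ℝ → Q} {s : Set ℝ} (hs : IsOpen s)
    (hq : ContMDiffOn 𝓘(ℝ, ℝ) 𝓘(ℝ, E) ∞ q s) (hqs : ∀ t ∈ s, q t ∈ (chartAt E q₀).source)
    {t : ℝ} (ht : t ∈ s) : velocity 𝓘(ℝ, E) q t =
      (tchart q₀).symm (chartAt E q₀ (q t), deriv (fun τ => chartAt E q₀ (q τ)) t) := by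
  refine velocity_chart_symm (x := fun τ => chartAt E q₀ (q τ))
    (((contDiffOn_chart_comp hq hqs).contDiffAt (hs.mem_nhds ht)).differentiableAt (by simp))
    ((chartAt E q₀).map_source (hqs t ht)) ?_
  filter_upwards [hs.mem_nhds ht] with τ hτ
  exact ((chartAt E q₀).left_inv (hqs τ hτ)).symm

theorem tchart_velocity {q₀ : Q} {q : ℝ → Q} {s : Set ℝ} (hs : IsOpen s)
    (hq : ContMDiffOn 𝓘(ℝ, ℝ) 𝓘(ℝ, E) ∞ q s) (hqs : ∀ t ∈ s, q t ∈ (chartAt E q₀).source)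
    {t : ℝ} (ht : t ∈ s) : tchart q₀ (velocity 𝓘(ℝ, E) q t) =
      (chartAt E q₀ (q t), deriv (fun τ => chartAt E q₀ (q τ)) t) := by
  rw [velocity_eq_tchart_symm hs hq hqs ht]
  exact (tchart q₀).right_inv (mem_tchart_target.2 ((chartAt E q₀).map_source (hqs t ht)))

omit [IsManifold 𝓘(ℝ, E) ∞ Q] in
theorem exists_isOpen_chart_source {q₀ : Q} {q : ℝ → Q} {s : Set ℝ} (hs : IsOpen s)
    (hq : ContMDiffOn 𝓘(ℝ, ℝ) 𝓘(ℝ, E) ∞ q s) {t : ℝ} (ht : t ∈ s)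
    (hqt : q t ∈ (chartAt E q₀).source) :
    ∃ s' ⊆ s, IsOpen s' ∧ t ∈ s' ∧ ∀ τ ∈ s', q τ ∈ (chartAt E q₀).source :=
  ⟨s ∩ q ⁻¹' (chartAt E q₀).source, inter_subset_left,
    hq.continuousOn.isOpen_inter_preimage hs (chartAt E q₀).open_source, ⟨ht, hqt⟩,
    fun _ h => h.2⟩

theorem continuousAt_velocity {q : ℝ → Q} {s : Set ℝ} (hs : IsOpen s)
    (hq : ContMDiffOn 𝓘(ℝ, ℝ) 𝓘(ℝ, E) ∞ q s) {t : ℝ} (ht : t ∈ s) :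
    ContinuousAt (velocity 𝓘(ℝ, E) q) t := by
  obtain ⟨s', hs's, hs', hts', hqs'⟩ :=
    exists_isOpen_chart_source hs hq ht (mem_chart_source E (q t))
  have hx := contDiffOn_chart_comp (hq.mono hs's) hqs'
  have hx' : ContDiffOn ℝ ∞ (deriv fun τ => chartAt E (q t) (q τ)) s' :=
    hx.deriv_of_isOpen hs' (by simp)
  have hn := hs'.mem_nhds hts'
  have h1 : ContinuousAt (fun τ => (chartAt E (q t) (q τ),
      deriv (fun τ => chartAt E (q t) (q τ)) τ)) t :=
    (hx.continuousOn.continuousAt hn).prodMk (hx'.continuousOn.continuousAt hn)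
  have h2 : ContinuousAt ((tchart (q t)).symm : E × E → TangentBundle 𝓘(ℝ, E) Q)
      (chartAt E (q t) (q t), deriv (fun τ => chartAt E (q t) (q τ)) t) :=
    (contMDiffOn_tchart_symm (q t)).continuousOn.continuousAt ((isOpen_tchart_target _).mem_nhds
      (mem_tchart_target.2 (mem_chart_target E (q t))))
  refine (ContinuousAt.comp (f := fun τ => (chartAt E (q t) (q τ),
      deriv (fun τ => chartAt E (q t) (q τ)) τ)) h2 h1).congr ?_
  filter_upwards [hn] with τ hτ
  exact (velocity_eq_tchart_symm hs' (hq.mono hs's) hqs' hτ).symm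

namespace ForcedMechanicalSystem

variable {S : ForcedMechanicalSystem E Q}

/-- In a chart, trajectories are integral curves of `(x, v) ↦ (v, X(x, v))`. -/
theorem eventually_hasDerivAt_of_isTrajectory [FiniteDimensional ℝ E] {q₀ : Q} {X : E × E → E}
    (hX : ∀ z : E × E, z.1 ∈ (chartAt E q₀).target → ∀ w,
        eulerLagrange (S.chartLag q₀) (S.chartForce q₀) z w = 0 ↔ w = X z)
    {c d : ℝ} {q : ℝ → Q} (hq : ContMDiffOn 𝓘(ℝ, ℝ) 𝓘(ℝ, E) ∞ q (Ioo c d))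
    (htr : ∀ a b, c < a → a < b → b < d → S.IsTrajectory q a b) {t : ℝ} (ht : t ∈ Ioo c d)
    (hqt : q t ∈ (chartAt E q₀).source) :
    ∀ᶠ τ in 𝓝 t, q τ ∈ (chartAt E q₀).source ∧
      velocity 𝓘(ℝ, E) q τ = (tchart q₀).symm (tchart q₀ (velocity 𝓘(ℝ, E) q τ)) ∧
      HasDerivAt (fun σ => tchart q₀ (velocity 𝓘(ℝ, E) q σ))
        ((tchart q₀ (velocity 𝓘(ℝ, E) q τ)).2, X (tchart q₀ (velocity 𝓘(ℝ, E) q τ))) τ := by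
  obtain ⟨s', hs's, hs', hts', hqs'⟩ := exists_isOpen_chart_source isOpen_Ioo hq ht hqt
  -- The trajectory condition concerns compact intervals, so half the radius is used to keep a
  -- closed interval inside the chart.
  obtain ⟨ε, hε, hball⟩ := Metric.isOpen_iff.1 hs' t hts'
  rw [Real.ball_eq_Ioo] at hball
  have hsub : Icc (t - ε / 2) (t + ε / 2) ⊆ s' := fun τ hτ =>
    hball ⟨by linarith [hτ.1], by linarith [hτ.2]⟩
  have hlt : t - ε / 2 < t + ε / 2 := by linarith
  have h1 := hs's (hsub (left_mem_Icc.2 hlt.le))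
  have h2 := hs's (hsub (right_mem_Icc.2 hlt.le))
  have hq' := hq.mono hs's
  have hEL := S.eulerLagrange_of_isTrajectory hs' hq' hqs' hlt hsub (htr _ _ h1.1 hlt h2.2)
  have hx := contDiffOn_chart_comp hq' hqs'
  have hx' : ContDiffOn ℝ ∞ (deriv fun τ => chartAt E q₀ (q τ)) s' :=
    hx.deriv_of_isOpen hs' (by simp)
  filter_upwards [Ioo_mem_nhds (show t - ε / 2 < t by linarith) (show t < t + ε / 2 by linarith)]
    with τ hτ
  have hτs := hsub (Ioo_subset_Icc_self hτ)
  have hn := hs'.mem_nhds hτs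
  have hv := tchart_velocity hs' hq' hqs' hτs
  refine ⟨hqs' τ hτs, ((tchart q₀).left_inv (mem_tchart_source.2 (hqs' τ hτs))).symm, ?_⟩
  have hacc := (hX (chartAt E q₀ (q τ), deriv (fun τ => chartAt E q₀ (q τ)) τ)
    ((chartAt E q₀).map_source (hqs' τ hτs)) _).1 (hEL τ hτ)
  have hd := ((hx.contDiffAt hn).differentiableAt (by simp)).hasDerivAt.prodMk
    ((hx'.contDiffAt hn).differentiableAt (by simp)).hasDerivAt
  rw [hv, ← hacc]
  refine hd.congr_of_eventuallyEq ?_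
  filter_upwards [hn] with σ hσ
  exact tchart_velocity hs' hq' hqs' hσ

/-- Around each point of a chart, the flow of a regular system is given by a smooth map. -/
theorem IsRegular.exists_chart_flow [FiniteDimensional ℝ E] [T2Space Q] (hS : S.IsRegular)
    (q₀ : Q) {z₀ : E × E} (hz₀ : z₀.1 ∈ (chartAt E q₀).target) :
    ∃ δ > 0, ∃ G : ℝ × (E × E) → E × E,
      ContDiffOn ℝ ∞ G (Ioo (-δ) δ ×ˢ Metric.ball z₀ δ) ∧
      (∀ z ∈ Metric.ball z₀ δ, G (0, z) = z) ∧
      ∀ t ∈ Ioo (-δ) δ, ∀ z ∈ Metric.ball z₀ δ, (G (t, z)).1 ∈ (chartAt E q₀).target ∧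
        HasDerivAt (fun s => (G (s, z)).1) (G (t, z)).2 t ∧
        ∀ w, S.FlowRel t ((tchart q₀).symm z) w ↔ w = (tchart q₀).symm (G (t, z)) := by
  have hT2 := t2Space_tangentBundle (E := E) (Q := Q)
  obtain ⟨X, hXs, hX⟩ := hS.exists_chart_acceleration q₀
  have hD := isOpen_tchart_target (E := E) q₀
  have hfs : ContDiffOn ℝ ∞ (fun z : E × E => (z.2, X z))
    (tchart q₀ : PartialEquiv (TangentBundle 𝓘(ℝ, E) Q) (E × E)).target := contDiffOn_snd.prodMk hXs
  obtain ⟨δ, hδ, G, hG, hG0, hGd⟩ :=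
    exists_smooth_local_flow_on hD hfs (mem_tchart_target.2 hz₀)
  have h0δ : (0 : ℝ) ∈ Ioo (-δ) δ := ⟨by linarith, hδ⟩
  have hmem : ∀ t ∈ Ioo (-δ) δ, ∀ z ∈ Metric.ball z₀ δ, (G (t, z)).1 ∈ (chartAt E q₀).target :=
    fun t ht z hz => mem_tchart_target.1 (hGd t ht z hz).1
  have hd1 : ∀ t ∈ Ioo (-δ) δ, ∀ z ∈ Metric.ball z₀ δ,
      HasDerivAt (fun s => (G (s, z)).1) (G (t, z)).2 t := fun t ht z hz =>
    (ContinuousLinearMap.fst ℝ E E).hasFDerivAt.comp_hasDerivAt t (hGd t ht z hz).2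
  have hd2 : ∀ t ∈ Ioo (-δ) δ, ∀ z ∈ Metric.ball z₀ δ,
      HasDerivAt (fun s => (G (s, z)).2) (X (G (t, z))) t := fun t ht z hz =>
    (ContinuousLinearMap.snd ℝ E E).hasFDerivAt.comp_hasDerivAt t (hGd t ht z hz).2
  refine ⟨δ, hδ, G, hG, hG0, fun t ht z hz => ⟨hmem t ht z hz, hd1 t ht z hz, fun w => ?_⟩⟩
  have hslice : ContDiffOn ℝ ∞ (fun s => G (s, z)) (Ioo (-δ) δ) :=
    hG.comp (contDiff_id.prodMk contDiff_const).contDiffOn fun s hs => mk_mem_prod hs hz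
  constructor
  · rintro ⟨c, d, q, h0, htcd, hq, htr, hv0, rfl⟩
    let J : Set ℝ := Ioo c d ∩ Ioo (-δ) δ
    have hJ : IsPreconnected J := (ordConnected_Ioo.inter ordConnected_Ioo).isPreconnected
    have hJo : IsOpen J := isOpen_Ioo.inter isOpen_Ioo
    -- Uniqueness by connectedness of `J`: the set of times at which the trajectory agrees with the
    -- local solution contains `0`, is open by uniqueness for Lipschitz fields, and is closed in `J`
    -- because `TQ` is Hausdorff.
    let A : Set ℝ := {s ∈ J | velocity 𝓘(ℝ, E) q s = (tchart q₀).symm (G (s, z))}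
    suffices hA : J ⊆ A from (hA ⟨htcd, ht⟩).2
    refine hJ.subset_of_closure_inter_subset ?_ ⟨0, ⟨h0, h0δ⟩, ⟨h0, h0δ⟩, by rw [hv0, hG0 z hz]⟩ ?_
    · rw [isOpen_iff_mem_nhds]
      rintro s ⟨hsJ, hsv⟩
      have hqs : q s = (chartAt E q₀).symm (G (s, z)).1 :=
        congrArg (fun v : TangentBundle 𝓘(ℝ, E) Q => v.proj) hsv
      have hsrc : q s ∈ (chartAt E q₀).source := by
        rw [hqs]; exact (chartAt E q₀).map_target (hmem s hsJ.2 z hz)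
      have hev := eventually_hasDerivAt_of_isTrajectory hX hq htr hsJ.1 hsrc
      have hts : tchart q₀ (velocity 𝓘(ℝ, E) q s) = G (s, z) := by
        rw [hsv]; exact (tchart q₀).right_inv (hGd s hsJ.2 z hz).1
      obtain ⟨K, N, hN, hlip⟩ := ((hfs.contDiffAt (hD.mem_nhds
        (hGd s hsJ.2 z hz).1)).of_le (by simp : (1 : WithTop ℕ∞) ≤ ∞)).exists_lipschitzOnWith
      have hc1 : ContinuousAt (fun σ => tchart q₀ (velocity 𝓘(ℝ, E) q σ)) s :=
        hev.self_of_nhds.2.2.continuousAt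
      have heq : (fun σ => tchart q₀ (velocity 𝓘(ℝ, E) q σ)) =ᶠ[𝓝 s] fun σ => G (σ, z) := by
        refine ODE_solution_unique_of_eventually (v := fun _ (z : E × E) => (z.2, X z))
          (s := fun _ => N) (K := K) (Eventually.of_forall fun _ => hlip) ?_ ?_ hts
        · filter_upwards [hev, hc1.preimage_mem_nhds (by rw [hts]; exact hN)] with σ h1 h2
          exact ⟨h1.2.2, h2⟩
        · filter_upwards [isOpen_Ioo.mem_nhds hsJ.2,
            (hGd s hsJ.2 z hz).2.continuousAt.preimage_mem_nhds hN] with σ h1 h2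
          exact ⟨(hGd σ h1 z hz).2, h2⟩
      filter_upwards [hev, heq, hJo.mem_nhds hsJ] with σ h1 h2 h3
      exact ⟨h3, by rw [h1.2.1, h2]⟩
    · rintro s ⟨hsA, hsJ⟩
      refine ⟨hsJ, ?_⟩
      have hc1 : ContinuousAt (velocity 𝓘(ℝ, E) q) s := continuousAt_velocity isOpen_Ioo hq hsJ.1
      have hc2 : ContinuousAt (fun σ => ((tchart q₀).symm (G (σ, z)) :
          TangentBundle 𝓘(ℝ, E) Q)) s :=
        ContinuousAt.comp (f := fun σ => G (σ, z))
          ((contMDiffOn_tchart_symm q₀).continuousOn.continuousAt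
            (hD.mem_nhds (hGd s hsJ.2 z hz).1))
          (hGd s hsJ.2 z hz).2.continuousAt
      have := mem_closure_iff_frequently.1 hsA
      by_contra hne
      obtain ⟨σ, h1, h2⟩ := (this.and_eventually
        ((hc1.prodMk hc2).preimage_mem_nhds (isClosed_diagonal.isOpen_compl.mem_nhds hne))).exists
      exact h2 h1.2
  · rintro rfl
    -- Conversely, the base curve of the local solution is a trajectory: in the chart its velocity
    -- is the second component of `G` and its acceleration is `X`, which solves the Euler–Lagrange
    -- equation.
    let q : ℝ → Q := fun s => (chartAt E q₀).symm (G (s, z)).1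
    have hx1 : ContDiffOn ℝ ∞ (fun s => (G (s, z)).1) (Ioo (-δ) δ) :=
      contDiff_fst.comp_contDiffOn hslice
    have hqs : ∀ s ∈ Ioo (-δ) δ, q s ∈ (chartAt E q₀).source := fun s hs =>
      (chartAt E q₀).map_target (hmem s hs z hz)
    have hq : ContMDiffOn 𝓘(ℝ, ℝ) 𝓘(ℝ, E) ∞ q (Ioo (-δ) δ) :=
      (contMDiffOn_chart_symm (I := 𝓘(ℝ, E)) (n := ∞)).comp hx1.contMDiffOn
        fun s hs => hmem s hs z hz
    have hxq : ∀ s ∈ Ioo (-δ) δ, (fun τ => chartAt E q₀ (q τ)) =ᶠ[𝓝 s] fun τ => (G (τ, z)).1 :=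
      fun s hs => by
        filter_upwards [isOpen_Ioo.mem_nhds hs] with τ hτ
        exact (chartAt E q₀).right_inv (hmem τ hτ z hz)
    have hder : ∀ s ∈ Ioo (-δ) δ, deriv (fun τ => chartAt E q₀ (q τ)) s = (G (s, z)).2 :=
      fun s hs => by rw [(hxq s hs).deriv_eq, (hd1 s hs z hz).deriv]
    have hvel : ∀ s ∈ Ioo (-δ) δ, velocity 𝓘(ℝ, E) q s = (tchart q₀).symm (G (s, z)) :=
      fun s hs => by
        rw [velocity_eq_tchart_symm isOpen_Ioo hq hqs hs, hder s hs, (hxq s hs).eq_of_nhds]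
    refine ⟨-δ, δ, q, h0δ, ht, hq, fun a b ha hab hb => ?_, ?_, hvel t ht⟩
    · refine S.isTrajectory_of_eulerLagrange isOpen_Ioo hq hqs (fun s hs => ?_) hab
        (fun τ hτ => ⟨ha.trans_le hτ.1, hτ.2.trans_lt hb⟩)
      have hder2 : deriv (deriv fun τ => chartAt E q₀ (q τ)) s = X (G (s, z)) := by
        have : (deriv fun τ => chartAt E q₀ (q τ)) =ᶠ[𝓝 s] fun τ => (G (τ, z)).2 := by
          filter_upwards [isOpen_Ioo.mem_nhds hs] with τ hτ using hder τ hτ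
        rw [this.deriv_eq, (hd2 s hs z hz).deriv]
      rw [(hxq s hs).eq_of_nhds, hder s hs, hder2]
      exact (hX (G (s, z)) (hmem s hs z hz) _).2 rfl
    · rw [hvel 0 h0δ, hG0 z hz]

end ForcedMechanicalSystem

end Flow

/-! ### The exact boundary maps in coordinates -/

namespace BoundaryTimes

variable (B : BoundaryTimes)

/-- Both `α⁺(h)` and `-α⁻(h)` lie on the same side of zero as `h`, and they add up to `h`; so
neither exceeds `h` in absolute value. -/
theorem abs_le_of_ne_zero {h : ℝ} (hh : h ∈ Ioo (-B.radius) B.radius) (h0 : h ≠ 0) :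
    |B.plus h| ≤ |h| ∧ |B.minus h| ≤ |h| := by
  have h1 := B.plus_sign h hh
  have h2 := B.minus_sign h hh
  have h3 := B.sub_eq h hh
  rcases lt_or_gt_of_ne h0 with hneg | hpos
  · have h4 : B.plus h ≤ 0 := by
      by_contra hc
      exact absurd h1 (not_le.2 (mul_neg_of_neg_of_pos hneg (not_le.1 hc)))
    have h5 : 0 ≤ B.minus h := by
      by_contra hc
      exact absurd h2 (not_le.2 (mul_pos_of_neg_of_neg hneg (not_le.1 hc)))
    rw [abs_of_neg hneg, abs_of_nonpos h4, abs_of_nonneg h5]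
    constructor <;> linarith
  · have h4 : 0 ≤ B.plus h := by
      by_contra hc
      exact absurd h1 (not_le.2 (mul_neg_of_pos_of_neg hpos (not_le.1 hc)))
    have h5 : B.minus h ≤ 0 := by
      by_contra hc
      exact absurd h2 (not_le.2 (mul_pos hpos (not_le.1 hc)))
    rw [abs_of_pos hpos, abs_of_nonneg h4, abs_of_nonpos h5]
    constructor <;> linarith

theorem zero_mem : (0 : ℝ) ∈ Ioo (-B.radius) B.radius := ⟨neg_lt_zero.2 B.radius_pos, B.radius_pos⟩

/-- The sign conditions are void at `h = 0`, so the value there is found by letting `h → 0` in the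
bound. -/
theorem eq_zero_of_bound {α : ℝ → ℝ} (hα : ContDiffOn ℝ ∞ α (Ioo (-B.radius) B.radius))
    (hb : ∀ h ∈ Ioo (-B.radius) B.radius, h ≠ 0 → |α h| ≤ |h|) : α 0 = 0 := by
  have hc : ContinuousAt α 0 := hα.continuousOn.continuousAt (isOpen_Ioo.mem_nhds B.zero_mem)
  have h1 : Tendsto (fun h => |α h|) (𝓝[≠] 0) (𝓝 |α 0|) :=
    hc.abs.tendsto.mono_left nhdsWithin_le_nhds
  have h2 : Tendsto (fun h : ℝ => |h|) (𝓝[≠] 0) (𝓝 |0|) :=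
    continuous_abs.continuousAt.tendsto.mono_left nhdsWithin_le_nhds
  have h3 := le_of_tendsto_of_tendsto h1 h2 (by
    filter_upwards [nhdsWithin_le_nhds (isOpen_Ioo.mem_nhds B.zero_mem), self_mem_nhdsWithin]
      with h hh h0 using hb h hh h0)
  simpa using h3

theorem plus_zero : B.plus 0 = 0 :=
  B.eq_zero_of_bound B.smooth_plus fun _ hh h0 => (B.abs_le_of_ne_zero hh h0).1

theorem minus_zero : B.minus 0 = 0 :=
  B.eq_zero_of_bound B.smooth_minus fun _ hh h0 => (B.abs_le_of_ne_zero hh h0).2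

theorem abs_plus_le {h : ℝ} (hh : h ∈ Ioo (-B.radius) B.radius) : |B.plus h| ≤ |h| := by
  by_cases h0 : h = 0
  · rw [h0, B.plus_zero]
  · exact (B.abs_le_of_ne_zero hh h0).1

theorem abs_minus_le {h : ℝ} (hh : h ∈ Ioo (-B.radius) B.radius) : |B.minus h| ≤ |h| := by
  by_cases h0 : h = 0
  · rw [h0, B.minus_zero]
  · exact (B.abs_le_of_ne_zero hh h0).2

end BoundaryTimes

/-- Rescaled differences of a pair of maps: `(m, (p - m) / h)`. -/
def rescaled {E V : Type*} [NormedAddCommGroup E] [NormedSpace ℝ E] (m p : ℝ × V → E) (h : ℝ)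
    (z : V) : E × E :=
  (m (h, z), h⁻¹ • (p (h, z) - m (h, z)))

section Rescaling

variable {E : Type*} [NormedAddCommGroup E] [NormedSpace ℝ E]

/-- The rescaled boundary maps of a second order flow are close to the identity. -/
theorem rescaled_flow_estimates (B : BoundaryTimes) {G : ℝ × (E × E) → E × E} {z₀ : E × E} {δ : ℝ}
    (hδ : 0 < δ) (hG : ContDiffOn ℝ ∞ G (Ioo (-δ) δ ×ˢ Metric.ball z₀ δ))
    (hG0 : ∀ z ∈ Metric.ball z₀ δ, G (0, z) = z)
    (hGd : ∀ t ∈ Ioo (-δ) δ, ∀ z ∈ Metric.ball z₀ δ,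
      HasDerivAt (fun s => (G (s, z)).1) (G (t, z)).2 t) :
    (∃ ε > 0, ∀ h, h ≠ 0 → |h| < ε → ∀ z ∈ Metric.ball z₀ ε, ∀ w ∈ Metric.ball z₀ ε,
      ‖rescaled (fun p => (G (B.minus p.1, p.2)).1) (fun p => (G (B.plus p.1, p.2)).1) h z -
        rescaled (fun p => (G (B.minus p.1, p.2)).1) (fun p => (G (B.plus p.1, p.2)).1) h w -
        (z - w)‖ ≤ 1 / 2 * ‖z - w‖) ∧
    ∀ η > 0, ∃ ε > 0, ∀ h, h ≠ 0 → |h| < ε → ∀ z ∈ Metric.ball z₀ ε,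
      ‖rescaled (fun p => (G (B.minus p.1, p.2)).1) (fun p => (G (B.plus p.1, p.2)).1) h z - z₀‖
        ≤ η := by
  have h0mem : ((0 : ℝ), z₀) ∈ Ioo (-δ) δ ×ˢ Metric.ball z₀ δ :=
    ⟨⟨by linarith, hδ⟩, Metric.mem_ball_self hδ⟩
  have hGat : ContDiffAt ℝ ∞ G (0, z₀) :=
    hG.contDiffAt ((isOpen_Ioo.prod Metric.isOpen_ball).mem_nhds h0mem)
  have hr := B.radius_pos
  have htimes : ∀ {h ε : ℝ}, ε ≤ B.radius → |h| < ε → (B.plus h ∈ Ioo (-ε) ε ∧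
      B.minus h ∈ Ioo (-ε) ε) ∧ B.plus h - B.minus h = h := by
    intro h ε hε hh
    have hm : h ∈ Ioo (-B.radius) B.radius := abs_lt.1 (hh.trans_le hε)
    exact ⟨⟨abs_lt.1 ((B.abs_plus_le hm).trans_lt hh), abs_lt.1 ((B.abs_minus_le hm).trans_lt hh)⟩,
      B.sub_eq h hm⟩
  -- The times `α⁻(h)` and `α⁺(h)` differ by exactly `h`, so the mean value inequality divided by
  -- `|h|` bounds a rescaled difference by the bound on the derivative, uniformly in `h`.
  have hmv : ∀ {ε c : ℝ} {k : ℝ → E} {k' : ℝ → E} {h : ℝ}, ε ≤ B.radius → h ≠ 0 → |h| < ε →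
      (∀ t ∈ Ioo (-ε) ε, HasDerivAt k (k' t) t) → (∀ t ∈ Ioo (-ε) ε, ‖k' t‖ ≤ c) →
      ‖h⁻¹ • (k (B.plus h) - k (B.minus h))‖ ≤ c := by
    intro ε c k k' h hε h0 hh hk hk'
    obtain ⟨⟨h1, h2⟩, h3⟩ := htimes hε hh
    have := (convex_Ioo (-ε) ε).norm_image_sub_le_of_norm_hasDerivWithin_le
      (fun t ht => (hk t ht).hasDerivWithinAt) hk' h2 h1
    rw [h3, Real.norm_eq_abs] at this
    rw [norm_smul, norm_inv, Real.norm_eq_abs, inv_mul_le_iff₀ (abs_pos.2 h0), mul_comm]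
    exact this
  constructor
  · have hst := hGat.hasStrictFDerivAt (by simp)
    have hD : ∀ v : E × E, fderiv ℝ G (0, z₀) (0, v) = v := by
      intro v
      have h1 : HasFDerivAt (fun z : E × E => G (0, z))
          ((fderiv ℝ G (0, z₀)).comp (.inr ℝ ℝ (E × E))) z₀ :=
        HasFDerivAt.comp z₀ hst.hasFDerivAt (hasFDerivAt_prodMk_right (0 : ℝ) z₀)
      have h2 : HasFDerivAt (fun z : E × E => G (0, z)) (.id ℝ (E × E)) z₀ :=
        (hasFDerivAt_id z₀).congr_of_eventuallyEq (by
          filter_upwards [Metric.ball_mem_nhds z₀ hδ] with z hz using hG0 z hz)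
      exact congrArg (fun L : E × E →L[ℝ] E × E => L v) (h1.unique h2)
    -- Strict differentiability at `(0, z₀)`, where the derivative in the space directions is the
    -- identity, makes `G(t, ·)` minus the identity Lipschitz with constant `1/2` for all small `t`.
    have hev := (hasStrictFDerivAt_iff_isLittleO.1 hst).def (show (0 : ℝ) < 1 / 2 by norm_num)
    rw [nhds_prod_eq, Metric.nhds_basis_ball.prod_self.eventually_iff] at hev
    obtain ⟨ρ, hρ, hest⟩ := hev
    set ε := min ρ (min δ B.radius)
    have hε : 0 < ε := lt_min hρ (lt_min hδ hr)
    have hεδ : ε ≤ δ := (min_le_right _ _).trans (min_le_left _ _)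
    have hεr : ε ≤ B.radius := (min_le_right _ _).trans (min_le_right _ _)
    have hIoo : Ioo (-ε) ε ⊆ Ioo (-δ) δ := Ioo_subset_Ioo (by linarith) hεδ
    have hbs : Metric.ball z₀ ε ⊆ Metric.ball z₀ δ := Metric.ball_subset_ball hεδ
    have key : ∀ t ∈ Ioo (-ε) ε, ∀ z ∈ Metric.ball z₀ ε, ∀ w ∈ Metric.ball z₀ ε,
        ‖G (t, z) - G (t, w) - (z - w)‖ ≤ 1 / 2 * ‖z - w‖ := by
      intro t ht z hz w hw
      have hb : ∀ z ∈ Metric.ball z₀ ε, ((t, z) : ℝ × (E × E)) ∈ Metric.ball ((0 : ℝ), z₀) ρ := by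
        intro z hz
        rw [Metric.mem_ball, Prod.dist_eq, max_lt_iff, dist_zero_right, Real.norm_eq_abs]
        exact ⟨(abs_lt.2 ht).trans_le (min_le_left _ _), lt_of_lt_of_le hz (min_le_left _ _)⟩
      have h := hest (mk_mem_prod (hb z hz) (hb w hw))
      have h3 : ((t, z) : ℝ × (E × E)) - (t, w) = (0, z - w) := by simp
      simp only [h3, hD] at h
      refine h.trans (le_of_eq ?_)
      simp [Prod.norm_def]
    refine ⟨ε, hε, fun h h0 hh z hz w hw => ?_⟩
    obtain ⟨⟨h1, h2⟩, -⟩ := htimes hεr hh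
    rw [Prod.norm_def, max_le_iff]
    refine ⟨?_, ?_⟩
    · exact (norm_fst_le (G (B.minus h, z) - G (B.minus h, w) - (z - w))).trans
        (key _ h2 z hz w hw)
    -- The linear term is subtracted because its rescaled difference is exactly `z.2 - w.2`. What
    -- remains has as derivative the velocity component of the estimate for `G`.
    · have hk := hmv (k := fun t => (G (t, z)).1 - (G (t, w)).1 - t • (z.2 - w.2))
        (k' := fun t => (G (t, z)).2 - (G (t, w)).2 - (z.2 - w.2)) hεr h0 hh
        (fun t ht => by
          have := (((hGd t (hIoo ht) z (hbs hz)).sub (hGd t (hIoo ht) w (hbs hw))).sub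
            ((hasDerivAt_id t).smul_const (z.2 - w.2)))
          rw [one_smul] at this
          exact this)
        (fun t ht => (norm_snd_le (G (t, z) - G (t, w) - (z - w))).trans (key t ht z hz w hw))
      refine le_trans (le_of_eq ?_) hk
      have hsub := (htimes hεr hh).2
      congr 1
      simp only [rescaled, Prod.snd_sub]
      have : z.2 - w.2 = h⁻¹ • ((B.plus h - B.minus h) • (z.2 - w.2)) := by
        rw [hsub, smul_smul, inv_mul_cancel₀ h0, one_smul]
      rw [this, ← smul_sub, ← smul_sub]
      congr 1
      rw [← this, sub_smul]
      abel
  · intro η hη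
    have hc := hGat.continuousAt
    have hev := Metric.continuousAt_iff.1 hc η hη
    obtain ⟨ρ, hρ, hest⟩ := hev
    rw [hG0 z₀ (Metric.mem_ball_self hδ)] at hest
    set ε := min ρ (min δ B.radius)
    have hε : 0 < ε := lt_min hρ (lt_min hδ hr)
    have hεδ : ε ≤ δ := (min_le_right _ _).trans (min_le_left _ _)
    have hεr : ε ≤ B.radius := (min_le_right _ _).trans (min_le_right _ _)
    have hIoo : Ioo (-ε) ε ⊆ Ioo (-δ) δ := Ioo_subset_Ioo (by linarith) hεδ
    have hbs : Metric.ball z₀ ε ⊆ Metric.ball z₀ δ := Metric.ball_subset_ball hεδ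
    have key : ∀ t ∈ Ioo (-ε) ε, ∀ z ∈ Metric.ball z₀ ε, ‖G (t, z) - z₀‖ ≤ η := by
      intro t ht z hz
      rw [← dist_eq_norm]
      refine (hest ?_).le
      rw [Prod.dist_eq, max_lt_iff, dist_zero_right, Real.norm_eq_abs]
      exact ⟨(abs_lt.2 ht).trans_le (min_le_left _ _), lt_of_lt_of_le hz (min_le_left _ _)⟩
    refine ⟨ε, hε, fun h h0 hh z hz => ?_⟩
    obtain ⟨⟨h1, h2⟩, -⟩ := htimes hεr hh
    rw [Prod.norm_def, max_le_iff]
    refine ⟨?_, ?_⟩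
    · exact (norm_fst_le (G (B.minus h, z) - z₀)).trans (key _ h2 z hz)
    · have hk := hmv (k := fun t => (G (t, z)).1 - t • z₀.2)
        (k' := fun t => (G (t, z)).2 - z₀.2) hεr h0 hh
        (fun t ht => by
          have := (hGd t (hIoo ht) z (hbs hz)).sub ((hasDerivAt_id t).smul_const z₀.2)
          rw [one_smul] at this
          exact this)
        (fun t ht => (norm_snd_le (G (t, z) - z₀)).trans (key t ht z hz))
      refine le_trans (le_of_eq ?_) hk
      have hsub := (htimes hεr hh).2
      congr 1
      simp only [rescaled, Prod.snd_sub]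
      have : z₀.2 = h⁻¹ • ((B.plus h - B.minus h) • z₀.2) := by
        rw [hsub, smul_smul, inv_mul_cancel₀ h0, one_smul]
      rw [this, ← smul_sub]
      congr 1
      rw [← this, sub_smul]
      abel

/-- If the rescaled pair is close to the identity, then `(h, m, p)` has invertible derivative. -/
theorem exists_hasFDerivAt_equiv_of_rescaled [FiniteDimensional ℝ E] {m p : ℝ × (E × E) → E}
    {h : ℝ} {z : E × E} {s : Set (E × E)} (hs : s ∈ 𝓝 z)
    (hm : DifferentiableAt ℝ m (h, z)) (hp : DifferentiableAt ℝ p (h, z))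
    (hest : ∀ w ∈ s, ‖rescaled m p h w - rescaled m p h z - (w - z)‖ ≤ 1 / 2 * ‖w - z‖) :
    ∃ e : (ℝ × E × E) ≃L[ℝ] (ℝ × E × E), HasFDerivAt
      (fun y : ℝ × E × E => (y.1, m y, p y)) (e : (ℝ × E × E) →L[ℝ] (ℝ × E × E)) (h, z) := by
  have hd := (hasFDerivAt_fst (𝕜 := ℝ) (p := (h, z))).prodMk (hm.hasFDerivAt.prodMk hp.hasFDerivAt)
  set L : (ℝ × E × E) →L[ℝ] (ℝ × E × E) := (ContinuousLinearMap.fst ℝ ℝ (E × E)).prod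
    ((fderiv ℝ m (h, z)).prod (fderiv ℝ p (h, z))) with hL
  -- A kernel vector has no component along `h` and is killed by `Dm` and `Dp`, hence by the
  -- derivative of the rescaled map. That derivative is within `1/2` of the identity, so `‖ζ‖ ≤ ‖ζ‖
  -- / 2` and the vector is zero.
  have hinj : Function.Injective (L : (ℝ × E × E) →ₗ[ℝ] (ℝ × E × E)) := by
    rw [injective_iff_map_eq_zero]
    rintro ⟨τ, ζ⟩ hζ
    have hτ : τ = 0 := congrArg Prod.fst hζ
    subst hτ
    have hm0 : fderiv ℝ m (h, z) (0, ζ) = 0 := congrArg (fun q : ℝ × E × E => q.2.1) hζ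
    have hp0 : fderiv ℝ p (h, z) (0, ζ) = 0 := congrArg (fun q : ℝ × E × E => q.2.2) hζ
    have hms : HasFDerivAt (fun w => m (h, w)) ((fderiv ℝ m (h, z)).comp (.inr ℝ ℝ (E × E))) z :=
      HasFDerivAt.comp z hm.hasFDerivAt (hasFDerivAt_prodMk_right h z)
    have hps : HasFDerivAt (fun w => p (h, w)) ((fderiv ℝ p (h, z)).comp (.inr ℝ ℝ (E × E))) z :=
      HasFDerivAt.comp z hp.hasFDerivAt (hasFDerivAt_prodMk_right h z)
    have hr : HasFDerivAt (fun w => rescaled m p h w - w)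
        ((((fderiv ℝ m (h, z)).comp (.inr ℝ ℝ (E × E))).prod
          (h⁻¹ • ((fderiv ℝ p (h, z)).comp (.inr ℝ ℝ (E × E)) -
            (fderiv ℝ m (h, z)).comp (.inr ℝ ℝ (E × E))))) - .id ℝ (E × E)) z :=
      (hms.prodMk ((hps.sub hms).const_smul h⁻¹)).sub (hasFDerivAt_id z)
    have hle := HasFDerivAt.le_of_lip' hr (C := 1 / 2) (by norm_num) (by
      filter_upwards [hs] with w hw
      refine (le_of_eq (congrArg norm ?_)).trans (hest w hw)
      abel)
    have h1 := ContinuousLinearMap.le_of_opNorm_le _ hle ζ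
    have h2 : ((fderiv ℝ m (h, z) (0, ζ), h⁻¹ • (fderiv ℝ p (h, z) (0, ζ) -
        fderiv ℝ m (h, z) (0, ζ))) : E × E) - ζ = -ζ := by
      rw [hm0, hp0, sub_zero, smul_zero]
      exact zero_sub ζ
    have h3 : ‖-ζ‖ ≤ 1 / 2 * ‖ζ‖ := (le_of_eq (congrArg norm h2.symm)).trans h1
    rw [norm_neg] at h3
    have h4 : ‖ζ‖ ≤ 0 := by linarith
    rw [norm_le_zero_iff.1 h4]
    rfl
  exact ⟨(LinearEquiv.ofInjectiveEndo (L : (ℝ × E × E) →ₗ[ℝ] (ℝ × E × E))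
    hinj).toContinuousLinearEquiv, hd.congr_fderiv (ContinuousLinearMap.ext fun _ => rfl)⟩

/-- A map close to the identity on a ball covers a definite ball. -/
theorem exists_preimage_of_near_id [CompleteSpace E] {θ : E → E} {z₀ : E} {ε : ℝ} (hε : 0 < ε)
    (hest : ∀ z ∈ Metric.ball z₀ ε, ∀ w ∈ Metric.ball z₀ ε,
      ‖θ z - θ w - (z - w)‖ ≤ 1 / 2 * ‖z - w‖)
    {y : E} (hy : ‖y - θ z₀‖ ≤ ε / 4) : ∃ z ∈ Metric.ball z₀ ε, θ z = y := by
  have happ : ApproximatesLinearOn θ (ContinuousLinearMap.id ℝ E) (Metric.ball z₀ ε)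
      (1 / 2 : NNReal) := by
    intro z hz w hw
    have := hest z hz w hw
    simpa using this
  let inv : (ContinuousLinearMap.id ℝ E).NonlinearRightInverse :=
    ⟨id, 1, fun y => by simp, fun y => rfl⟩
  -- The identity is a right inverse with constant `1`, so the image of the ball of radius `ε / 2`
  -- contains a ball of radius `(1 - 1/2) * (ε / 2) = ε / 4`.
  have hsurj := happ.surjOn_closedBall_of_nonlinearRightInverse inv (ε := ε / 2) (b := z₀)
    (by linarith) (Metric.closedBall_subset_ball (by linarith))
  obtain ⟨z, hz, hzy⟩ := hsurj (show y ∈ Metric.closedBall (θ z₀) _ by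
    rw [Metric.mem_closedBall, dist_eq_norm]
    refine hy.trans (le_of_eq ?_)
    simp only [inv]
    norm_num
    ring)
  exact ⟨z, Metric.closedBall_subset_ball (by linarith) hz, hzy⟩

end Rescaling

/-! ### Local structure of the exact boundary maps -/

section BoundaryCharts

variable {E : Type*} [NormedAddCommGroup E] [NormedSpace ℝ E]
  {Q : Type*} [TopologicalSpace Q] [ChartedSpace E Q] [IsManifold 𝓘(ℝ, E) ∞ Q]

namespace ForcedMechanicalSystem

variable {S : ForcedMechanicalSystem E Q} {B : BoundaryTimes}

/-- In the chart at `q₀`, the exact boundary maps are `m = ∂⁻` and `p = ∂⁺` for `(h, z)` in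
`(-r, r) × ball z₀ r`. -/
structure IsBoundaryChart (S : ForcedMechanicalSystem E Q) (B : BoundaryTimes) (q₀ : Q)
    (z₀ : E × E) (m p : ℝ × (E × E) → E) (r : ℝ) : Prop where
  pos : 0 < r
  contDiffOn_minus : ContDiffOn ℝ ∞ m (Ioo (-r) r ×ˢ Metric.ball z₀ r)
  contDiffOn_plus : ContDiffOn ℝ ∞ p (Ioo (-r) r ×ˢ Metric.ball z₀ r)
  minus_mem : ∀ h ∈ Ioo (-r) r, ∀ z ∈ Metric.ball z₀ r, m (h, z) ∈ (chartAt E q₀).target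
  plus_mem : ∀ h ∈ Ioo (-r) r, ∀ z ∈ Metric.ball z₀ r, p (h, z) ∈ (chartAt E q₀).target
  mem_domain : ∀ h ∈ Ioo (-r) r, ∀ z ∈ Metric.ball z₀ r,
    (h, (tchart q₀).symm z) ∈ S.boundaryDomain B
  dMinus_eq : ∀ h ∈ Ioo (-r) r, ∀ z ∈ Metric.ball z₀ r,
    S.dMinus B h ((tchart q₀).symm z) = (chartAt E q₀).symm (m (h, z))
  dPlus_eq : ∀ h ∈ Ioo (-r) r, ∀ z ∈ Metric.ball z₀ r,
    S.dPlus B h ((tchart q₀).symm z) = (chartAt E q₀).symm (p (h, z))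
  minus_zero : ∀ z ∈ Metric.ball z₀ r, m (0, z) = z.1
  close : ∀ h, h ≠ 0 → |h| < r → ∀ z ∈ Metric.ball z₀ r, ∀ w ∈ Metric.ball z₀ r,
    ‖rescaled m p h z - rescaled m p h w - (z - w)‖ ≤ 1 / 2 * ‖z - w‖
  tendsto : ∀ η > 0, ∃ ε > 0, ∀ h, h ≠ 0 → |h| < ε → ∀ z ∈ Metric.ball z₀ ε,
    ‖rescaled m p h z - z₀‖ ≤ η

theorem flow_eq_of_flowRel_iff {t : ℝ} {v w : TangentBundle 𝓘(ℝ, E) Q}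
    (h : ∀ w', S.FlowRel t v w' ↔ w' = w) : S.flow t v = w := by
  have hex : ∃ w, S.FlowRel t v w := ⟨w, (h w).2 rfl⟩
  rw [flow, dif_pos hex]
  exact (h _).1 hex.choose_spec

/-- The maps are the positions of the chart flow at the times `α⁻(h)` and `α⁺(h)`. The bounds by
`|h|` keep these times inside the interval of the local flow. -/
theorem IsRegular.exists_boundaryChart [FiniteDimensional ℝ E] [T2Space Q] (hS : S.IsRegular)
    (B : BoundaryTimes) (q₀ : Q) {z₀ : E × E} (hz₀ : z₀.1 ∈ (chartAt E q₀).target) :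
    ∃ m p r, S.IsBoundaryChart B q₀ z₀ m p r := by
  obtain ⟨δ, hδ, G, hG, hG0, hGt⟩ := hS.exists_chart_flow q₀ hz₀
  obtain ⟨⟨ε₁, hε₁, hclose⟩, htend⟩ := rescaled_flow_estimates B hδ hG hG0
    fun t ht z hz => (hGt t ht z hz).2.1
  set r := min ε₁ (min δ B.radius)
  have hr : 0 < r := lt_min hε₁ (lt_min hδ B.radius_pos)
  have hr1 : r ≤ ε₁ := min_le_left _ _
  have hr3 : r ≤ δ := (min_le_right _ _).trans (min_le_left _ _)
  have hr4 : r ≤ B.radius := (min_le_right _ _).trans (min_le_right _ _)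
  have hrad : ∀ h ∈ Ioo (-r) r, h ∈ Ioo (-B.radius) B.radius := fun h hh =>
    Ioo_subset_Ioo (by linarith) hr4 hh
  have hpl : ∀ h ∈ Ioo (-r) r, B.plus h ∈ Ioo (-δ) δ := fun h hh =>
    abs_lt.1 ((B.abs_plus_le (hrad h hh)).trans_lt ((abs_lt.2 hh).trans_le hr3))
  have hmi : ∀ h ∈ Ioo (-r) r, B.minus h ∈ Ioo (-δ) δ := fun h hh =>
    abs_lt.1 ((B.abs_minus_le (hrad h hh)).trans_lt ((abs_lt.2 hh).trans_le hr3))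
  have hd : ∀ h ∈ Ioo (-r) r, h ∈ Ioo (-δ) δ := fun h hh => Ioo_subset_Ioo (by linarith) hr3 hh
  have hb : Metric.ball z₀ r ⊆ Metric.ball z₀ δ := Metric.ball_subset_ball hr3
  have h0r : (0 : ℝ) ∈ Ioo (-r) r := ⟨by linarith, hr⟩
  refine ⟨fun y => (G (B.minus y.1, y.2)).1, fun y => (G (B.plus y.1, y.2)).1, r, hr,
    ?_, ?_, ?_, ?_, ?_, ?_, ?_, ?_, ?_, htend⟩
  · refine contDiff_fst.comp_contDiffOn (hG.comp (ContDiffOn.prodMk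
      (B.smooth_minus.comp contDiffOn_fst fun y hy => hrad _ hy.1) contDiffOn_snd) fun y hy =>
      ⟨hmi _ hy.1, hb hy.2⟩)
  · refine contDiff_fst.comp_contDiffOn (hG.comp (ContDiffOn.prodMk
      (B.smooth_plus.comp contDiffOn_fst fun y hy => hrad _ hy.1) contDiffOn_snd) fun y hy =>
      ⟨hpl _ hy.1, hb hy.2⟩)
  · exact fun h hh z hz => (hGt _ (hmi h hh) z (hb hz)).1
  · exact fun h hh z hz => (hGt _ (hpl h hh) z (hb hz)).1
  · exact fun h hh z hz => ⟨hrad h hh, ⟨⟨_, ((hGt _ (hd h hh) z (hb hz)).2.2 _).2 rfl⟩,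
      ⟨_, ((hGt _ (hpl h hh) z (hb hz)).2.2 _).2 rfl⟩⟩,
      ⟨⟨_, ((hGt _ (hd h hh) z (hb hz)).2.2 _).2 rfl⟩,
      ⟨_, ((hGt _ (hmi h hh) z (hb hz)).2.2 _).2 rfl⟩⟩⟩
  · exact fun h hh z hz => congrArg (fun v : TangentBundle 𝓘(ℝ, E) Q => v.proj)
      (flow_eq_of_flowRel_iff (hGt _ (hmi h hh) z (hb hz)).2.2)
  · exact fun h hh z hz => congrArg (fun v : TangentBundle 𝓘(ℝ, E) Q => v.proj)
      (flow_eq_of_flowRel_iff (hGt _ (hpl h hh) z (hb hz)).2.2)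
  · intro z hz
    simp only [B.minus_zero, hG0 z (hb hz)]
  · exact fun h h0 hh z hz w hw => hclose h h0 (hh.trans_le hr1) z
      (Metric.ball_subset_ball hr1 hz) w (Metric.ball_subset_ball hr1 hw)

namespace IsBoundaryChart

variable {q₀ : Q} {z₀ : E × E} {m p : ℝ × (E × E) → E} {r : ℝ}

/-- The open set of `ℝ × TQ` covered by a boundary chart. -/
def source (q₀ : Q) (z₀ : E × E) (r : ℝ) : Set (ℝ × TangentBundle 𝓘(ℝ, E) Q) :=
  Ioo (-r) r ×ˢ ((tchart q₀).source ∩ tchart q₀ ⁻¹' Metric.ball z₀ r)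

theorem isOpen_source : IsOpen (source q₀ z₀ r) :=
  isOpen_Ioo.prod ((contMDiffOn_tchart q₀).continuousOn.isOpen_inter_preimage
    (isOpen_tchart_source q₀) Metric.isOpen_ball)

theorem mem_source (hc : S.IsBoundaryChart B q₀ z₀ m p r) {v : TangentBundle 𝓘(ℝ, E) Q}
    (hv : v ∈ (tchart q₀).source) (hvz : tchart q₀ v = z₀) : (0, v) ∈ source q₀ z₀ r :=
  ⟨⟨neg_lt_zero.2 hc.pos, hc.pos⟩, hv, by
    rw [mem_preimage, hvz]; exact Metric.mem_ball_self hc.pos⟩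

theorem source_subset (hc : S.IsBoundaryChart B q₀ z₀ m p r) :
    source q₀ z₀ r ⊆ S.boundaryDomain B := by
  rintro ⟨h, v⟩ ⟨hh, hv, hz⟩
  have := hc.mem_domain h hh _ hz
  rwa [(tchart q₀).left_inv hv] at this

theorem dPairTilde_eq (hc : S.IsBoundaryChart B q₀ z₀ m p r)
    {x : ℝ × TangentBundle 𝓘(ℝ, E) Q} (hx : x ∈ source q₀ z₀ r) :
    S.dPairTilde B x = (x.1, (chartAt E q₀).symm (m (x.1, tchart q₀ x.2)),
      (chartAt E q₀).symm (p (x.1, tchart q₀ x.2))) := by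
  obtain ⟨h, v⟩ := x
  obtain ⟨hh, hv, hz⟩ := hx
  have h1 := hc.dMinus_eq h hh _ hz
  have h2 := hc.dPlus_eq h hh _ hz
  rw [(tchart q₀).left_inv hv] at h1 h2
  simp only [dPairTilde, dPair, h1, h2]

theorem contMDiffOn_dPairTilde (hc : S.IsBoundaryChart B q₀ z₀ m p r) :
    ContMDiffOn (𝓘(ℝ, ℝ).prod 𝓘(ℝ, E).tangent) (𝓘(ℝ, ℝ).prod (𝓘(ℝ, E).prod 𝓘(ℝ, E))) ∞
      (S.dPairTilde B) (source q₀ z₀ r) := by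
  have hs : ContMDiffOn 𝓘(ℝ, E) 𝓘(ℝ, E) ∞ (chartAt E q₀).symm (chartAt E q₀).target :=
    contMDiffOn_chart_symm
  have ht : ContMDiffOn (𝓘(ℝ, ℝ).prod 𝓘(ℝ, E).tangent) 𝓘(ℝ, E × E) ∞
      (fun x : ℝ × TangentBundle 𝓘(ℝ, E) Q => tchart q₀ x.2) (source q₀ z₀ r) :=
    (contMDiffOn_tchart q₀).comp contMDiffOn_snd fun x hx => hx.2.1
  have h1 : ContMDiffOn (𝓘(ℝ, ℝ).prod 𝓘(ℝ, E).tangent) 𝓘(ℝ, ℝ × (E × E)) ∞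
      (fun x : ℝ × TangentBundle 𝓘(ℝ, E) Q => (x.1, tchart q₀ x.2)) (source q₀ z₀ r) :=
    contMDiffOn_fst.prodMk_space ht
  refine ContMDiffOn.congr (contMDiffOn_fst.prodMk ((hs.comp
    (hc.contDiffOn_minus.contMDiffOn.comp h1 fun x hx => ⟨hx.1, hx.2.2⟩) fun x hx =>
      hc.minus_mem _ hx.1 _ hx.2.2).prodMk (hs.comp
    (hc.contDiffOn_plus.contMDiffOn.comp h1 fun x hx => ⟨hx.1, hx.2.2⟩) fun x hx =>
      hc.plus_mem _ hx.1 _ hx.2.2))) fun x hx => hc.dPairTilde_eq hx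

/-- Off `h = 0` the coordinate map `(h, z) ↦ (h, m, p)` has invertible derivative by the rescaling
estimate, although it degenerates at `h = 0`. The inverse function theorem is applied in coordinates
and carried back through the charts. -/
theorem exists_localInverse [FiniteDimensional ℝ E] (hc : S.IsBoundaryChart B q₀ z₀ m p r)
    {x : ℝ × TangentBundle 𝓘(ℝ, E) Q} (hx : x ∈ source q₀ z₀ r) (h0 : x.1 ≠ 0) :
    ∃ g : ℝ × Q × Q → ℝ × TangentBundle 𝓘(ℝ, E) Q,
      ContMDiffAt (𝓘(ℝ, ℝ).prod (𝓘(ℝ, E).prod 𝓘(ℝ, E))) (𝓘(ℝ, ℝ).prod 𝓘(ℝ, E).tangent) ∞ g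
        (S.dPairTilde B x) ∧ g (S.dPairTilde B x) = x ∧
      ∀ᶠ y in 𝓝 (S.dPairTilde B x), S.dPairTilde B (g y) = y := by
  obtain ⟨h, v⟩ := x
  set z := tchart q₀ v with hz
  have hxz : (h, z) ∈ Ioo (-r) r ×ˢ Metric.ball z₀ r := ⟨hx.1, hx.2.2⟩
  have hopen : IsOpen (Ioo (-r) r ×ˢ Metric.ball z₀ r) := isOpen_Ioo.prod Metric.isOpen_ball
  have hm := hc.contDiffOn_minus.contDiffAt (hopen.mem_nhds hxz)
  have hp := hc.contDiffOn_plus.contDiffAt (hopen.mem_nhds hxz)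
  obtain ⟨e, he⟩ := exists_hasFDerivAt_equiv_of_rescaled
    (Metric.isOpen_ball.mem_nhds hxz.2) (hm.differentiableAt (by simp))
    (hp.differentiableAt (by simp)) fun w hw =>
      hc.close h h0 (abs_lt.2 hx.1) w hw z hx.2.2
  have hf : ContDiffAt ℝ ∞ (fun y : ℝ × E × E => (y.1, m y, p y)) (h, z) :=
    contDiffAt_fst.prodMk (hm.prodMk hp)
  set k := hf.localInverse he (by simp) with hk
  have hkz : k (h, m (h, z), p (h, z)) = (h, z) := hf.localInverse_apply_image he (by simp)
  have hks : ContDiffAt ℝ ∞ k (h, m (h, z), p (h, z)) := hf.to_localInverse he (by simp)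
  have hkr : ∀ᶠ y in 𝓝 (h, m (h, z), p (h, z)), ((k y).1, m (k y), p (k y)) = y :=
    (hf.hasStrictFDerivAt' he (by simp)).eventually_right_inverse
  have hv : v ∈ (tchart q₀).source := hx.2.1
  have hFx := hc.dPairTilde_eq hx
  simp only [← hz] at hFx
  rw [hFx]
  have hmt : m (h, z) ∈ (chartAt E q₀).target := hc.minus_mem _ hx.1 _ hx.2.2
  have hpt : p (h, z) ∈ (chartAt E q₀).target := hc.plus_mem _ hx.1 _ hx.2.2
  set χ : ℝ × Q × Q → ℝ × E × E := fun y => (y.1, chartAt E q₀ y.2.1, chartAt E q₀ y.2.2) with hχ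
  set y₀ : ℝ × Q × Q := (h, (chartAt E q₀).symm (m (h, z)), (chartAt E q₀).symm (p (h, z))) with hy₀
  have hy₀1 : y₀.2.1 ∈ (chartAt E q₀).source := (chartAt E q₀).map_target hmt
  have hy₀2 : y₀.2.2 ∈ (chartAt E q₀).source := (chartAt E q₀).map_target hpt
  have hχ₀ : χ y₀ = (h, m (h, z), p (h, z)) := by
    simp only [hχ, hy₀, (chartAt E q₀).right_inv hmt, (chartAt E q₀).right_inv hpt]
  have hχc : ∀ q ∈ (chartAt E q₀).source, ContMDiffAt 𝓘(ℝ, E) 𝓘(ℝ, E) ∞ (chartAt E q₀) q :=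
    fun q hq => (contMDiffOn_chart (I := 𝓘(ℝ, E))).contMDiffAt
      ((chartAt E q₀).open_source.mem_nhds hq)
  have hχs : ContMDiffAt (𝓘(ℝ, ℝ).prod (𝓘(ℝ, E).prod 𝓘(ℝ, E))) 𝓘(ℝ, ℝ × E × E) ∞ χ y₀ :=
    contMDiffAt_fst.prodMk_space (((hχc _ hy₀1).comp y₀ (contMDiffAt_fst.comp y₀
      contMDiffAt_snd)).prodMk_space ((hχc _ hy₀2).comp y₀ (contMDiffAt_snd.comp y₀
      contMDiffAt_snd)))
  have hkχ : ContMDiffAt (𝓘(ℝ, ℝ).prod (𝓘(ℝ, E).prod 𝓘(ℝ, E))) 𝓘(ℝ, ℝ × E × E) ∞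
      (fun y => k (χ y)) y₀ := by
    refine ContMDiffAt.comp y₀ (g := k) ?_ hχs
    rw [hχ₀]
    exact hks.contMDiffAt
  have hkχ₀ : k (χ y₀) = (h, z) := by rw [hχ₀, hkz]
  have hzt : z ∈ (tchart q₀ : PartialEquiv (TangentBundle 𝓘(ℝ, E) Q) (E × E)).target :=
    (tchart q₀).map_source hv
  refine ⟨fun y => ((k (χ y)).1, (tchart q₀).symm (k (χ y)).2), ?_, ?_, ?_⟩
  · have h1 : ContMDiffAt (𝓘(ℝ, ℝ).prod (𝓘(ℝ, E).prod 𝓘(ℝ, E))) 𝓘(ℝ, ℝ) ∞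
        (fun y => (k (χ y)).1) y₀ :=
      (contDiff_fst.contMDiff (n := ∞)).contMDiffAt.comp y₀ hkχ
    have h2 : ContMDiffAt (𝓘(ℝ, ℝ).prod (𝓘(ℝ, E).prod 𝓘(ℝ, E))) 𝓘(ℝ, E × E) ∞
        (fun y => (k (χ y)).2) y₀ :=
      (contDiff_snd.contMDiff (n := ∞)).contMDiffAt.comp y₀ hkχ
    have h3 : ContMDiffAt 𝓘(ℝ, E × E) 𝓘(ℝ, E).tangent ∞
        ((tchart q₀).symm : E × E → TangentBundle 𝓘(ℝ, E) Q) (k (χ y₀)).2 := by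
      rw [hkχ₀]
      exact (contMDiffOn_tchart_symm q₀).contMDiffAt ((isOpen_tchart_target q₀).mem_nhds hzt)
    exact h1.prodMk (h3.comp y₀ h2)
  · simp only [hkχ₀]
    rw [hz, (tchart q₀).left_inv hv]
  · have hc1 : ∀ᶠ y in 𝓝 y₀, k (χ y) ∈ Ioo (-r) r ×ˢ Metric.ball z₀ r :=
      hkχ.continuousAt.eventually_mem (by rw [hkχ₀]; exact hopen.mem_nhds hxz)
    have hc2 : ∀ᶠ y in 𝓝 y₀, ((k (χ y)).1, m (k (χ y)), p (k (χ y))) = χ y :=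
      hχs.continuousAt.eventually (by rw [hχ₀]; exact hkr)
    have hc3 : ∀ᶠ y : ℝ × Q × Q in 𝓝 y₀, y.2.1 ∈ (chartAt E q₀).source :=
      (continuous_fst.comp continuous_snd).continuousAt.eventually_mem
        ((chartAt E q₀).open_source.mem_nhds hy₀1)
    have hc4 : ∀ᶠ y : ℝ × Q × Q in 𝓝 y₀, y.2.2 ∈ (chartAt E q₀).source :=
      (continuous_snd.comp continuous_snd).continuousAt.eventually_mem
        ((chartAt E q₀).open_source.mem_nhds hy₀2)
    filter_upwards [hc1, hc2, hc3, hc4] with y h1 h2 h3 h4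
    have e1 : (k (χ y)).1 = y.1 := congrArg Prod.fst h2
    have e2 : m (k (χ y)) = chartAt E q₀ y.2.1 := congrArg (fun q : ℝ × E × E => q.2.1) h2
    have e3 : p (k (χ y)) = chartAt E q₀ y.2.2 := congrArg (fun q : ℝ × E × E => q.2.2) h2
    refine Prod.ext e1 (Prod.ext ?_ ?_)
    · refine (hc.dMinus_eq _ h1.1 _ h1.2).trans ?_
      rw [Prod.mk.eta, e2, (chartAt E q₀).left_inv h3]
    · refine (hc.dPlus_eq _ h1.1 _ h1.2).trans ?_
      rw [Prod.mk.eta, e3, (chartAt E q₀).left_inv h4]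

end IsBoundaryChart

end ForcedMechanicalSystem

end BoundaryCharts

/-! ### Existence of adapted pairs -/

/-- An injective smooth map with smooth local inverses is a diffeomorphism onto its image. -/
theorem isDiffeoOn_image_of_localInverse
    {E : Type*} [NormedAddCommGroup E] [NormedSpace ℝ E]
    {H : Type*} [TopologicalSpace H] {I : ModelWithCorners ℝ E H}
    {M : Type*} [TopologicalSpace M] [ChartedSpace H M]
    {E' : Type*} [NormedAddCommGroup E'] [NormedSpace ℝ E']
    {H' : Type*} [TopologicalSpace H'] {J : ModelWithCorners ℝ E' H'}
    {N : Type*} [TopologicalSpace N] [ChartedSpace H' N] {F : M → N} {s : Set M}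
    (hNM : Nonempty (N → M)) (hs : IsOpen s) (hF : ContMDiffOn I J ∞ F s) (hinj : InjOn F s)
    (hloc : ∀ x ∈ s, ∃ g : N → M, ContMDiffAt J I ∞ g (F x) ∧ g (F x) = x ∧
      ∀ᶠ y in 𝓝 (F x), F (g y) = y) :
    IsDiffeoOn I J F s (F '' s) := by
  have hloc' : ∀ x ∈ s, ∃ g : N → M, ContMDiffAt J I ∞ g (F x) ∧
      ∀ᶠ y in 𝓝 (F x), F (g y) = y ∧ g y ∈ s := by
    intro x hx
    obtain ⟨g, hg, hgx, hgy⟩ := hloc x hx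
    refine ⟨g, hg, hgy.and (hg.continuousAt.eventually_mem ?_)⟩
    rw [hgx]
    exact hs.mem_nhds hx
  have hopen : IsOpen (F '' s) := by
    rw [isOpen_iff_mem_nhds]
    rintro _ ⟨x, hx, rfl⟩
    obtain ⟨g, hg, hgy⟩ := hloc' x hx
    filter_upwards [hgy] with y hy using ⟨g y, hy.2, hy.1⟩
  refine ⟨hs, hopen, hinj.bijOn_image, hF, ?_⟩
  -- For empty `s` the inverse is any map at all; this is the only use of `hNM`.
  rcases s.eq_empty_or_nonempty with rfl | ⟨x₀, hx₀⟩
  · obtain ⟨g⟩ := hNM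
    exact ⟨g, by simp, by simp [InvOn, LeftInvOn, RightInvOn]⟩
  · have hne : Nonempty M := ⟨x₀⟩
    have hl : LeftInvOn (Function.invFunOn F s) F s := hinj.leftInvOn_invFunOn
    refine ⟨Function.invFunOn F s, ?_, hl, ?_⟩
    · rintro _ ⟨x, hx, rfl⟩
      obtain ⟨g, hg, hgy⟩ := hloc' x hx
      refine (hg.congr_of_eventuallyEq ?_).contMDiffWithinAt
      filter_upwards [hgy] with y hy
      have := hl hy.2
      rwa [hy.1] at this
    · rintro _ ⟨x, hx, rfl⟩
      rw [hl hx]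

section Existence

variable {E : Type*} [NormedAddCommGroup E] [NormedSpace ℝ E] [FiniteDimensional ℝ E]
  {Q : Type*} [TopologicalSpace Q] [ChartedSpace E Q] [IsManifold 𝓘(ℝ, E) ∞ Q]

/-- Countably many charts of `Q` cover it, and the induced charts of `TQ` inherit this. The outcome
is what a compact exhaustion of `TQ` requires. -/
theorem sigmaCompactSpace_tangentBundle [SecondCountableTopology Q] :
    LocallyCompactSpace (TangentBundle 𝓘(ℝ, E) Q) ∧
      SigmaCompactSpace (TangentBundle 𝓘(ℝ, E) Q) := by
  have hE : ProperSpace E := FiniteDimensional.proper_real E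
  have hlc : LocallyCompactSpace (TangentBundle 𝓘(ℝ, E) Q) :=
    have : LocallyCompactSpace (ModelProd E E) := inferInstanceAs (LocallyCompactSpace (E × E))
    ChartedSpace.locallyCompactSpace (ModelProd E E) _
  obtain ⟨s, hsc, hs⟩ := TopologicalSpace.countable_cover_nhds
    (fun q : Q => chart_source_mem_nhds E q)
  have : SecondCountableTopology (TangentBundle 𝓘(ℝ, E) Q) := by
    have : SecondCountableTopology (ModelProd E E) :=
      inferInstanceAs (SecondCountableTopology (E × E))
    refine ChartedSpace.secondCountable_of_countable_cover (ModelProd E E)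
      (s := (fun q : Q => (⟨q, 0⟩ : TangentBundle 𝓘(ℝ, E) Q)) '' s) ?_ (hsc.image _)
    rw [eq_univ_iff_forall] at hs ⊢
    intro v
    obtain ⟨q, hq, hv⟩ := mem_iUnion₂.1 (hs v.proj)
    exact mem_iUnion₂.2 ⟨_, mem_image_of_mem _ hq, (TangentBundle.mem_chart_source_iff _ _).2 hv⟩
  exact ⟨hlc, inferInstance⟩

variable [T2Space Q]

namespace ForcedMechanicalSystem

variable {S : ForcedMechanicalSystem E Q} {B : BoundaryTimes}

theorem IsRegular.exists_boundaryChart_at (hS : S.IsRegular) (B : BoundaryTimes)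
    (v : TangentBundle 𝓘(ℝ, E) Q) :
    ∃ m p r, S.IsBoundaryChart B v.proj (tchart v.proj v) m p r :=
  hS.exists_boundaryChart B v.proj (mem_tchart_target.1 ((tchart v.proj).map_source
    (mem_tchart_source.2 (mem_chart_source E v.proj))))

theorem IsRegular.dMinus_zero (hS : S.IsRegular) (B : BoundaryTimes)
    (v : TangentBundle 𝓘(ℝ, E) Q) : S.dMinus B 0 v = v.proj := by
  obtain ⟨m, p, r, hc⟩ := hS.exists_boundaryChart_at B v
  have hv : v ∈ (tchart v.proj).source := mem_tchart_source.2 (mem_chart_source E v.proj)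
  have h1 := hc.dMinus_eq 0 ⟨neg_lt_zero.2 hc.pos, hc.pos⟩ _ (Metric.mem_ball_self hc.pos)
  rw [(tchart v.proj).left_inv hv, hc.minus_zero _ (Metric.mem_ball_self hc.pos)] at h1
  rw [h1]
  exact (chartAt E v.proj).left_inv (mem_chart_source E v.proj)

theorem IsRegular.dPairTilde_zero (hS : S.IsRegular) (B : BoundaryTimes)
    (v : TangentBundle 𝓘(ℝ, E) Q) : S.dPairTilde B (0, v) = (0, v.proj, v.proj) := by
  have h1 := hS.dMinus_zero B v
  have h2 : S.dPlus B 0 v = S.dMinus B 0 v := by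
    rw [dPlus, dMinus, B.plus_zero, B.minus_zero]
  simp only [dPairTilde, dPair, h2, h1]

theorem IsRegular.continuousAt_dPairTilde (hS : S.IsRegular) (B : BoundaryTimes)
    (v : TangentBundle 𝓘(ℝ, E) Q) : ContinuousAt (S.dPairTilde B) (0, v) := by
  obtain ⟨m, p, r, hc⟩ := hS.exists_boundaryChart_at B v
  have hv : v ∈ (tchart v.proj).source := mem_tchart_source.2 (mem_chart_source E v.proj)
  exact hc.contMDiffOn_dPairTilde.continuousOn.continuousAt
    (IsBoundaryChart.isOpen_source.mem_nhds (hc.mem_source hv rfl))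

/-- For small nonzero time steps, the exact boundary maps separate points near two given points. -/
theorem IsRegular.eventually_injective (hS : S.IsRegular) (B : BoundaryTimes)
    (v w : TangentBundle 𝓘(ℝ, E) Q) :
    ∀ᶠ x : ℝ × TangentBundle 𝓘(ℝ, E) Q × TangentBundle 𝓘(ℝ, E) Q in 𝓝 (0, v, w), x.1 ≠ 0 →
      S.dPair B x.1 x.2.1 = S.dPair B x.1 x.2.2 → x.2.1 = x.2.2 := by
  have hpv : ContinuousAt (fun x : ℝ × TangentBundle 𝓘(ℝ, E) Q × TangentBundle 𝓘(ℝ, E) Q =>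
      (x.1, x.2.1)) (0, v, w) := by fun_prop
  have hpw : ContinuousAt (fun x : ℝ × TangentBundle 𝓘(ℝ, E) Q × TangentBundle 𝓘(ℝ, E) Q =>
      (x.1, x.2.2)) (0, v, w) := by fun_prop
  -- Over different base points `∂⁻` separates, since at `h = 0` it is the projection. Over a common
  -- base point, equal boundary values force equal rescaled values in one chart. The rescaled map is
  -- injective near a single vector, and near two distinct vectors its values stay near these
  -- vectors.
  by_cases hvw : v.proj = w.proj
  · set q := v.proj with hq
    have hv : v ∈ (tchart q).source := mem_tchart_source.2 (mem_chart_source E v.proj)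
    have hw : w ∈ (tchart q).source := mem_tchart_source.2 (hvw ▸ mem_chart_source E w.proj)
    -- equality of the boundary values gives equality of the rescaled maps
    have hkey : ∀ {z₀ w₀ m p r m' p' r'}, S.IsBoundaryChart B q z₀ m p r →
        S.IsBoundaryChart B q w₀ m' p' r' → ∀ {h : ℝ} {v' w' : TangentBundle 𝓘(ℝ, E) Q},
        (h, v') ∈ IsBoundaryChart.source q z₀ r → (h, w') ∈ IsBoundaryChart.source q w₀ r' →
        S.dPair B h v' = S.dPair B h w' →
        rescaled m p h (tchart q v') = rescaled m' p' h (tchart q w') := by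
      intro z₀ w₀ m p r m' p' r' hc hc' h v' w' hv' hw' heq
      have e : S.dPairTilde B (h, v') = S.dPairTilde B (h, w') := congrArg (Prod.mk h) heq
      rw [hc.dPairTilde_eq hv', hc'.dPairTilde_eq hw'] at e
      have e1 := (chartAt E q).symm.injOn (hc.minus_mem _ hv'.1 _ hv'.2.2)
        (hc'.minus_mem _ hw'.1 _ hw'.2.2) (congrArg (fun x : ℝ × Q × Q => x.2.1) e)
      have e2 := (chartAt E q).symm.injOn (hc.plus_mem _ hv'.1 _ hv'.2.2)
        (hc'.plus_mem _ hw'.1 _ hw'.2.2) (congrArg (fun x : ℝ × Q × Q => x.2.2) e)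
      simp only [rescaled, e1, e2]
    obtain ⟨m, p, r, hc⟩ := hS.exists_boundaryChart B q (z₀ := tchart q v)
      (mem_tchart_target.1 ((tchart q).map_source hv))
    have hsv := hpv.eventually_mem (IsBoundaryChart.isOpen_source.mem_nhds (hc.mem_source hv rfl))
    by_cases hne : v = w
    · subst hne
      have hsw := hpw.eventually_mem
        (IsBoundaryChart.isOpen_source.mem_nhds (hc.mem_source hv rfl))
      filter_upwards [hsv, hsw] with x h1 h2 h0 heq
      have e := hkey hc hc h1 h2 heq
      have hest := hc.close x.1 h0 (abs_lt.2 h1.1) _ h1.2.2 _ h2.2.2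
      rw [e, sub_self, zero_sub, norm_neg] at hest
      have : ‖tchart q x.2.1 - tchart q x.2.2‖ ≤ 0 := by linarith
      exact (tchart q).injOn h1.2.1 h2.2.1 (sub_eq_zero.1 (norm_le_zero_iff.1 this))
    · obtain ⟨m', p', r', hc'⟩ := hS.exists_boundaryChart B q (z₀ := tchart q w)
        (mem_tchart_target.1 ((tchart q).map_source hw))
      have hsw := hpw.eventually_mem
        (IsBoundaryChart.isOpen_source.mem_nhds (hc'.mem_source hw rfl))
      have hd : 0 < ‖tchart q v - tchart q w‖ :=
        norm_pos_iff.2 (sub_ne_zero.2 fun h => hne ((tchart q).injOn hv hw h))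
      -- A common rescaled value would lie within a third of the distance from each of the two
      -- vectors, contradicting the triangle inequality.
      obtain ⟨ε, hε, ht⟩ := hc.tendsto (‖tchart q v - tchart q w‖ / 3) (by linarith)
      obtain ⟨ε', hε', ht'⟩ := hc'.tendsto (‖tchart q v - tchart q w‖ / 3) (by linarith)
      have hcont : ∀ {u : TangentBundle 𝓘(ℝ, E) Q}, u ∈ (tchart q).source →
          ContinuousAt (tchart q) u := fun hu =>
        (contMDiffOn_tchart q).continuousOn.continuousAt ((isOpen_tchart_source q).mem_nhds hu)
      have b1 : ∀ᶠ x : ℝ × TangentBundle 𝓘(ℝ, E) Q × TangentBundle 𝓘(ℝ, E) Q in 𝓝 (0, v, w),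
          tchart q x.2.1 ∈ Metric.ball (tchart q v) ε := by
        have : ContinuousAt (fun x : ℝ × TangentBundle 𝓘(ℝ, E) Q × TangentBundle 𝓘(ℝ, E) Q =>
            tchart q x.2.1) (0, v, w) :=
          ContinuousAt.comp (g := tchart q) (hcont hv) (by fun_prop)
        exact this.eventually_mem (Metric.ball_mem_nhds _ hε)
      have b2 : ∀ᶠ x : ℝ × TangentBundle 𝓘(ℝ, E) Q × TangentBundle 𝓘(ℝ, E) Q in 𝓝 (0, v, w),
          tchart q x.2.2 ∈ Metric.ball (tchart q w) ε' := by
        have : ContinuousAt (fun x : ℝ × TangentBundle 𝓘(ℝ, E) Q × TangentBundle 𝓘(ℝ, E) Q =>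
            tchart q x.2.2) (0, v, w) :=
          ContinuousAt.comp (g := tchart q) (hcont hw) (by fun_prop)
        exact this.eventually_mem (Metric.ball_mem_nhds _ hε')
      have b3 : ∀ᶠ x : ℝ × TangentBundle 𝓘(ℝ, E) Q × TangentBundle 𝓘(ℝ, E) Q in 𝓝 (0, v, w),
          |x.1| < min ε ε' := by
        have : ContinuousAt (fun x : ℝ × TangentBundle 𝓘(ℝ, E) Q × TangentBundle 𝓘(ℝ, E) Q =>
            |x.1|) (0, v, w) := by fun_prop
        exact this.eventually_lt_const (by simp [hε, hε'])
      filter_upwards [hsv, hsw, b1, b2, b3] with x h1 h2 h3 h4 h5 h0 heq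
      have e := hkey hc hc' h1 h2 heq
      have i1 := ht x.1 h0 (h5.trans_le (min_le_left _ _)) _ h3
      have i2 := ht' x.1 h0 (h5.trans_le (min_le_right _ _)) _ h4
      rw [e] at i1
      have := norm_sub_le_norm_sub_add_norm_sub (tchart q v)
        (rescaled m' p' x.1 (tchart q x.2.2)) (tchart q w)
      rw [norm_sub_rev (tchart q v) (rescaled _ _ _ _)] at this
      linarith
  · obtain ⟨O₁, O₂, hO₁, hO₂, h₁, h₂, hd⟩ := t2_separation hvw
    have hc : ∀ u : TangentBundle 𝓘(ℝ, E) Q,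
        ContinuousAt (fun y => (S.dPairTilde B y).2.1) (0, u) := fun u =>
      (hS.continuousAt_dPairTilde B u).snd.fst
    have c1 : ∀ᶠ x : ℝ × TangentBundle 𝓘(ℝ, E) Q × TangentBundle 𝓘(ℝ, E) Q in 𝓝 (0, v, w),
        S.dMinus B x.1 x.2.1 ∈ O₁ := by
      have : ContinuousAt (fun x : ℝ × TangentBundle 𝓘(ℝ, E) Q × TangentBundle 𝓘(ℝ, E) Q =>
          S.dMinus B x.1 x.2.1) (0, v, w) :=
        ContinuousAt.comp (g := fun y => (S.dPairTilde B y).2.1) (x := ((0 : ℝ), v, w)) (hc v) hpv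
      refine this.eventually_mem (hO₁.mem_nhds ?_)
      rw [hS.dMinus_zero B v]
      exact h₁
    have c2 : ∀ᶠ x : ℝ × TangentBundle 𝓘(ℝ, E) Q × TangentBundle 𝓘(ℝ, E) Q in 𝓝 (0, v, w),
        S.dMinus B x.1 x.2.2 ∈ O₂ := by
      have : ContinuousAt (fun x : ℝ × TangentBundle 𝓘(ℝ, E) Q × TangentBundle 𝓘(ℝ, E) Q =>
          S.dMinus B x.1 x.2.2) (0, v, w) :=
        ContinuousAt.comp (g := fun y => (S.dPairTilde B y).2.1) (x := ((0 : ℝ), v, w)) (hc w) hpw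
      refine this.eventually_mem (hO₂.mem_nhds ?_)
      rw [hS.dMinus_zero B w]
      exact h₂
    filter_upwards [c1, c2] with x h1 h2 _ heq
    have e : S.dMinus B x.1 x.2.1 = S.dMinus B x.1 x.2.2 := congrArg Prod.fst heq
    exact absurd h2 (disjoint_left.1 hd (e ▸ h1))

/-- Local separation of pairs becomes, by compactness of `K n × K n`, injectivity on `K n` for all
steps `0 < |h| < ε n`. The neighbourhood is the union of the sets `(-ε n, ε n) × interior (K n)`, so
no bound on `h` uniform over `TQ` is needed. Local inverses then make the map a diffeomorphism onto
its image off `h = 0`. -/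
theorem IsRegular.exists_isAdaptedPair [SecondCountableTopology Q] (hS : S.IsRegular)
    (B : BoundaryTimes) : ∃ U W, S.IsAdaptedPair B U W := by
  obtain ⟨hlc, hsc⟩ := sigmaCompactSpace_tangentBundle (E := E) (Q := Q)
  choose m p r hc using fun v : TangentBundle 𝓘(ℝ, E) Q => hS.exists_boundaryChart_at B v
  set N : Set (ℝ × TangentBundle 𝓘(ℝ, E) Q) :=
    ⋃ v, IsBoundaryChart.source v.proj (tchart v.proj v) (r v) with hN
  have hNo : IsOpen N := isOpen_iUnion fun v => IsBoundaryChart.isOpen_source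
  have hN0 : ∀ v, (0, v) ∈ N := fun v => mem_iUnion.2 ⟨v, (hc v).mem_source
    (mem_tchart_source.2 (mem_chart_source E v.proj)) rfl⟩
  let K : CompactExhaustion (TangentBundle 𝓘(ℝ, E) Q) := default
  have hε : ∀ n, ∃ ε > 0, ∀ h : ℝ, |h| < ε → (∀ v ∈ K n, (h, v) ∈ N) ∧
      (h ≠ 0 → InjOn (S.dPair B h) (K n)) := by
    intro n
    have h1 : ∀ᶠ h : ℝ in 𝓝 0, ∀ v ∈ K n, (h, v) ∈ N :=
      (K.isCompact n).eventually_forall_of_forall_eventually fun v _ => hNo.mem_nhds (hN0 v)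
    have h2 : ∀ᶠ h : ℝ in 𝓝 0, ∀ x ∈ K n ×ˢ K n, h ≠ 0 →
        S.dPair B h x.1 = S.dPair B h x.2 → x.1 = x.2 :=
      ((K.isCompact n).prod (K.isCompact n)).eventually_forall_of_forall_eventually
        fun x _ => hS.eventually_injective B x.1 x.2
    obtain ⟨ε, hε, h⟩ := Metric.eventually_nhds_iff.1 (h1.and h2)
    refine ⟨ε, hε, fun t ht => ?_⟩
    have := h (show dist t 0 < ε by rwa [dist_zero_right])
    exact ⟨this.1, fun t0 v hv w hw hvw => this.2 (v, w) ⟨hv, hw⟩ t0 hvw⟩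
  choose ε hε hεN using hε
  set U : Set (ℝ × TangentBundle 𝓘(ℝ, E) Q) := ⋃ n, Ioo (-ε n) (ε n) ×ˢ interior (K n) with hU
  have hUo : IsOpen U := isOpen_iUnion fun n => isOpen_Ioo.prod isOpen_interior
  have hU0 : ∀ v, (0, v) ∈ U := fun v => by
    obtain ⟨n, hn⟩ := K.exists_mem_nhds v
    exact mem_iUnion.2 ⟨n, ⟨neg_lt_zero.2 (hε n), hε n⟩, mem_interior_iff_mem_nhds.2 hn⟩
  have hUN : U ⊆ N := by
    intro x hx
    obtain ⟨n, hn, hx'⟩ := mem_iUnion.1 hx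
    exact (hεN n x.1 (abs_lt.2 hn)).1 x.2 (interior_subset hx')
  have hinj : InjOn (S.dPairTilde B) {x ∈ U | x.1 ≠ 0} := by
    rintro ⟨h, v⟩ ⟨hv, h0⟩ ⟨h', w⟩ ⟨hw, -⟩ heq
    obtain rfl : h = h' := congrArg Prod.fst heq
    have heq' : S.dPair B h v = S.dPair B h w := congrArg Prod.snd heq
    obtain ⟨n, hn, hv'⟩ := mem_iUnion.1 hv
    obtain ⟨k, hk, hw'⟩ := mem_iUnion.1 hw
    -- Both vectors lie in the member of the exhaustion with the larger index, and `h` already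
    -- satisfies the bound belonging to that index.
    rcases le_total n k with hnk | hnk
    · exact congrArg (Prod.mk h) ((hεN k h (abs_lt.2 hk)).2 h0
        (K.subset hnk (interior_subset hv')) (interior_subset hw') heq')
    · exact congrArg (Prod.mk h) ((hεN n h (abs_lt.2 hn)).2 h0 (interior_subset hv')
        (K.subset hnk (interior_subset hw')) heq')
  refine ⟨U, S.dPairTilde B '' U, hUo, hU0, ?_, ?_, rfl, ?_⟩
  · intro x hx
    obtain ⟨v, hv⟩ := mem_iUnion.1 (hUN hx)
    exact (hc v).source_subset hv
  · exact fun q => ⟨(0, ⟨q, 0⟩), hU0 _, hS.dPairTilde_zero B _⟩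
  · have himage : {x ∈ S.dPairTilde B '' U | x.1 ≠ 0} = S.dPairTilde B '' {x ∈ U | x.1 ≠ 0} := by
      ext y
      constructor
      · rintro ⟨⟨x, hx, rfl⟩, h0⟩
        exact ⟨x, ⟨hx, h0⟩, rfl⟩
      · rintro ⟨x, ⟨hx, h0⟩, rfl⟩
        exact ⟨⟨x, hx, rfl⟩, h0⟩
    rw [himage]
    refine isDiffeoOn_image_of_localInverse ⟨fun y => (y.1, ⟨y.2.1, 0⟩)⟩
      (hUo.inter (isOpen_ne_fun continuous_fst continuous_const)) ?_ hinj ?_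
    · intro x hx
      obtain ⟨v, hv⟩ := mem_iUnion.1 (hUN hx.1)
      exact ((hc v).contMDiffOn_dPairTilde.contMDiffAt
        (IsBoundaryChart.isOpen_source.mem_nhds hv)).contMDiffWithinAt
    · intro x hx
      obtain ⟨v, hv⟩ := mem_iUnion.1 (hUN hx.1)
      exact (hc v).exists_localInverse hv hx.2

/-- For `h ≠ 0`, both boundary values equal `q'` exactly when the rescaled map takes the value `(q',
0)`. That map covers the ball of radius `ε / 4` around its value at `z₀ = (q, 0)`; one error of `ε /
8` allows for the distance of this value from `z₀`, the other for `q'` varying near `q`. Compactness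
of the closure of `Q₀` makes the step bound uniform. -/
theorem IsRegular.exists_diagonal_bound (hS : S.IsRegular)
    {U : Set (ℝ × TangentBundle 𝓘(ℝ, E) Q)} {W : Set (ℝ × Q × Q)} (hUW : S.IsAdaptedPair B U W)
    {Q₀ : Set Q} (hQ₀ : IsCompact (closure Q₀)) :
    ∃ a > 0, ∀ h : ℝ, |h| < a → ∀ q ∈ Q₀, (h, q, q) ∈ W := by
  obtain ⟨hUo, hU0, -, hW0, hUWi, -⟩ := hUW
  suffices h : ∀ᶠ h : ℝ in 𝓝 0, ∀ q ∈ closure Q₀, (h, q, q) ∈ W by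
    obtain ⟨a, ha, h⟩ := Metric.eventually_nhds_iff.1 h
    exact ⟨a, ha, fun t ht q hq => h (show dist t 0 < a by rwa [dist_zero_right]) q
      (subset_closure hq)⟩
  refine hQ₀.eventually_forall_of_forall_eventually fun q _ => ?_
  set v : TangentBundle 𝓘(ℝ, E) Q := ⟨q, 0⟩ with hv
  have hvs : v ∈ (tchart q).source := mem_tchart_source.2 (mem_chart_source E q)
  obtain ⟨m, p, r, hc⟩ := hS.exists_boundaryChart_at B v
  set z₀ := tchart q v with hz₀
  have hz₀' : z₀ = (chartAt E q q, 0) := by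
    rw [hz₀, tchart_apply]
    exact Prod.ext rfl (map_zero _)
  have hcs : ContinuousAt (fun y : ℝ × E × E => (y.1, (tchart q).symm y.2)) ((0 : ℝ), z₀) := by
    refine continuousAt_fst.prodMk (ContinuousAt.comp (g := (tchart q).symm) ?_ continuousAt_snd)
    exact (contMDiffOn_tchart_symm q).continuousOn.continuousAt
      ((isOpen_tchart_target q).mem_nhds ((tchart q).map_source hvs))
  have hnear := hcs.eventually_mem (s := U) (hUo.mem_nhds (by
    simp only [hz₀]
    rw [(tchart q).left_inv hvs]
    exact hU0 v))
  obtain ⟨ε₁, hε₁, hball⟩ := Metric.eventually_nhds_iff.1 hnear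
  set ε := min ε₁ r
  have hε : 0 < ε := lt_min hε₁ hc.pos
  obtain ⟨ε₂, hε₂, hlim⟩ := hc.tendsto (ε / 8) (by linarith)
  have e1 : ∀ᶠ x : ℝ × Q in 𝓝 (0, q), |x.1| < min ε ε₂ := by
    have : ContinuousAt (fun x : ℝ × Q => |x.1|) (0, q) := by fun_prop
    exact this.eventually_lt_const (by simp [hε, hε₂])
  have e2 : ∀ᶠ x : ℝ × Q in 𝓝 (0, q), x.2 ∈ (chartAt E q).source :=
    continuousAt_snd.eventually_mem (chart_source_mem_nhds E q)
  have e3 : ∀ᶠ x : ℝ × Q in 𝓝 (0, q), ‖chartAt E q x.2 - chartAt E q q‖ < ε / 8 := by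
    have h1 : ContinuousAt (chartAt E q) q := (chartAt E q).continuousAt (mem_chart_source E q)
    have h2 : ContinuousAt (fun x : ℝ × Q => ‖chartAt E q x.2 - chartAt E q q‖) (0, q) :=
      ((ContinuousAt.comp (g := chartAt E q) (f := Prod.snd) (x := ((0 : ℝ), q)) h1
        continuousAt_snd).sub continuousAt_const).norm
    exact h2.eventually_lt_const (by simp only [sub_self, norm_zero]; linarith)
  filter_upwards [e1, e2, e3] with x h1 h2 h3
  obtain ⟨h, q'⟩ := x
  change |h| < min ε ε₂ at h1
  change q' ∈ (chartAt E q).source at h2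
  change ‖chartAt E q q' - chartAt E q q‖ < ε / 8 at h3
  change (h, q', q') ∈ W
  by_cases h0 : h = 0
  · rw [h0]
    exact hW0 q'
  have hhε : |h| < ε := h1.trans_le (min_le_left _ _)
  have hhr : |h| < r := hhε.trans_le (min_le_right _ _)
  have hsub : Metric.ball z₀ ε ⊆ Metric.ball z₀ r := Metric.ball_subset_ball (min_le_right _ _)
  have hcl := hlim h h0 (h1.trans_le (min_le_right _ _)) z₀ (Metric.mem_ball_self hε₂)
  obtain ⟨z, hz, hzeq⟩ := exists_preimage_of_near_id hε
    (fun z hz w hw => hc.close h h0 hhr z (hsub hz) w (hsub hw))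
    (y := (chartAt E q q', 0)) (by
      have h4 : ‖((chartAt E q q', 0) : E × E) - z₀‖ ≤ ε / 8 := by
        rw [hz₀', Prod.mk_sub_mk, Prod.norm_mk, sub_zero, norm_zero]
        exact max_le h3.le (by linarith)
      have := norm_sub_le_norm_sub_add_norm_sub ((chartAt E q q', 0) : E × E) z₀
        (rescaled m p h z₀)
      rw [norm_sub_rev z₀] at this
      exact this.trans (by linarith [show ‖rescaled m p h z₀ - z₀‖ ≤ ε / 8 from hcl]))
  have hm : m (h, z) = chartAt E q q' := congrArg Prod.fst hzeq
  have hp : p (h, z) = chartAt E q q' := by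
    have h5 : h⁻¹ • (p (h, z) - m (h, z)) = 0 := congrArg Prod.snd hzeq
    rw [← hm]
    exact sub_eq_zero.1 ((smul_eq_zero.1 h5).resolve_left (inv_ne_zero h0))
  rw [← hUWi]
  refine ⟨(h, (tchart q).symm z), ?_, ?_⟩
  · refine hball (y := (h, z)) ?_
    rw [Prod.dist_eq, max_lt_iff, dist_zero_right, Real.norm_eq_abs]
    exact ⟨hhε.trans_le (min_le_left _ _), lt_of_lt_of_le hz (min_le_left _ _)⟩
  · have hm' := hc.dMinus_eq h (abs_lt.1 hhr) z (hsub hz)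
    have hp' := hc.dPlus_eq h (abs_lt.1 hhr) z (hsub hz)
    rw [hm] at hm'
    rw [hp] at hp'
    have hq' := (chartAt E q).left_inv h2
    exact Prod.ext rfl (Prod.ext (hm'.trans hq') (hp'.trans hq'))

end ForcedMechanicalSystem

end Existence

/-! ### Calculus of one-forms -/

section FormCalculus

variable {E : Type*} [NormedAddCommGroup E] [NormedSpace ℝ E]
  {H : Type*} [TopologicalSpace H] {I : ModelWithCorners ℝ E H}
  {M : Type*} [TopologicalSpace M] [ChartedSpace H M]
  {E' : Type*} [NormedAddCommGroup E'] [NormedSpace ℝ E']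
  {H' : Type*} [TopologicalSpace H'] {J : ModelWithCorners ℝ E' H'}
  {N : Type*} [TopologicalSpace N] [ChartedSpace H' N]

theorem mfderiv_slice {f : ℝ × M → N} {h : ℝ} {v : M}
    (hf : MDifferentiableAt (𝓘(ℝ, ℝ).prod I) J f (h, v)) (ξ : TangentSpace I v) :
    mfderiv I J (fun w => f (h, w)) v ξ =
      mfderiv (𝓘(ℝ, ℝ).prod I) J f (h, v) ((0, ξ) : ℝ × E) := by
  have h1 : MDifferentiableAt I (𝓘(ℝ, ℝ).prod I) (fun w : M => (h, w)) v :=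
    mdifferentiableAt_const.prodMk mdifferentiableAt_id
  refine (mfderiv_comp_apply (I' := 𝓘(ℝ, ℝ).prod I) v hf h1 ξ).trans ?_
  exact congrArg (fun L : E →L[ℝ] ℝ × E => mfderiv (𝓘(ℝ, ℝ).prod I) J f (h, v) (L ξ))
    mfderiv_prod_right

theorem LagForce.mu_comap {D : LagForce J N} {g : M → N} {x : M}
    (hD : MDifferentiableAt J 𝓘(ℝ, ℝ) D.lag (g x)) (hg : MDifferentiableAt I J g x)
    (ξ : TangentSpace I x) : (D.comap I J g).mu x ξ = D.mu (g x) (mfderiv I J g x ξ) := by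
  have h := mfderiv_comp_apply x hD hg ξ
  exact congrArg (· + D.force (g x) (mfderiv I J g x ξ)) h

/-- The force is compared pointwise, but the derivative of the Lagrangian needs agreement on a
neighbourhood; hence the openness. -/
theorem LagForce.mu_congr {D D' : LagForce I M} {s : Set M} (hs : IsOpen s) (h : LagForce.EqOn s D D')
    {x : M} (hx : x ∈ s) : D.mu x = D'.mu x := by
  have h1 : D.lag =ᶠ[𝓝 x] D'.lag := by
    filter_upwards [hs.mem_nhds hx] with y hy using (h y hy).1
  have h2 : mfderiv I 𝓘(ℝ, ℝ) D.lag x = mfderiv I 𝓘(ℝ, ℝ) D'.lag x := h1.mfderiv_eq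
  ext ξ
  exact congrArg₂ (· + ·) (congrArg (fun L : E →L[ℝ] ℝ => L ξ) h2)
    (congrArg (fun L : E →L[ℝ] ℝ => L ξ) (h x hx).2)

variable [IsManifold I ∞ M] [IsManifold J ∞ N]

/-- Vectors along the slices, as tangent vectors of `ℝ × M` with zero time component. Through them,
smoothness of fibrewise derivatives of a family follows from smoothness of its full tangent map. -/
theorem contMDiff_tangentInr : ContMDiff (𝓘(ℝ, ℝ).prod I.tangent) (𝓘(ℝ, ℝ).prod I).tangent ∞
    (fun p : ℝ × TangentBundle I M =>
      (⟨(p.1, p.2.proj), ((0, p.2.2) : ℝ × E)⟩ : TangentBundle (𝓘(ℝ, ℝ).prod I) (ℝ × M))) := by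
  have h1 : IsManifold I 1 M := .of_le (n := ∞) (by simp)
  have h0 : ContMDiff 𝓘(ℝ, ℝ) 𝓘(ℝ, ℝ).tangent ∞
      (fun t : ℝ => (⟨t, (0 : ℝ)⟩ : TangentBundle 𝓘(ℝ, ℝ) ℝ)) :=
    Bundle.contMDiff_zeroSection ℝ (TangentSpace 𝓘(ℝ, ℝ) : ℝ → Type _)
  exact (contMDiff_equivTangentBundleProd_symm (I := 𝓘(ℝ, ℝ)) (I' := I) (M := ℝ) (M' := M)
    (n := ∞)).comp ((h0.comp contMDiff_fst).prodMk contMDiff_snd)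

/-- The fibrewise tangent maps of a smooth family depend smoothly on the parameter. -/
theorem contMDiffOn_tangentMap_slice {f : ℝ × M → N} {s : Set (ℝ × M)} (hs : IsOpen s)
    (hf : ContMDiffOn (𝓘(ℝ, ℝ).prod I) J ∞ f s) :
    ContMDiffOn (𝓘(ℝ, ℝ).prod I.tangent) J.tangent ∞
      (fun p : ℝ × TangentBundle I M => tangentMap I J (fun w => f (p.1, w)) p.2)
      {p | (p.1, p.2.proj) ∈ s} := by
  refine ((contMDiffOn_tangentMap_of_isOpen hs hf).comp contMDiff_tangentInr.contMDiffOn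
    fun p hp => hp).congr ?_
  rintro ⟨h, v, ξ⟩ hp
  exact tangentBundle_mk_eq_mk rfl (mfderiv_slice
    ((hf.contMDiffAt (hs.mem_nhds hp)).mdifferentiableAt (by simp)) ξ)

theorem smoothFormFamilyOn_mu {D : ℝ → LagForce I M} {s : Set (ℝ × M)} (hs : IsOpen s)
    (hl : ContMDiffOn (𝓘(ℝ, ℝ).prod I) 𝓘(ℝ, ℝ) ∞ (fun p : ℝ × M => (D p.1).lag p.2) s)
    (hf : SmoothFormFamilyOn I (fun h => (D h).force) s) :
    SmoothFormFamilyOn I (fun h => (D h).mu) s := by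
  have h1 := (contMDiff_snd_tangentBundle_modelSpace ℝ 𝓘(ℝ, ℝ) (n := ∞)).comp_contMDiffOn
    (contMDiffOn_tangentMap_slice hs hl)
  exact h1.add hf

theorem SmoothFormFamilyOn.slice {α : ℝ → OneForm I M} {s : Set (ℝ × M)}
    (hα : SmoothFormFamilyOn I α s) (h : ℝ) : SmoothFormOn I (α h) {v | (h, v) ∈ s} :=
  ContMDiffOn.comp (g := fun p : ℝ × TangentBundle I M => α p.1 p.2.proj p.2.2) hα
    (f := fun ξ : TangentBundle I M => (h, ξ))
    (contMDiff_const.prodMk contMDiff_id).contMDiffOn fun _ hξ => hξ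

theorem SmoothFormOn.mono {α : OneForm I M} {s t : Set M} (hα : SmoothFormOn I α s) (hts : t ⊆ s) :
    SmoothFormOn I α t := ContMDiffOn.mono hα fun _ hξ => hts hξ

theorem SmoothFormOn.add {α β : OneForm I M} {s : Set M} (hα : SmoothFormOn I α s)
    (hβ : SmoothFormOn I β s) : SmoothFormOn I (fun x => α x + β x) s :=
  ContMDiffOn.add hα hβ

theorem SmoothFormOn.pullback {α : OneForm J N} {t : Set N} (hα : SmoothFormOn J α t) {g : M → N}
    {s : Set M} (hs : IsOpen s) (hg : ContMDiffOn I J ∞ g s) (hst : MapsTo g s t) :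
    SmoothFormOn I (pullback I J g α) s :=
  ContMDiffOn.comp (g := fun ξ : TangentBundle J N => α ξ.proj ξ.2) hα
    (contMDiffOn_tangentMap_of_isOpen hs hg) fun _ hξ => hst hξ

theorem SmoothFormFamilyOn.timeForm {α : ℝ → OneForm I M} {s : Set (ℝ × M)}
    (hα : SmoothFormFamilyOn I α s) : SmoothFormOn (𝓘(ℝ, ℝ).prod I) (timeForm I α) s := by
  have h1 : ContMDiff (𝓘(ℝ, ℝ).prod I).tangent (𝓘(ℝ, ℝ).prod I.tangent) ∞
      (fun ξ : TangentBundle (𝓘(ℝ, ℝ).prod I) (ℝ × M) =>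
        (ξ.proj.1, tangentMap (𝓘(ℝ, ℝ).prod I) I Prod.snd ξ)) :=
    (contMDiff_fst.comp (Bundle.contMDiff_proj
      (TangentSpace (𝓘(ℝ, ℝ).prod I) : ℝ × M → Type _))).prodMk
      (contMDiff_snd.contMDiff_tangentMap (m := ∞) (n := ∞) (by simp))
  exact ContMDiffOn.comp (g := fun p : ℝ × TangentBundle I M => α p.1 p.2.proj p.2.2) hα
    h1.contMDiffOn fun _ hξ => hξ

/-- Pull-back of a smooth family of forms by a smooth family of maps. -/
theorem SmoothFormFamilyOn.pullback {α : ℝ → OneForm J N} {t : Set (ℝ × N)}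
    (hα : SmoothFormFamilyOn J α t) {g : ℝ × M → N} {s : Set (ℝ × M)} (hs : IsOpen s)
    (hg : ContMDiffOn (𝓘(ℝ, ℝ).prod I) J ∞ g s) (hst : ∀ p ∈ s, (p.1, g p) ∈ t) :
    SmoothFormFamilyOn I (fun h => pullback I J (fun v => g (h, v)) (α h)) s :=
  ContMDiffOn.comp (g := fun p : ℝ × TangentBundle J N => α p.1 p.2.proj p.2.2) hα
    (contMDiffOn_fst.prodMk (contMDiffOn_tangentMap_slice hs hg)) fun _ hp => hst _ hp

theorem SmoothFormFamilyOn.congr {α β : ℝ → OneForm I M} {s : Set (ℝ × M)}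
    (hα : SmoothFormFamilyOn I α s) (h : ∀ p ∈ s, β p.1 p.2 = α p.1 p.2) :
    SmoothFormFamilyOn I β s :=
  ContMDiffOn.congr hα fun p hp =>
    congrArg (fun L : E →L[ℝ] ℝ => L p.2.2) (h (p.1, p.2.proj) hp)

namespace LagForce

theorem SmoothOn.congr {D D' : LagForce I M} {s : Set M} (hD : D.SmoothOn s)
    (h : LagForce.EqOn s D D') : D'.SmoothOn s :=
  ⟨hD.1.congr fun x hx => ((h x hx).1).symm, ContMDiffOn.congr hD.2 fun ξ hξ =>
    congrArg (fun L : E →L[ℝ] ℝ => L ξ.2) (h ξ.proj hξ).2.symm⟩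

theorem SmoothOn.mono {D : LagForce I M} {s t : Set M} (hD : D.SmoothOn s) (hts : t ⊆ s) :
    D.SmoothOn t := ⟨hD.1.mono hts, hD.2.mono hts⟩

theorem SmoothOn.comap {D : LagForce J N} {t : Set N} (hD : D.SmoothOn t) {g : M → N} {s : Set M}
    (hs : IsOpen s) (hg : ContMDiffOn I J ∞ g s) (hst : MapsTo g s t) :
    (D.comap I J g).SmoothOn s :=
  ⟨hD.1.comp hg hst, hD.2.pullback hs hg hst⟩

theorem SmoothOn.smoothFormOn_mu {D : LagForce I M} {s : Set M} (hs : IsOpen s)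
    (hD : D.SmoothOn s) : SmoothFormOn I D.mu s :=
  ((contMDiff_snd_tangentBundle_modelSpace ℝ 𝓘(ℝ, ℝ) (n := ∞)).comp_contMDiffOn
    (contMDiffOn_tangentMap_of_isOpen hs hD.1)).add hD.2

end LagForce

end FormCalculus

/-! ### Submanifolds, tangent sets and transfer of critical problems -/

section Submanifolds

variable {E : Type*} [NormedAddCommGroup E] [NormedSpace ℝ E]
  {H : Type*} [TopologicalSpace H] {I : ModelWithCorners ℝ E H}
  {M : Type*} [TopologicalSpace M] [ChartedSpace H M]
  {E' : Type*} [NormedAddCommGroup E'] [NormedSpace ℝ E']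
  {H' : Type*} [TopologicalSpace H'] {J : ModelWithCorners ℝ E' H'}
  {N : Type*} [TopologicalSpace N] [ChartedSpace H' N]

theorem isEmbeddedSubmanifold_of_isOpen {S : Set M} (hS : IsOpen S) :
    IsEmbeddedSubmanifold I S := by
  refine fun x hx => ⟨0, S, fun _ => 0, hS, hx, contMDiffOn_const, fun y _ η => ⟨0, ?_⟩, ?_⟩
  · exact Subsingleton.elim (α := EuclideanSpace ℝ (Fin 0)) _ _
  · ext y
    simp

/-- The locus where two maps with transverse differentials agree is a submanifold. -/
theorem isEmbeddedSubmanifold_eqLocus [FiniteDimensional ℝ E'] {Q : Type*} [TopologicalSpace Q]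
    [ChartedSpace E' Q] [IsManifold 𝓘(ℝ, E') ∞ Q] {O : Set M} (hO : IsOpen O) {f g : M → Q}
    (hf : ContMDiffOn I 𝓘(ℝ, E') ∞ f O) (hg : ContMDiffOn I 𝓘(ℝ, E') ∞ g O)
    (hfg : ∀ y ∈ O, ∀ η : E', ∃ ξ : TangentSpace I y,
      mfderiv I 𝓘(ℝ, E') f y ξ = η ∧ mfderiv I 𝓘(ℝ, E') g y ξ = 0) :
    IsEmbeddedSubmanifold I {y | y ∈ O ∧ f y = g y} := by
  have h1 : IsManifold 𝓘(ℝ, E') 1 Q := .of_le (n := ∞) (by simp)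
  rintro x ⟨hx, hxe⟩
  set χ := extChartAt 𝓘(ℝ, E') (f x) with hχ
  set O' := (O ∩ f ⁻¹' χ.source) ∩ (O ∩ g ⁻¹' χ.source) with hO'
  have hO'o : IsOpen O' :=
    (hf.continuousOn.isOpen_inter_preimage hO (isOpen_extChartAt_source _)).inter
      (hg.continuousOn.isOpen_inter_preimage hO (isOpen_extChartAt_source _))
  have hχs : ContMDiffOn 𝓘(ℝ, E') 𝓘(ℝ, E') ∞ χ χ.source := by
    rw [hχ, extChartAt_source]
    exact contMDiffOn_extChartAt
  have hcf : ContMDiffOn I 𝓘(ℝ, E') ∞ (fun y => χ (f y)) O' :=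
    hχs.comp (hf.mono fun y hy => hy.1.1) fun y hy => hy.1.2
  have hcg : ContMDiffOn I 𝓘(ℝ, E') ∞ (fun y => χ (g y)) O' :=
    hχs.comp (hg.mono fun y hy => hy.1.1) fun y hy => hy.2.2
  set e : E' ≃L[ℝ] EuclideanSpace ℝ (Fin (Module.finrank ℝ E')) := toEuclidean
  -- The defining function is the difference of both maps in a chart around their common value; it
  -- cuts out the locus since the chart is injective. A vector moving `f` as prescribed while fixing
  -- `g` shows that it is a submersion.
  refine ⟨Module.finrank ℝ E', O', fun y => e (χ (f y) - χ (g y)), hO'o, ?_, ?_, ?_, ?_⟩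
  · refine ⟨⟨hx, mem_extChartAt_source _⟩, hx, ?_⟩
    rw [mem_preimage, ← hxe]
    exact mem_extChartAt_source _
  · exact e.contDiff.contMDiff.comp_contMDiffOn (hcf.sub hcg)
  · intro y hy η
    have hat : ∀ {k : M → Q}, ContMDiffOn I 𝓘(ℝ, E') ∞ k O → MDifferentiableAt I 𝓘(ℝ, E') k y :=
      fun hk => (hk.contMDiffAt (hO.mem_nhds hy.1.1)).mdifferentiableAt (by simp)
    have hχat : ∀ {q : Q}, q ∈ χ.source → MDifferentiableAt 𝓘(ℝ, E') 𝓘(ℝ, E') χ q := fun hq =>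
      (hχs.contMDiffAt ((isOpen_extChartAt_source _).mem_nhds hq)).mdifferentiableAt (by simp)
    obtain ⟨e₁, he₁⟩ := isInvertible_mfderiv_extChartAt (I := 𝓘(ℝ, E')) hy.1.2
    obtain ⟨ξ, hξ, hξ'⟩ := hfg y hy.1.1 (e₁.symm (e.symm η))
    refine ⟨ξ, ?_⟩
    have d1 : HasMFDerivAt I 𝓘(ℝ, E') (fun z => χ (f z)) y
        ((mfderiv 𝓘(ℝ, E') 𝓘(ℝ, E') χ (f y)).comp (mfderiv I 𝓘(ℝ, E') f y)) :=
      (hχat hy.1.2).hasMFDerivAt.comp y (hat hf).hasMFDerivAt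
    have d2 : HasMFDerivAt I 𝓘(ℝ, E') (fun z => χ (g z)) y
        ((mfderiv 𝓘(ℝ, E') 𝓘(ℝ, E') χ (g y)).comp (mfderiv I 𝓘(ℝ, E') g y)) :=
      (hχat hy.2.2).hasMFDerivAt.comp y (hat hg).hasMFDerivAt
    have d3 := (e.hasFDerivAt (x := χ (f y) - χ (g y))).hasMFDerivAt
    have d4 := (d3.comp y (d1.sub d2)).mfderiv
    refine (congrArg (fun L : E →L[ℝ] EuclideanSpace ℝ (Fin (Module.finrank ℝ E')) => L ξ)
      d4).trans ?_
    have s1 : mfderiv 𝓘(ℝ, E') 𝓘(ℝ, E') χ (f y) (mfderiv I 𝓘(ℝ, E') f y ξ) = e.symm η := by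
      refine (congrArg (mfderiv 𝓘(ℝ, E') 𝓘(ℝ, E') χ (f y)) hξ).trans ?_
      refine (congrArg (fun L : E' →L[ℝ] E' => L (e₁.symm (e.symm η))) he₁).symm.trans ?_
      exact e₁.apply_symm_apply _
    have s2 : mfderiv 𝓘(ℝ, E') 𝓘(ℝ, E') χ (g y) (mfderiv I 𝓘(ℝ, E') g y ξ) = 0 :=
      (congrArg (mfderiv 𝓘(ℝ, E') 𝓘(ℝ, E') χ (g y)) hξ').trans (map_zero _)
    refine (congrArg₂ (fun a b : E' => e (a - b)) s1 s2).trans ?_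
    exact (congrArg e (sub_zero (e.symm (η : EuclideanSpace ℝ _)))).trans (e.apply_symm_apply η)
  · ext y
    constructor
    · rintro ⟨⟨-, hy⟩, hyO⟩
      refine ⟨hyO, ?_⟩
      simp only [hy, sub_self, map_zero]
    · rintro ⟨hyO, hy⟩
      refine ⟨⟨hyO.1.1, ?_⟩, hyO⟩
      exact χ.injOn hyO.1.2 hyO.2.2 (sub_eq_zero.1 ((map_eq_zero_iff e e.injective).1 hy))

/-! #### Tangent sets -/

theorem velocity_comp {c : ℝ → M} {t : ℝ} {f : M → N} (hf : MDifferentiableAt I J f (c t))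
    (hc : MDifferentiableAt 𝓘(ℝ, ℝ) I c t) :
    velocity J (fun s => f (c s)) t = tangentMap I J f (velocity I c t) :=
  tangentBundle_mk_eq_mk rfl (mfderiv_comp_apply t hf hc (1 : ℝ))

theorem velocity_congr {c c' : ℝ → M} {t : ℝ} (h : c =ᶠ[𝓝 t] c') :
    velocity I c t = velocity I c' t :=
  tangentBundle_mk_eq_mk h.eq_of_nhds
    (congrArg (fun L : ℝ →L[ℝ] E => L 1) h.mfderiv_eq)

/-- A straight line in the preferred chart at `x` has the prescribed velocity, because tangent
vectors are written in that chart, and it stays in the open set for short times. -/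
theorem tangentSet_of_isOpen [I.Boundaryless] [IsManifold I ∞ M] {S : Set M} (hS : IsOpen S)
    {x : M} (hx : x ∈ S) : tangentSet I S x = univ := by
  rw [eq_univ_iff_forall]
  intro (ξ : E)
  set l : ℝ → E := fun t => extChartAt I x x + t • ξ
  have hl : ContDiff ℝ ∞ l := by fun_prop
  have hl0 : l 0 = extChartAt I x x := by simp [l]
  set c : ℝ → M := fun t => (extChartAt I x).symm (l t)
  have hc0 : c 0 = x := by simp only [c, hl0, extChartAt_to_inv]
  have hc : ContMDiffAt 𝓘(ℝ, ℝ) I ∞ c 0 := by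
    have h1 : ContMDiffAt 𝓘(ℝ, E) I ∞ (extChartAt I x).symm (l 0) := by
      rw [hl0]
      exact (contMDiffOn_extChartAt_symm x).contMDiffAt (extChartAt_target_mem_nhds x)
    exact h1.comp 0 hl.contMDiff.contMDiffAt
  refine ⟨c, hc, hc.continuousAt.eventually_mem (by rw [hc0]; exact hS.mem_nhds hx), ?_⟩
  refine tangentBundle_mk_eq_mk hc0 ?_
  have h2 : HasFDerivAt l ((1 : ℝ →L[ℝ] ℝ).smulRight ξ) 0 := by
    have := ((hasDerivAt_id (0 : ℝ)).smul_const ξ).const_add (extChartAt I x x)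
    exact this.hasFDerivAt.congr_fderiv (by ext; simp)
  have h3 : HasMFDerivAt 𝓘(ℝ, ℝ) I c 0 ((1 : ℝ →L[ℝ] ℝ).smulRight (ξ : E)) := by
    refine ⟨hc.continuousAt, HasFDerivAt.hasFDerivWithinAt ?_⟩
    refine h2.congr_of_eventuallyEq ?_
    have h4 : ∀ᶠ t in 𝓝 (0 : ℝ), l t ∈ (extChartAt I x).target :=
      hl.continuous.continuousAt.eventually_mem (by rw [hl0]; exact extChartAt_target_mem_nhds x)
    filter_upwards [h4] with t ht
    show extChartAt I (c 0) ((extChartAt I x).symm (l t)) = l t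
    rw [hc0]
    exact (extChartAt I x).right_inv ht
  refine (congrArg (fun L : ℝ →L[ℝ] E => L 1) h3.mfderiv).trans ?_
  exact one_smul ℝ ξ

theorem mfderiv_mem_tangentSet {f : M → N} {C : Set M} {C' : Set N} {m : M}
    (hf : ContMDiffAt I J ∞ f m) (hmaps : MapsTo f C C') {ξ : TangentSpace I m}
    (hξ : ξ ∈ tangentSet I C m) : mfderiv I J f m ξ ∈ tangentSet J C' (f m) := by
  obtain ⟨c, hc, hev, hv⟩ := hξ
  obtain ⟨rfl, rfl⟩ := tangentBundle_mk_eq_mk_iff.1 hv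
  exact ⟨fun t => f (c t), hf.comp 0 hc, hev.mono fun t ht => hmaps ht,
    velocity_comp (hf.mdifferentiableAt (by simp)) (hc.mdifferentiableAt (by simp))⟩

/-- The identity `f ∘ g = id` holds on `C'` only, so it cannot be differentiated as an identity of
maps on `N`; it is differentiated along curves in `C'`, which is enough for vectors of the tangent
set. -/
theorem mfderiv_mfderiv_of_rightInverse {f : M → N} {g : N → M} {C' : Set N} {n : N}
    (hg : ContMDiffAt J I ∞ g n) (hf : ContMDiffAt I J ∞ f (g n)) (hinv : ∀ y ∈ C', f (g y) = y)
    {ξ : TangentSpace J n} (hξ : ξ ∈ tangentSet J C' n) :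
    (mfderiv I J f (g n) (mfderiv J I g n ξ) : E') = ξ := by
  obtain ⟨c, hc, hev, hv⟩ := hξ
  obtain ⟨rfl, rfl⟩ := tangentBundle_mk_eq_mk_iff.1 hv
  have h1 : velocity J (fun t => f (g (c t))) 0 = velocity J c 0 :=
    velocity_congr (hev.mono fun t ht => hinv _ ht)
  have hgc : MDifferentiableAt 𝓘(ℝ, ℝ) I (fun t => g (c t)) 0 :=
    (hg.comp 0 hc).mdifferentiableAt (by simp)
  have h2 := velocity_comp (c := fun t => g (c t)) (hf.mdifferentiableAt (by simp)) hgc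
  have h3 := velocity_comp (c := c) (hg.mdifferentiableAt (by simp))
    (hc.mdifferentiableAt (by simp))
  rw [h3] at h2
  exact (tangentBundle_mk_eq_mk_iff.1 (h2.symm.trans h1)).2

/-- The differential at `g n` of `f` sends tangent vectors of `C` onto those of `C'`, if `f` and `g`
are mutually inverse. -/
theorem exists_mem_tangentSet {f : M → N} {g : N → M} {C : Set M} {C' : Set N} {m : M}
    (hm : g (f m) = m) (hg : ContMDiffAt J I ∞ g (f m)) (hf : ContMDiffAt I J ∞ f m)
    (hmaps : MapsTo g C' C) (hinv : ∀ y ∈ C', f (g y) = y) {η : TangentSpace J (f m)}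
    (hη : η ∈ tangentSet J C' (f m)) :
    ∃ ξ ∈ tangentSet I C m, mfderiv I J f m ξ = η := by
  -- The points `g (f m)` and `m` agree only through an equation; generalising the point lets their
  -- tangent spaces be identified by substitution.
  have key : ∀ m', g (f m) = m' → m' = m → ∃ ξ ∈ tangentSet I C m', (mfderiv I J f m' ξ : E') = η := by
    rintro m' rfl h
    exact ⟨mfderiv J I g (f m) η, mfderiv_mem_tangentSet hg hmaps hη,
      mfderiv_mfderiv_of_rightInverse hg (h.symm ▸ hf) hinv hη⟩
  exact key m hm rfl

end Submanifolds

/-! ### Isomorphisms of critical problems -/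

namespace CriticalProblem

variable {E : Type*} [NormedAddCommGroup E] [NormedSpace ℝ E]
  {H : Type*} [TopologicalSpace H] {I : ModelWithCorners ℝ E H}
  {M : Type*} [TopologicalSpace M] [ChartedSpace H M]
  {E' : Type*} [NormedAddCommGroup E'] [NormedSpace ℝ E']
  {H' : Type*} [TopologicalSpace H'] {I' : ModelWithCorners ℝ E' H'}
  {M' : Type*} [TopologicalSpace M'] [ChartedSpace H' M']
  {F : Type*} [NormedAddCommGroup F] [NormedSpace ℝ F]
  {K : Type*} [TopologicalSpace K] {J : ModelWithCorners ℝ F K}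
  {N : Type*} [TopologicalSpace N] [ChartedSpace K N]

theorem mem_criticalPoints_iff {P : CriticalProblem I M N} {m : M} : m ∈ P.criticalPoints J ↔
    m ∈ P.carrier ∧ ∀ ξ ∈ P.distribution J m, P.form m ξ = 0 :=
  ⟨fun ⟨_, h⟩ => ⟨h.1, h.2.2⟩, fun h => ⟨P.map m, h.1, rfl, h.2⟩⟩

/-- An isomorphism of critical problems over the same target. -/
structure IsIso (J : ModelWithCorners ℝ F K) (P : CriticalProblem I M N)
    (P' : CriticalProblem I' M' N) (Ψ : M → M') (ψ : M' → M) : Prop where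
  mapsTo : MapsTo Ψ P.carrier P'.carrier
  mapsTo_symm : MapsTo ψ P'.carrier P.carrier
  left_inv : ∀ m ∈ P.carrier, ψ (Ψ m) = m
  right_inv : ∀ m ∈ P'.carrier, Ψ (ψ m) = m
  smooth : ∀ m ∈ P.carrier, ContMDiffAt I I' ∞ Ψ m
  smooth_symm : ∀ m ∈ P'.carrier, ContMDiffAt I' I ∞ ψ m
  smooth_map : ∀ m ∈ P'.carrier, ContMDiffAt I' J ∞ P'.map m
  map_eq : P.map = P'.map ∘ Ψ
  form_eq : ∀ m ∈ P.carrier, ∀ ξ ∈ P.distribution J m,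
    P.form m ξ = P'.form (Ψ m) (mfderiv I I' Ψ m ξ)

namespace IsIso

variable {P : CriticalProblem I M N} {P' : CriticalProblem I' M' N} {Ψ : M → M'} {ψ : M' → M}

theorem mfderiv_map (h : IsIso J P P' Ψ ψ) {m : M} (hm : m ∈ P.carrier) (ξ : TangentSpace I m) :
    (mfderiv I J P.map m ξ : F) = mfderiv I' J P'.map (Ψ m) (mfderiv I I' Ψ m ξ) := by
  rw [h.map_eq]
  exact mfderiv_comp_apply m ((h.smooth_map _ (h.mapsTo hm)).mdifferentiableAt (by simp))
    ((h.smooth m hm).mdifferentiableAt (by simp)) ξ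

theorem exists_tangent (h : IsIso J P P' Ψ ψ) {m : M} (hm : m ∈ P.carrier)
    {η : TangentSpace I' (Ψ m)} (hη : η ∈ tangentSet I' P'.carrier (Ψ m)) :
    ∃ ξ ∈ tangentSet I P.carrier m, mfderiv I I' Ψ m ξ = η :=
  exists_mem_tangentSet (h.left_inv m hm) (h.smooth_symm _ (h.mapsTo hm)) (h.smooth m hm)
    h.mapsTo_symm h.right_inv hη

/-- The differential of `Ψ` carries the tangent set onto the tangent set, and it matches the
distributions because the maps to the common target agree. Hence the forms vanish on one
distribution exactly when they vanish on the other. -/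
theorem mem_criticalPoints_iff (h : IsIso J P P' Ψ ψ) {m : M} (hm : m ∈ P.carrier) :
    m ∈ P.criticalPoints J ↔ Ψ m ∈ P'.criticalPoints J := by
  rw [CriticalProblem.mem_criticalPoints_iff, CriticalProblem.mem_criticalPoints_iff]
  simp only [hm, h.mapsTo hm, true_and]
  constructor
  · rintro hc η ⟨hη, hη0⟩
    obtain ⟨ξ, hξ, rfl⟩ := h.exists_tangent hm hη
    have hd : ξ ∈ P.distribution J m := ⟨hξ, (h.mfderiv_map hm ξ).trans hη0⟩
    rw [← h.form_eq m hm ξ hd]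
    exact hc ξ hd
  · intro hc ξ hξ
    rw [h.form_eq m hm ξ hξ]
    exact hc _ ⟨mfderiv_mem_tangentSet (h.smooth m hm) h.mapsTo hξ.1,
      (h.mfderiv_map hm ξ).symm.trans hξ.2⟩

theorem bijOn_criticalPoints (h : IsIso J P P' Ψ ψ) :
    BijOn Ψ (P.criticalPoints J) (P'.criticalPoints J) := by
  have hsub : P.criticalPoints J ⊆ P.carrier := fun m hm =>
    (CriticalProblem.mem_criticalPoints_iff.1 hm).1
  refine ⟨fun m hm => (h.mem_criticalPoints_iff (hsub hm)).1 hm, ?_, ?_⟩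
  · exact (show LeftInvOn ψ Ψ P.carrier from h.left_inv).injOn.mono hsub
  · intro m' hm'
    have hc := (CriticalProblem.mem_criticalPoints_iff.1 hm').1
    refine ⟨ψ m', (h.mem_criticalPoints_iff (h.mapsTo_symm hc)).2 ?_, h.right_inv m' hc⟩
    rwa [h.right_inv m' hc]

/-- The submersion condition can be checked on an isomorphic problem. -/
theorem isCriticalProblem [IsManifold I ∞ M] [IsManifold I' ∞ M'] (h : IsIso J P P' Ψ ψ)
    (hP' : P'.IsCriticalProblem J) (hemb : IsEmbeddedSubmanifold I P.carrier)
    (hform : ∃ O : Set M, IsOpen O ∧ P.carrier ⊆ O ∧ SmoothFormOn I P.form O) :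
    P.IsCriticalProblem J := by
  refine ⟨hemb, hform, fun m hm => ⟨?_, fun η => ?_⟩⟩
  · rw [h.map_eq]
    exact (h.smooth_map _ (h.mapsTo hm)).comp m (h.smooth m hm)
  · have hη : P'.map (Ψ m) = P.map m := (congrFun h.map_eq m).symm
    obtain ⟨ξ', hξ', hξη⟩ := (hP'.2.2 _ (h.mapsTo hm)).2 (η : F)
    obtain ⟨ξ, hξ, rfl⟩ := h.exists_tangent hm hξ'
    exact ⟨ξ, hξ, (h.mfderiv_map hm ξ).trans hξη⟩

end IsIso

theorem isCriticalProblem_of_isOpen [I.Boundaryless] [IsManifold I ∞ M]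
    {P : CriticalProblem I M N} (hP : IsOpen P.carrier) (hform : SmoothFormOn I P.form P.carrier)
    (hmap : ∀ m ∈ P.carrier, ContMDiffAt I J ∞ P.map m ∧
      Function.Surjective (mfderiv I J P.map m)) : P.IsCriticalProblem J := by
  refine ⟨isEmbeddedSubmanifold_of_isOpen hP, ⟨_, hP, Subset.rfl, hform⟩, fun m hm =>
    ⟨(hmap m hm).1, fun η => ?_⟩⟩
  obtain ⟨ξ, hξ⟩ := (hmap m hm).2 η
  exact ⟨ξ, by rw [tangentSet_of_isOpen hP hm]; trivial, hξ⟩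

theorem mem_criticalPoints_iff_of_isOpen [I.Boundaryless] [IsManifold I ∞ M]
    {P : CriticalProblem I M N} (hP : IsOpen P.carrier) {m : M} : m ∈ P.criticalPoints J ↔
      m ∈ P.carrier ∧ ∀ ξ, mfderiv I J P.map m ξ = 0 → P.form m ξ = 0 := by
  rw [mem_criticalPoints_iff]
  refine and_congr_right fun hm => ?_
  simp only [distribution, tangentSet_of_isOpen hP hm, mem_univ, true_and, mem_ofPred_eq]

end CriticalProblem

/-! ### Diffeomorphisms between open sets and transport of Lagrangians and forces -/

section DiffeoPairs

variable {E : Type*} [NormedAddCommGroup E] [NormedSpace ℝ E]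
  {H : Type*} [TopologicalSpace H] {I : ModelWithCorners ℝ E H}
  {M : Type*} [TopologicalSpace M] [ChartedSpace H M]
  {E' : Type*} [NormedAddCommGroup E'] [NormedSpace ℝ E']
  {H' : Type*} [TopologicalSpace H'] {J : ModelWithCorners ℝ E' H'}
  {N : Type*} [TopologicalSpace N] [ChartedSpace H' N]

/-- `f` and `g` restrict to mutually inverse diffeomorphisms of the open sets `s` and `t`. -/
structure IsDiffeoPair (I : ModelWithCorners ℝ E H) (J : ModelWithCorners ℝ E' H') (f : M → N)
    (g : N → M) (s : Set M) (t : Set N) : Prop where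
  isOpen_source : IsOpen s
  isOpen_target : IsOpen t
  smooth : ContMDiffOn I J ∞ f s
  smooth_symm : ContMDiffOn J I ∞ g t
  mapsTo : MapsTo f s t
  mapsTo_symm : MapsTo g t s
  left_inv : ∀ x ∈ s, g (f x) = x
  right_inv : ∀ y ∈ t, f (g y) = y

namespace IsDiffeoPair

variable {f : M → N} {g : N → M} {s : Set M} {t : Set N}

theorem bijOn (h : IsDiffeoPair I J f g s t) : BijOn f s t :=
  ⟨h.mapsTo, (show LeftInvOn g f s from h.left_inv).injOn,
    fun y hy => ⟨g y, h.mapsTo_symm hy, h.right_inv y hy⟩⟩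

theorem isDiffeoOn (h : IsDiffeoPair I J f g s t) : IsDiffeoOn I J f s t :=
  ⟨h.isOpen_source, h.isOpen_target, h.bijOn, h.smooth, g, h.smooth_symm, h.left_inv, h.right_inv⟩

theorem symm (h : IsDiffeoPair I J f g s t) : IsDiffeoPair J I g f t s :=
  ⟨h.isOpen_target, h.isOpen_source, h.smooth_symm, h.smooth, h.mapsTo_symm, h.mapsTo,
    h.right_inv, h.left_inv⟩

theorem restrict (h : IsDiffeoPair I J f g s t) {O : Set N} (hO : IsOpen O) :
    IsDiffeoPair I J f g (s ∩ f ⁻¹' O) (t ∩ O) where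
  isOpen_source := h.smooth.continuousOn.isOpen_inter_preimage h.isOpen_source hO
  isOpen_target := h.isOpen_target.inter hO
  smooth := h.smooth.mono inter_subset_left
  smooth_symm := h.smooth_symm.mono inter_subset_left
  mapsTo := fun _ hx => ⟨h.mapsTo hx.1, hx.2⟩
  mapsTo_symm := fun y hy => ⟨h.mapsTo_symm hy.1, by
    rw [mem_preimage, h.right_inv y hy.1]; exact hy.2⟩
  left_inv := fun x hx => h.left_inv x hx.1
  right_inv := fun y hy => h.right_inv y hy.1

theorem contMDiffAt (h : IsDiffeoPair I J f g s t) {x : M} (hx : x ∈ s) : ContMDiffAt I J ∞ f x :=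
  h.smooth.contMDiffAt (h.isOpen_source.mem_nhds hx)

theorem mdifferentiableAt (h : IsDiffeoPair I J f g s t) {x : M} (hx : x ∈ s) :
    MDifferentiableAt I J f x := (h.contMDiffAt hx).mdifferentiableAt (by simp)

theorem mfderiv_symm_mfderiv (h : IsDiffeoPair I J f g s t) {x : M} (hx : x ∈ s)
    (ξ : TangentSpace I x) : (mfderiv J I g (f x) (mfderiv I J f x ξ) : E) = ξ := by
  have h1 := mfderiv_comp_apply x (h.symm.mdifferentiableAt (h.mapsTo hx))
    (h.mdifferentiableAt hx) ξ
  have h2 : g ∘ f =ᶠ[𝓝 x] id := by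
    filter_upwards [h.isOpen_source.mem_nhds hx] with y hy using h.left_inv y hy
  have h3 : (mfderiv I I (g ∘ f) x : E →L[ℝ] E) = .id ℝ E := h2.mfderiv_eq.trans mfderiv_id
  exact h1.symm.trans (congrArg (fun L : E →L[ℝ] E => L ξ) h3)

theorem surjective_mfderiv (h : IsDiffeoPair I J f g s t) {x : M} (hx : x ∈ s) :
    Function.Surjective (mfderiv I J f x) := by
  intro η
  have key : ∀ x', g (f x) = x' → x' = x → ∃ ξ : TangentSpace I x', (mfderiv I J f x' ξ : E') = η := by
    rintro _ rfl -
    exact ⟨mfderiv J I g (f x) η, h.symm.mfderiv_symm_mfderiv (h.mapsTo hx) η⟩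
  exact key x (h.left_inv x hx) rfl

theorem eq_zero_of_mfderiv_eq_zero (h : IsDiffeoPair I J f g s t) {x : M} (hx : x ∈ s)
    {ξ : TangentSpace I x} (hξ : mfderiv I J f x ξ = 0) : ξ = 0 :=
  (h.mfderiv_symm_mfderiv hx ξ).symm.trans
    ((congrArg (mfderiv J I g (f x)) hξ).trans (map_zero _))

theorem comap_comap (h : IsDiffeoPair I J f g s t) (D : LagForce I M) :
    LagForce.EqOn s D ((D.comap J I g).comap I J f) := by
  intro x hx
  refine ⟨congrArg D.lag (h.left_inv x hx).symm, ?_⟩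
  ext ξ
  have h0 : ∀ y, y = x → (D.force y : E →L[ℝ] ℝ) = D.force x := by rintro _ rfl; rfl
  have h1 := h0 _ (h.left_inv x hx)
  exact (congrArg (D.force x) (h.mfderiv_symm_mfderiv hx ξ)).symm.trans
    (congrArg (fun L : E →L[ℝ] ℝ => L (mfderiv J I g (f x) (mfderiv I J f x ξ))) h1).symm

/-- The differential is onto at each point, so a form on the target is determined by its pull-back.
-/
theorem eqOn_of_eqOn_comap (h : IsDiffeoPair I J f g s t) {D : LagForce I M} {D₁ D₂ : LagForce J N}
    (h₁ : LagForce.EqOn s D (D₁.comap I J f)) (h₂ : LagForce.EqOn s D (D₂.comap I J f)) :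
    LagForce.EqOn t D₁ D₂ := by
  intro y hy
  have hx := h.mapsTo_symm hy
  have key : ∀ y', f (g y) = y' → y' = y →
      D₁.lag y' = D₂.lag y' ∧ (D₁.force y' : E' →L[ℝ] ℝ) = D₂.force y' := by
    rintro _ rfl -
    refine ⟨(h₁ _ hx).1.symm.trans (h₂ _ hx).1, ?_⟩
    ext η
    obtain ⟨ξ, hξ⟩ := h.surjective_mfderiv hx η
    have h3 : (D₁.force (f (g y))).comp (mfderiv I J f (g y)) =
      (D₂.force (f (g y))).comp (mfderiv I J f (g y)) := (h₁ _ hx).2.symm.trans (h₂ _ hx).2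
    have h4 := congrArg (fun L : E →L[ℝ] ℝ => L ξ) h3
    exact (congrArg (D₁.force (f (g y))) hξ).symm.trans
      (h4.trans (congrArg (D₂.force (f (g y))) hξ))
  exact key y (h.right_inv y hy) rfl

/-- Transport along a diffeomorphism is a bijective correspondence of smooth pairs. -/
theorem isCorrespondence [IsManifold I ∞ M] [IsManifold J ∞ N] (h : IsDiffeoPair I J f g s t)
    {PA : LagForce I M → Prop} {PB : LagForce J N → Prop} (hA : ∀ D, PA D ↔ D.SmoothOn s)
    (hB : ∀ D, PB D ↔ D.SmoothOn t) :
    IsCorrespondence PA PB (LagForce.EqOn s) (LagForce.EqOn t)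
      (fun D D' => LagForce.EqOn s D (D'.comap I J f)) := by
  refine ⟨fun D hD => ⟨D.comap J I g, (hB _).2 (((hA D).1 hD).comap h.isOpen_target h.smooth_symm
    h.mapsTo_symm), h.comap_comap D⟩, fun D' hD' => ⟨D'.comap I J f, (hA _).2
    (((hB D').1 hD').comap h.isOpen_source h.smooth h.mapsTo), fun x _ => ⟨rfl, rfl⟩⟩,
    fun D D₁ D₂ _ _ _ h₁ h₂ => h.eqOn_of_eqOn_comap h₁ h₂, ?_⟩
  exact fun D₁ D₂ D' _ _ _ h₁ h₂ x hx =>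
    ⟨(h₁ x hx).1.trans (h₂ x hx).1.symm, (h₁ x hx).2.trans (h₂ x hx).2.symm⟩

theorem mu_eq [IsManifold J ∞ N] (h : IsDiffeoPair I J f g s t) {D : LagForce I M}
    {D' : LagForce J N} (hD : LagForce.EqOn s D (D'.comap I J f)) (hD' : D'.SmoothOn t) {x : M}
    (hx : x ∈ s) (ξ : TangentSpace I x) : D.mu x ξ = D'.mu (f x) (mfderiv I J f x ξ) := by
  have h1 := LagForce.mu_congr h.isOpen_source hD hx
  have h2 : MDifferentiableAt J 𝓘(ℝ, ℝ) D'.lag (f x) :=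
    (hD'.1.contMDiffAt (h.isOpen_target.mem_nhds (h.mapsTo hx))).mdifferentiableAt (by simp)
  exact (congrArg (fun L : E →L[ℝ] ℝ => L ξ) h1).trans
    (LagForce.mu_comap h2 (h.mdifferentiableAt hx) ξ)

/-- Fixing the parameter in a family of diffeomorphisms. -/
theorem slice {φ : ℝ → M → N} {γ : ℝ → N → M} {s : Set (ℝ × M)} {t : Set (ℝ × N)}
    (h : IsDiffeoPair (𝓘(ℝ, ℝ).prod I) (𝓘(ℝ, ℝ).prod J) (fun p => (p.1, φ p.1 p.2))
      (fun p => (p.1, γ p.1 p.2)) s t) (τ : ℝ) :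
    IsDiffeoPair I J (φ τ) (γ τ) {v | (τ, v) ∈ s} {r | (τ, r) ∈ t} where
  isOpen_source := h.isOpen_source.preimage (by fun_prop)
  isOpen_target := h.isOpen_target.preimage (by fun_prop)
  smooth := (contMDiff_snd.comp_contMDiffOn h.smooth).comp
    (contMDiff_const.prodMk contMDiff_id).contMDiffOn fun _ hx => hx
  smooth_symm := (contMDiff_snd.comp_contMDiffOn h.smooth_symm).comp
    (contMDiff_const.prodMk contMDiff_id).contMDiffOn fun _ hx => hx
  mapsTo := fun _ hx => h.mapsTo hx
  mapsTo_symm := fun _ hx => h.mapsTo_symm hx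
  left_inv := fun x hx => congrArg Prod.snd (h.left_inv (τ, x) hx)
  right_inv := fun x hx => congrArg Prod.snd (h.right_inv (τ, x) hx)

end IsDiffeoPair

end DiffeoPairs

/-! ### Consequences of an adapted pair -/

section Adapted

variable {E : Type*} [NormedAddCommGroup E] [NormedSpace ℝ E]
  {Q : Type*} [TopologicalSpace Q] [ChartedSpace E Q] [IsManifold 𝓘(ℝ, E) ∞ Q]

namespace ForcedMechanicalSystem

variable {S : ForcedMechanicalSystem E Q} {B : BoundaryTimes}
  {U : Set (ℝ × TangentBundle 𝓘(ℝ, E) Q)} {W : Set (ℝ × Q × Q)}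

/-- `γ` inverts the exact boundary maps off `h = 0`. -/
def IsInverseFamily (S : ForcedMechanicalSystem E Q) (B : BoundaryTimes)
    (U : Set (ℝ × TangentBundle 𝓘(ℝ, E) Q)) (W : Set (ℝ × Q × Q))
    (γ : ℝ → Q × Q → TangentBundle 𝓘(ℝ, E) Q) : Prop :=
  IsDiffeoPair (𝓘(ℝ, ℝ).prod 𝓘(ℝ, E).tangent) (𝓘(ℝ, ℝ).prod (𝓘(ℝ, E).prod 𝓘(ℝ, E)))
    (fun p => (p.1, S.dPair B p.1 p.2)) (fun p => (p.1, γ p.1 p.2)) {p ∈ U | p.1 ≠ 0}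
    {p ∈ W | p.1 ≠ 0}

/-- Since `dPairTilde` preserves the time step, so does its inverse; only the component of the
inverse in `TQ` carries information. -/
theorem IsAdaptedPair.exists_isInverseFamily (hUW : S.IsAdaptedPair B U W) :
    ∃ γ, S.IsInverseFamily B U W γ := by
  obtain ⟨-, -, -, -, -, hUo, hWo, hbij, hsm, g, hg, hinv⟩ := hUW
  have hfst : ∀ p ∈ {p ∈ W | p.1 ≠ 0}, (p.1, (g p).2) = g p := fun p hp =>
    Prod.ext (congrArg Prod.fst (hinv.2 hp)).symm rfl
  refine ⟨fun h r => (g (h, r)).2, hUo, hWo, hsm, hg.congr hfst, hbij.mapsTo, fun p hp => ?_,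
    fun p hp => ?_, fun p hp => ?_⟩
  · obtain ⟨x, hx, rfl⟩ := hbij.surjOn hp
    show (_, _) ∈ _
    rw [hfst _ hp, hinv.1 hx]
    exact hx
  · exact (hfst _ (hbij.mapsTo hp)).trans (hinv.1 hp)
  · exact (congrArg (S.dPairTilde B) (hfst _ hp)).trans (hinv.2 hp)

namespace IsInverseFamily

variable {γ : ℝ → Q × Q → TangentBundle 𝓘(ℝ, E) Q}

theorem slice (hγ : S.IsInverseFamily B U W γ) {h : ℝ} (h0 : h ≠ 0) :
    IsDiffeoPair 𝓘(ℝ, E).tangent (𝓘(ℝ, E).prod 𝓘(ℝ, E)) (S.dPair B h) (γ h) {v | (h, v) ∈ U}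
      {r | (h, r) ∈ W} := by
  have := IsDiffeoPair.slice hγ h
  simpa only [mem_ofPred_eq, ne_eq, h0, not_false_eq_true, and_true] using this

theorem slice_restrict (hγ : S.IsInverseFamily B U W γ) {h : ℝ} (h0 : h ≠ 0) {Q₀ : Set Q}
    (hQ₀ : IsOpen Q₀) : IsDiffeoPair 𝓘(ℝ, E).tangent (𝓘(ℝ, E).prod 𝓘(ℝ, E)) (S.dPair B h) (γ h)
      (S.bundleAt B U Q₀ h) (domainAt W Q₀ h) :=
  (hγ.slice h0).restrict (hQ₀.prod hQ₀)

/-- Transport along the exact boundary maps is a bijective correspondence of discretizations. -/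
theorem isCorrespondence (hγ : S.IsInverseFamily B U W γ) :
    IsCorrespondence (S.IsDiscretization U) (S.IsDiscretizationQQ B U)
      (fun Δ₁ Δ₂ => ∀ h, LagForce.EqOn {v | (h, v) ∈ U} (Δ₁ h) (Δ₂ h))
      (fun Δ₁ Δ₂ => ∀ h, h ≠ 0 → LagForce.EqOn {r | (h, r) ∈ W} (Δ₁ h) (Δ₂ h))
      (S.Corresponds B U) := by
  -- A family on `Q × Q` comes with a partner on `TQ` by the very definition of
  -- `IsDiscretizationQQ`.
  refine ⟨fun Δ hΔ => ?_, fun Δ' hΔ' => hΔ', fun Δ Δ₁ Δ₂ _ _ _ h₁ h₂ h h0 =>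
    (hγ.slice h0).eqOn_of_eqOn_comap (h₁ h h0) (h₂ h h0), fun Δ₁ Δ₂ Δ' hΔ₁ hΔ₂ _ h₁ h₂ h v hv => ?_⟩
  · have hc : S.Corresponds B U Δ (fun h => (Δ h).comap _ _ (γ h)) := fun h h0 =>
      (hγ.slice h0).comap_comap (Δ h)
    exact ⟨_, ⟨Δ, hΔ, hc⟩, hc⟩
  · by_cases h0 : h = 0
    · subst h0
      obtain ⟨-, -, ⟨r₁, -, hr₁⟩, ρ₁, -, hρ₁⟩ := hΔ₁
      obtain ⟨-, -, ⟨r₂, -, hr₂⟩, ρ₂, -, hρ₂⟩ := hΔ₂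
      have e1 := hr₁ _ hv
      have e2 := hr₂ _ hv
      have e3 := hρ₁ _ hv
      have e4 := hρ₂ _ hv
      simp only [zero_mul, ne_eq, OfNat.ofNat_ne_zero, not_false_eq_true, zero_pow, add_zero,
        zero_smul] at e1 e2 e3 e4
      exact ⟨e1.trans e2.symm, e3.trans e4.symm⟩
    · exact ⟨(h₁ h h0 v hv).1.trans (h₂ h h0 v hv).1.symm,
        (h₁ h h0 v hv).2.trans (h₂ h h0 v hv).2.symm⟩

end IsInverseFamily

end ForcedMechanicalSystem

end Adapted

/-! ### Smoothness of corresponding data -/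

section SmoothData

variable {E : Type*} [NormedAddCommGroup E] [NormedSpace ℝ E]
  {Q : Type*} [TopologicalSpace Q] [ChartedSpace E Q] [IsManifold 𝓘(ℝ, E) ∞ Q]

namespace ForcedMechanicalSystem

variable {S : ForcedMechanicalSystem E Q} {B : BoundaryTimes}
  {U : Set (ℝ × TangentBundle 𝓘(ℝ, E) Q)} {W : Set (ℝ × Q × Q)}
  {Δ : ℝ → LagForce 𝓘(ℝ, E).tangent (TangentBundle 𝓘(ℝ, E) Q)}
  {Δ' : ℝ → LagForce (𝓘(ℝ, E).prod 𝓘(ℝ, E)) (Q × Q)}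

theorem IsDiscretization.smoothOn_slice (hΔ : S.IsDiscretization U Δ) (h : ℝ) :
    (Δ h).SmoothOn {v | (h, v) ∈ U} :=
  ⟨hΔ.1.comp (contMDiff_const.prodMk contMDiff_id).contMDiffOn fun _ hx => hx, hΔ.2.1.slice h⟩

theorem IsDiscretization.smoothFormFamilyOn_mu (hU : IsOpen U) (hΔ : S.IsDiscretization U Δ) :
    SmoothFormFamilyOn 𝓘(ℝ, E).tangent (fun h => (Δ h).mu) U :=
  ForcedDiscrete.smoothFormFamilyOn_mu hU hΔ.1 hΔ.2.1

namespace IsInverseFamily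

variable {γ : ℝ → Q × Q → TangentBundle 𝓘(ℝ, E) Q}

/-- The definition of a discretization on `Q × Q` imposes smoothness only on pull-backs. Recovering
the family from its partner by the inverse of the boundary pair is what makes it smooth itself. -/
theorem eqOn_comap_symm (hγ : S.IsInverseFamily B U W γ) (hc : S.Corresponds B U Δ Δ') {h : ℝ}
    (h0 : h ≠ 0) : LagForce.EqOn {r | (h, r) ∈ W} ((Δ h).comap _ _ (γ h)) (Δ' h) :=
  (hγ.slice h0).eqOn_of_eqOn_comap ((hγ.slice h0).comap_comap (Δ h)) (hc h h0)

theorem smoothOn_slice (hγ : S.IsInverseFamily B U W γ) (hΔ : S.IsDiscretization U Δ)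
    (hc : S.Corresponds B U Δ Δ') {h : ℝ} (h0 : h ≠ 0) : (Δ' h).SmoothOn {r | (h, r) ∈ W} :=
  ((hΔ.smoothOn_slice h).comap (hγ.slice h0).isOpen_target (hγ.slice h0).smooth_symm
    (hγ.slice h0).mapsTo_symm).congr (hγ.eqOn_comap_symm hc h0)

theorem smoothFormFamilyOn_mu (hγ : S.IsInverseFamily B U W γ) (hΔ : S.IsDiscretization U Δ)
    (hc : S.Corresponds B U Δ Δ') :
    SmoothFormFamilyOn (𝓘(ℝ, E).prod 𝓘(ℝ, E)) (fun h => (Δ' h).mu) {p ∈ W | p.1 ≠ 0} := by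
  have hg : ContMDiffOn (𝓘(ℝ, ℝ).prod (𝓘(ℝ, E).prod 𝓘(ℝ, E))) 𝓘(ℝ, E).tangent ∞
      (fun p : ℝ × Q × Q => γ p.1 p.2) {p ∈ W | p.1 ≠ 0} :=
    contMDiff_snd.comp_contMDiffOn hγ.smooth_symm
  have hmem : ∀ p ∈ {p ∈ W | p.1 ≠ 0}, (p.1, γ p.1 p.2) ∈ U := fun p hp => (hγ.mapsTo_symm hp).1
  refine ForcedDiscrete.smoothFormFamilyOn_mu hγ.isOpen_target ?_ ?_
  · exact (hΔ.1.comp (contMDiffOn_fst.prodMk hg) hmem).congr fun p hp =>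
      (hγ.eqOn_comap_symm hc hp.2 p.2 hp.1).1.symm
  · exact (hΔ.2.1.pullback hγ.isOpen_target hg hmem).congr fun p hp =>
      (hγ.eqOn_comap_symm hc hp.2 p.2 hp.1).2.symm

end IsInverseFamily

end ForcedMechanicalSystem

end SmoothData

/-! ### Discrete systems related by a diffeomorphism -/

section FixedStep

variable {E : Type*} [NormedAddCommGroup E] [NormedSpace ℝ E]
  {Q : Type*} [TopologicalSpace Q] [ChartedSpace E Q]
  {F : Type*} [NormedAddCommGroup F] [NormedSpace ℝ F]
  {H : Type*} [TopologicalSpace H] {I : ModelWithCorners ℝ F H}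
  {M : Type*} [TopologicalSpace M] [ChartedSpace H M]

/-- The maps agree on `C` only, so their derivatives are compared along curves in `C`. It yields the
matching condition on the middle vectors of a path variation. -/
theorem mfderiv_eq_of_mem_tangentSet {C : Set M} {f g : M → Q} {m : M}
    (hf : MDifferentiableAt I 𝓘(ℝ, E) f m) (hg : MDifferentiableAt I 𝓘(ℝ, E) g m)
    (hfg : ∀ x ∈ C, f x = g x) {ξ : TangentSpace I m} (hξ : ξ ∈ tangentSet I C m) :
    (mfderiv I 𝓘(ℝ, E) f m ξ : E) = mfderiv I 𝓘(ℝ, E) g m ξ := by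
  obtain ⟨c, hc, hev, hv⟩ := hξ
  obtain ⟨rfl, rfl⟩ := tangentBundle_mk_eq_mk_iff.1 hv
  have hc' := hc.mdifferentiableAt (n := ∞) (by simp)
  have h1 : velocity 𝓘(ℝ, E) (fun t => f (c t)) 0 = velocity 𝓘(ℝ, E) (fun t => g (c t)) 0 :=
    velocity_congr (hev.mono fun t ht => hfg _ ht)
  have h2 := (velocity_comp hf hc').symm.trans (h1.trans (velocity_comp hg hc'))
  exact (tangentBundle_mk_eq_mk_iff.1 h2).2

section Pair

variable {f : M → Q × Q} {s : Set M}

theorem mfderiv_fst_comp {x : M} (hf : MDifferentiableAt I (𝓘(ℝ, E).prod 𝓘(ℝ, E)) f x)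
    (ξ : TangentSpace I x) : (mfderiv I 𝓘(ℝ, E) (fun y => (f y).1) x ξ : E) =
      (mfderiv I (𝓘(ℝ, E).prod 𝓘(ℝ, E)) f x ξ : E × E).1 :=
  (mfderiv_comp_apply x mdifferentiableAt_fst hf ξ).trans
    (congrArg (fun L : E × E →L[ℝ] E => L (mfderiv I (𝓘(ℝ, E).prod 𝓘(ℝ, E)) f x ξ)) mfderiv_fst)

theorem mfderiv_snd_comp {x : M} (hf : MDifferentiableAt I (𝓘(ℝ, E).prod 𝓘(ℝ, E)) f x)
    (ξ : TangentSpace I x) : (mfderiv I 𝓘(ℝ, E) (fun y => (f y).2) x ξ : E) =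
      (mfderiv I (𝓘(ℝ, E).prod 𝓘(ℝ, E)) f x ξ : E × E).2 :=
  (mfderiv_comp_apply x mdifferentiableAt_snd hf ξ).trans
    (congrArg (fun L : E × E →L[ℝ] E => L (mfderiv I (𝓘(ℝ, E).prod 𝓘(ℝ, E)) f x ξ)) mfderiv_snd)

theorem mfderiv_comp_fst {k : M → Q} {p : M × M} (hk : MDifferentiableAt I 𝓘(ℝ, E) k p.1)
    (ξ : F × F) : (mfderiv (I.prod I) 𝓘(ℝ, E) (fun x : M × M => k x.1) p ξ : E) =
      mfderiv I 𝓘(ℝ, E) k p.1 ξ.1 :=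
  congrArg (fun L : F × F →L[ℝ] E => L ξ)
    (hk.hasMFDerivAt.comp p (hasMFDerivAt_fst (I := I) (I' := I) p)).mfderiv

theorem mfderiv_comp_snd {k : M → Q} {p : M × M} (hk : MDifferentiableAt I 𝓘(ℝ, E) k p.2)
    (ξ : F × F) : (mfderiv (I.prod I) 𝓘(ℝ, E) (fun x : M × M => k x.2) p ξ : E) =
      mfderiv I 𝓘(ℝ, E) k p.2 ξ.2 :=
  congrArg (fun L : F × F →L[ℝ] E => L ξ)
    (hk.hasMFDerivAt.comp p (hasMFDerivAt_snd (I := I) (I' := I) p)).mfderiv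

end Pair

theorem DiscreteSystem.criticalProblem_form {Q' : Type*} (T : DiscreteSystem I M Q') (p : M × M) (ξ : F × F) :
    T.criticalProblem.form p ξ = T.data.mu p.1 ξ.1 + T.data.mu p.2 ξ.2 :=
  congrArg₂ (fun L L' : F × F →L[ℝ] F => T.data.mu p.1 (L ξ) + T.data.mu p.2 (L' ξ))
    (hasMFDerivAt_fst (I := I) (I' := I) p).mfderiv (hasMFDerivAt_snd (I := I) (I' := I) p).mfderiv

/-- The discrete Euler-Lagrange (D'Alembert) equation at `(q₀, q₁, q₂)`. -/
def DiscreteEquation (D : LagForce (𝓘(ℝ, E).prod 𝓘(ℝ, E)) (Q × Q)) (r : Q × Q × Q) : Prop :=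
  ∀ η : E, D.mu (r.1, r.2.1) ((0, η) : E × E) + D.mu (r.2.1, r.2.2) ((η, 0) : E × E) = 0

/-! ### Systems on pairs of points and the discrete equation -/

namespace DiscreteSystemQQ

variable (T : DiscreteSystemQQ 𝓘(ℝ, E) Q)

theorem hasMFDerivAt_fst_mid (r : Q × Q × Q) : HasMFDerivAt (𝓘(ℝ, E).prod (𝓘(ℝ, E).prod 𝓘(ℝ, E)))
    (𝓘(ℝ, E).prod 𝓘(ℝ, E)) (fun s : Q × Q × Q => (s.1, s.2.1)) r
    ((ContinuousLinearMap.fst ℝ E (E × E)).prod ((ContinuousLinearMap.fst ℝ E E).comp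
      (ContinuousLinearMap.snd ℝ E (E × E)))) :=
  (hasMFDerivAt_fst r).prodMk ((hasMFDerivAt_fst r.2).comp r (hasMFDerivAt_snd r))

theorem hasMFDerivAt_fst_last (r : Q × Q × Q) : HasMFDerivAt (𝓘(ℝ, E).prod (𝓘(ℝ, E).prod 𝓘(ℝ, E)))
    (𝓘(ℝ, E).prod 𝓘(ℝ, E)) (fun s : Q × Q × Q => (s.1, s.2.2)) r
    ((ContinuousLinearMap.fst ℝ E (E × E)).prod ((ContinuousLinearMap.snd ℝ E E).comp
      (ContinuousLinearMap.snd ℝ E (E × E)))) :=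
  (hasMFDerivAt_fst r).prodMk ((hasMFDerivAt_snd r.2).comp r (hasMFDerivAt_snd r))

theorem criticalProblem_form (r : Q × Q × Q) (ξ : E × E × E) : T.criticalProblem.form r ξ =
    T.data.mu (r.1, r.2.1) ((ξ.1, ξ.2.1) : E × E) +
      T.data.mu (r.2.1, r.2.2) ((ξ.2.1, ξ.2.2) : E × E) :=
  congrArg₂ (fun L L' : E × E × E →L[ℝ] E × E =>
      T.data.mu (r.1, r.2.1) (L ξ) + T.data.mu (r.2.1, r.2.2) (L' ξ))
    (hasMFDerivAt_fst_mid r).mfderiv (hasMFDerivAt_snd r).mfderiv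

theorem criticalProblem_mfderiv_map (r : Q × Q × Q) (ξ : E × E × E) :
    (mfderiv (𝓘(ℝ, E).prod (𝓘(ℝ, E).prod 𝓘(ℝ, E))) (𝓘(ℝ, E).prod 𝓘(ℝ, E)) T.criticalProblem.map r ξ
      : E × E) = (ξ.1, ξ.2.2) :=
  congrArg (fun L : E × E × E →L[ℝ] E × E => L ξ) (hasMFDerivAt_fst_last r).mfderiv

variable {T}

theorem isOpen_carrier (hT : IsOpen T.domain) : IsOpen T.criticalProblem.carrier :=
  (hT.preimage (by fun_prop : Continuous fun r : Q × Q × Q => (r.1, r.2.1))).inter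
    (hT.preimage (by fun_prop : Continuous fun r : Q × Q × Q => (r.2.1, r.2.2)))

/-- A variation of `(q₀, q₁, q₂)` with fixed ends is one vector at `q₁`, so the principle is a
single linear equation in it. -/
theorem isTrajectory_iff {r : Q × Q × Q} : T.IsTrajectory ![r.1, r.2.1, r.2.2] ↔
    r ∈ T.criticalProblem.carrier ∧ DiscreteEquation T.data r := by
  refine and_congr ?_ ⟨fun h η => ?_, fun h δ h0 h2 => ?_⟩
  · rw [Fin.forall_fin_two]
    rfl
  · have := h (fun k => (![0, η, 0] : Fin 3 → E) k) rfl rfl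
    rw [Fin.sum_univ_two] at this
    exact this
  · rw [Fin.sum_univ_two]
    have h1 := h (δ 1)
    have e1 : ((δ (Fin.castSucc 0), δ (Fin.succ 0)) : E × E) = (0, δ 1) := Prod.ext h0 rfl
    have e2 : ((δ (Fin.castSucc 1), δ (Fin.succ 1)) : E × E) = (δ 1, 0) := Prod.ext rfl h2
    refine (congrArg₂ (fun a b : E × E => T.data.mu (r.1, r.2.1) a + T.data.mu (r.2.1, r.2.2) b)
      e1 e2).trans h1

variable [IsManifold 𝓘(ℝ, E) ∞ Q]

/-- The carrier is open, so all triples of vectors are tangent to it; the kernel of the map consists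
of those with zero end components. The trajectory equation results. -/
theorem mem_criticalPoints_iff (hT : IsOpen T.domain) {r : Q × Q × Q} :
    r ∈ T.criticalProblem.criticalPoints (𝓘(ℝ, E).prod 𝓘(ℝ, E)) ↔
      r ∈ T.criticalProblem.carrier ∧ DiscreteEquation T.data r := by
  rw [CriticalProblem.mem_criticalPoints_iff_of_isOpen (isOpen_carrier hT)]
  refine and_congr_right fun _ => ⟨fun h η => ?_, fun h (ξ : E × E × E) hξ => ?_⟩
  · refine (T.criticalProblem_form r (0, η, 0)).symm.trans (h _ ?_)
    exact T.criticalProblem_mfderiv_map r (0, η, 0)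
  · have h1 : ((ξ.1, ξ.2.2) : E × E) = 0 := (T.criticalProblem_mfderiv_map r ξ).symm.trans hξ
    have h2 : ξ.1 = 0 := congrArg (fun x : E × E => x.1) h1
    have h3 : ξ.2.2 = 0 := congrArg (fun x : E × E => x.2) h1
    refine (T.criticalProblem_form r ξ).trans ?_
    rw [h2, h3]
    exact h ξ.2.1

theorem isCriticalProblem (hT : IsOpen T.domain) (hD : T.data.SmoothOn T.domain) :
    T.criticalProblem.IsCriticalProblem (𝓘(ℝ, E).prod 𝓘(ℝ, E)) := by
  have ho := isOpen_carrier hT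
  have hmu := hD.smoothFormOn_mu hT
  refine CriticalProblem.isCriticalProblem_of_isOpen ho ?_ fun r hr => ⟨?_, fun η => ?_⟩
  · exact (hmu.pullback ho (contMDiffOn_fst.prodMk (contMDiff_fst.comp contMDiff_snd).contMDiffOn)
      fun r hr => hr.1).add (hmu.pullback ho contMDiffOn_snd fun r hr => hr.2)
  · exact contMDiffAt_fst.prodMk (contMDiffAt_snd.comp r contMDiffAt_snd)
  · exact ⟨((η : E × E).1, 0, (η : E × E).2), T.criticalProblem_mfderiv_map r _⟩

end DiscreteSystemQQ

end FixedStep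

/-! ### Transfer of discrete systems along their boundary maps -/

namespace DiscreteSystem

variable {E : Type*} [NormedAddCommGroup E] [NormedSpace ℝ E]
  {Q : Type*} [TopologicalSpace Q] [ChartedSpace E Q] [IsManifold 𝓘(ℝ, E) ∞ Q]
  {F : Type*} [NormedAddCommGroup F] [NormedSpace ℝ F]
  {H : Type*} [TopologicalSpace H] {I : ModelWithCorners ℝ F H}
  {M : Type*} [TopologicalSpace M] [ChartedSpace H M]

/-- The discrete system `T` is carried to the system `T'` on `Q₀ × Q₀` by its boundary maps, with
inverse `g`. -/
structure IsEquivQQ (T : DiscreteSystem I M Q) (T' : DiscreteSystemQQ 𝓘(ℝ, E) Q)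
    (g : Q × Q → M) : Prop where
  pair : IsDiffeoPair I (𝓘(ℝ, E).prod 𝓘(ℝ, E)) (fun v => (T.dMinus v, T.dPlus v)) g T.bundle
    T'.domain
  data_eq : LagForce.EqOn T.bundle T.data
    (T'.data.comap I (𝓘(ℝ, E).prod 𝓘(ℝ, E)) (fun v => (T.dMinus v, T.dPlus v)))
  smooth_data : T'.data.SmoothOn T'.domain

/-- The base points of a discrete path. -/
def basePoints (T : DiscreteSystem I M Q) (p : M × M) : Q × Q × Q :=
  (T.dMinus p.1, T.dPlus p.1, T.dPlus p.2)

namespace IsEquivQQ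

variable {T : DiscreteSystem I M Q} {T' : DiscreteSystemQQ 𝓘(ℝ, E) Q} {g : Q × Q → M}

theorem contMDiffAt_dMinus (h : T.IsEquivQQ T' g) {v : M} (hv : v ∈ T.bundle) :
    ContMDiffAt I 𝓘(ℝ, E) ∞ T.dMinus v := contMDiffAt_fst.comp v (h.pair.contMDiffAt hv)

theorem contMDiffAt_dPlus (h : T.IsEquivQQ T' g) {v : M} (hv : v ∈ T.bundle) :
    ContMDiffAt I 𝓘(ℝ, E) ∞ T.dPlus v := contMDiffAt_snd.comp v (h.pair.contMDiffAt hv)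

theorem mdifferentiableAt_dMinus (h : T.IsEquivQQ T' g) {v : M} (hv : v ∈ T.bundle) :
    MDifferentiableAt I 𝓘(ℝ, E) T.dMinus v :=
  (h.contMDiffAt_dMinus hv).mdifferentiableAt (by simp)

theorem mdifferentiableAt_dPlus (h : T.IsEquivQQ T' g) {v : M} (hv : v ∈ T.bundle) :
    MDifferentiableAt I 𝓘(ℝ, E) T.dPlus v :=
  (h.contMDiffAt_dPlus hv).mdifferentiableAt (by simp)

theorem mfderiv_pair (h : T.IsEquivQQ T' g) {v : M} (hv : v ∈ T.bundle) (ξ : TangentSpace I v) :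
    (mfderiv I (𝓘(ℝ, E).prod 𝓘(ℝ, E)) (fun v => (T.dMinus v, T.dPlus v)) v ξ : E × E) =
      (mfderiv I 𝓘(ℝ, E) T.dMinus v ξ, mfderiv I 𝓘(ℝ, E) T.dPlus v ξ) :=
  Prod.ext (mfderiv_fst_comp (h.pair.mdifferentiableAt hv) ξ).symm
    (mfderiv_snd_comp (h.pair.mdifferentiableAt hv) ξ).symm

theorem exists_mfderiv_eq (h : T.IsEquivQQ T' g) {v : M} (hv : v ∈ T.bundle) (a b : E) :
    ∃ ξ : TangentSpace I v, (mfderiv I 𝓘(ℝ, E) T.dMinus v ξ : E) = a ∧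
      (mfderiv I 𝓘(ℝ, E) T.dPlus v ξ : E) = b := by
  obtain ⟨ξ, hξ⟩ := h.pair.surjective_mfderiv hv ((a, b) : E × E)
  have h1 := (h.mfderiv_pair hv ξ).symm.trans hξ
  exact ⟨ξ, congrArg (fun x : E × E => x.1) h1, congrArg (fun x : E × E => x.2) h1⟩

theorem mu_eq (h : T.IsEquivQQ T' g) {v : M} (hv : v ∈ T.bundle) (ξ : TangentSpace I v) :
    T.data.mu v ξ = T'.data.mu (T.dMinus v, T.dPlus v)
      ((mfderiv I 𝓘(ℝ, E) T.dMinus v ξ, mfderiv I 𝓘(ℝ, E) T.dPlus v ξ) : E × E) :=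
  (h.pair.mu_eq h.data_eq h.smooth_data hv ξ).trans
    (congrArg (T'.data.mu (T.dMinus v, T.dPlus v)) (h.mfderiv_pair hv ξ))

/-- Sum of the forms along a discrete path, for vectors that match in the middle. -/
theorem mu_add_mu (h : T.IsEquivQQ T' g) {p : M × M} (hp : p ∈ T.criticalProblem.carrier)
    (ξ : TangentSpace I p.1) (ζ : TangentSpace I p.2)
    (hξζ : (mfderiv I 𝓘(ℝ, E) T.dPlus p.1 ξ : E) = mfderiv I 𝓘(ℝ, E) T.dMinus p.2 ζ) :
    T.data.mu p.1 ξ + T.data.mu p.2 ζ = T'.criticalProblem.form (T.basePoints p)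
      ((mfderiv I 𝓘(ℝ, E) T.dMinus p.1 ξ, mfderiv I 𝓘(ℝ, E) T.dPlus p.1 ξ,
        mfderiv I 𝓘(ℝ, E) T.dPlus p.2 ζ) : E × E × E) := by
  refine Eq.trans ?_ (T'.criticalProblem_form (T.basePoints p) _).symm
  rw [h.mu_eq hp.1 ξ, h.mu_eq hp.2.1 ζ]
  -- The middle point appears as `∂⁺` of the first vector and as `∂⁻` of the second; generalising it
  -- allows the two equal points to be identified.
  have key : ∀ q, q = T.dMinus p.2 → ∀ a, a = (mfderiv I 𝓘(ℝ, E) T.dMinus p.2 ζ : E) →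
      T'.data.mu (T.dMinus p.2, T.dPlus p.2)
        ((mfderiv I 𝓘(ℝ, E) T.dMinus p.2 ζ, mfderiv I 𝓘(ℝ, E) T.dPlus p.2 ζ) : E × E) =
      T'.data.mu (q, T.dPlus p.2) ((a, mfderiv I 𝓘(ℝ, E) T.dPlus p.2 ζ) : E × E) := by
    rintro _ rfl _ rfl
    rfl
  exact congrArg _ (key _ hp.2.2 _ hξζ)

theorem mfderiv_basePoints (h : T.IsEquivQQ T' g) {p : M × M}
    (hp : p ∈ T.criticalProblem.carrier) (ξ : F × F) :
    (mfderiv (I.prod I) (𝓘(ℝ, E).prod (𝓘(ℝ, E).prod 𝓘(ℝ, E))) T.basePoints p ξ : E × E × E) =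
      (mfderiv I 𝓘(ℝ, E) T.dMinus p.1 ξ.1, mfderiv I 𝓘(ℝ, E) T.dPlus p.1 ξ.1,
        mfderiv I 𝓘(ℝ, E) T.dPlus p.2 ξ.2) := by
  have h1 := (h.mdifferentiableAt_dMinus hp.1).hasMFDerivAt.comp p
    (hasMFDerivAt_fst (I := I) (I' := I) p)
  have h2 := (h.mdifferentiableAt_dPlus hp.1).hasMFDerivAt.comp p
    (hasMFDerivAt_fst (I := I) (I' := I) p)
  have h3 := (h.mdifferentiableAt_dPlus hp.2.1).hasMFDerivAt.comp p
    (hasMFDerivAt_snd (I := I) (I' := I) p)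
  exact congrArg (fun L : F × F →L[ℝ] E × E × E => L ξ) (h1.prodMk (h2.prodMk h3)).mfderiv

theorem eq_of_mem_tangentSet (h : T.IsEquivQQ T' g) {p : M × M}
    (hp : p ∈ T.criticalProblem.carrier) {ξ : F × F}
    (hξ : ξ ∈ tangentSet (I.prod I) T.criticalProblem.carrier p) :
    (mfderiv I 𝓘(ℝ, E) T.dPlus p.1 ξ.1 : E) = mfderiv I 𝓘(ℝ, E) T.dMinus p.2 ξ.2 := by
  have h1 := h.mdifferentiableAt_dPlus hp.1
  have h2 := h.mdifferentiableAt_dMinus hp.2.1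
  have h3 := mfderiv_eq_of_mem_tangentSet (f := fun x : M × M => T.dPlus x.1)
    (g := fun x : M × M => T.dMinus x.2) (h1.comp p mdifferentiableAt_fst)
    (h2.comp p mdifferentiableAt_snd) (fun x hx => hx.2.2) hξ
  exact (mfderiv_comp_fst h1 ξ).symm.trans (h3.trans (mfderiv_comp_snd h2 ξ))

/-- A path is determined by its base points, because each of its two vectors is determined by its
pair of boundary values; the matching condition says that the middle points coincide. The forms
agree only on vectors tangent to the carrier, for which the middle derivatives match as well. -/
theorem isIso (h : T.IsEquivQQ T' g) :
    CriticalProblem.IsIso (𝓘(ℝ, E).prod 𝓘(ℝ, E)) T.criticalProblem T'.criticalProblem T.basePoints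
      (fun r => (g (r.1, r.2.1), g (r.2.1, r.2.2))) where
  mapsTo := fun p hp => ⟨h.pair.mapsTo hp.1, by
    have h2 := h.pair.mapsTo hp.2.1
    rwa [← hp.2.2] at h2⟩
  mapsTo_symm := fun r hr => ⟨h.pair.mapsTo_symm hr.1, h.pair.mapsTo_symm hr.2,
    (congrArg Prod.snd (h.pair.right_inv _ hr.1)).trans
      (congrArg Prod.fst (h.pair.right_inv _ hr.2)).symm⟩
  left_inv := fun p hp => Prod.ext (h.pair.left_inv _ hp.1)
    ((congrArg (fun q => g (q, T.dPlus p.2)) hp.2.2).trans (h.pair.left_inv _ hp.2.1))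
  right_inv := fun r hr => by
    obtain ⟨h1, h2⟩ := Prod.mk.inj (h.pair.right_inv _ hr.1)
    obtain ⟨-, h3⟩ := Prod.mk.inj (h.pair.right_inv _ hr.2)
    exact Prod.ext h1 (Prod.ext h2 h3)
  smooth := fun p hp => ((h.contMDiffAt_dMinus hp.1).comp p contMDiffAt_fst).prodMk
    (((h.contMDiffAt_dPlus hp.1).comp p contMDiffAt_fst).prodMk
      ((h.contMDiffAt_dPlus hp.2.1).comp p contMDiffAt_snd))
  smooth_symm := fun r hr =>
    (ContMDiffAt.comp r (h.pair.symm.contMDiffAt hr.1)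
      (contMDiffAt_fst.prodMk (contMDiffAt_fst.comp r contMDiffAt_snd))).prodMk
    (ContMDiffAt.comp r (h.pair.symm.contMDiffAt hr.2) contMDiffAt_snd)
  smooth_map := fun r _ => contMDiffAt_fst.prodMk (contMDiffAt_snd.comp r contMDiffAt_snd)
  map_eq := rfl
  form_eq := fun p hp ξ hξ => (T.criticalProblem_form p ξ).trans
    ((h.mu_add_mu hp _ _ (h.eq_of_mem_tangentSet hp hξ.1)).trans
      (congrArg (T'.criticalProblem.form (T.basePoints p)) (h.mfderiv_basePoints hp ξ)).symm)

theorem smoothOn_data [IsManifold I ∞ M] (h : T.IsEquivQQ T' g) : T.data.SmoothOn T.bundle :=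
  (h.smooth_data.comap h.pair.isOpen_source h.pair.smooth h.pair.mapsTo).congr fun x hx =>
    ⟨(h.data_eq x hx).1.symm, (h.data_eq x hx).2.symm⟩

theorem isEmbeddedSubmanifold_carrier [FiniteDimensional ℝ E] (h : T.IsEquivQQ T' g) :
    IsEmbeddedSubmanifold (I.prod I) T.criticalProblem.carrier := by
  have hO : IsOpen (T.bundle ×ˢ T.bundle) := h.pair.isOpen_source.prod h.pair.isOpen_source
  have hc : T.criticalProblem.carrier =
      {p : M × M | p ∈ T.bundle ×ˢ T.bundle ∧ T.dPlus p.1 = T.dMinus p.2} := by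
    ext p
    exact and_assoc.symm
  rw [hc]
  refine isEmbeddedSubmanifold_eqLocus (f := fun p : M × M => T.dPlus p.1)
    (g := fun p : M × M => T.dMinus p.2) hO
    (fun p hp => ((h.contMDiffAt_dPlus hp.1).comp p contMDiffAt_fst).contMDiffWithinAt)
    (fun p hp => ((h.contMDiffAt_dMinus hp.2).comp p contMDiffAt_snd).contMDiffWithinAt)
    fun p hp η => ?_
  obtain ⟨ξ, -, hξ⟩ := h.exists_mfderiv_eq hp.1 0 η
  refine ⟨((ξ, 0) : F × F), (mfderiv_comp_fst (h.mdifferentiableAt_dPlus hp.1) (ξ, 0)).trans hξ,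
    (mfderiv_comp_snd (h.mdifferentiableAt_dMinus hp.2) (ξ, 0)).trans (map_zero _)⟩

theorem isCriticalProblem [FiniteDimensional ℝ E] [IsManifold I ∞ M] (h : T.IsEquivQQ T' g) :
    T.criticalProblem.IsCriticalProblem (𝓘(ℝ, E).prod 𝓘(ℝ, E)) := by
  have hO : IsOpen (T.bundle ×ˢ T.bundle) := h.pair.isOpen_source.prod h.pair.isOpen_source
  have hmu := h.smoothOn_data.smoothFormOn_mu h.pair.isOpen_source
  exact h.isIso.isCriticalProblem
    (DiscreteSystemQQ.isCriticalProblem h.pair.isOpen_target h.smooth_data)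
    h.isEmbeddedSubmanifold_carrier ⟨_, hO, fun p hp => ⟨hp.1, hp.2.1⟩,
      (hmu.pullback hO contMDiffOn_fst fun p hp => hp.1).add
        (hmu.pullback hO contMDiffOn_snd fun p hp => hp.2)⟩

/-- The differential of the boundary pair is onto, so each variation `η` of the middle point lifts
to vectors at `v` and `ṽ` that fix the outer ends. Conversely, an admissible variation enters the
sum only through its middle derivative. -/
theorem isTrajectory_iff (h : T.IsEquivQQ T' g) {p : M × M} :
    T.IsTrajectory 𝓘(ℝ, E) ![p.1, p.2] ↔
      p ∈ T.criticalProblem.carrier ∧ DiscreteEquation T'.data (T.basePoints p) := by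
  have hcar : ((∀ k, (![p.1, p.2] : Fin 2 → M) k ∈ T.bundle) ∧ ∀ k : Fin 1,
      T.dPlus ((![p.1, p.2] : Fin 2 → M) k.castSucc) =
        T.dMinus ((![p.1, p.2] : Fin 2 → M) k.succ)) ↔ p ∈ T.criticalProblem.carrier := by
    rw [Fin.forall_fin_two, Fin.forall_fin_one]
    exact and_assoc
  rw [IsTrajectory, ← and_assoc, hcar]
  refine and_congr_right fun hp => ⟨fun hT η => ?_, fun hE δ hδ h0 h1 => ?_⟩
  · obtain ⟨ξ, hξ0, hξ⟩ := h.exists_mfderiv_eq hp.1 0 η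
    obtain ⟨ζ, hζ, hζ0⟩ := h.exists_mfderiv_eq hp.2.1 η 0
    have h1 := hT (fun k => (![ξ, ζ] : Fin 2 → F) k) (fun k => by
      rw [Subsingleton.elim k 0]
      exact tangentBundle_mk_eq_mk hp.2.2 (hξ.trans hζ.symm)) hξ0 hζ0
    rw [Fin.sum_univ_two] at h1
    have h2 := (h.mu_add_mu hp ξ ζ (hξ.trans hζ.symm)).symm.trans h1
    rw [hξ0, hξ, hζ0] at h2
    exact (T'.criticalProblem_form (T.basePoints p) (0, η, 0)).symm.trans h2
  · have hmid := (tangentBundle_mk_eq_mk_iff.1 (hδ 0)).2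
    rw [Fin.sum_univ_two]
    refine (h.mu_add_mu hp (δ 0) (δ 1) hmid).trans ?_
    refine (T'.criticalProblem_form (T.basePoints p) _).trans ?_
    have e0 : (mfderiv I 𝓘(ℝ, E) T.dMinus p.1 (δ 0) : E) = 0 := h0
    have e1 : (mfderiv I 𝓘(ℝ, E) T.dPlus p.2 (δ 1) : E) = 0 := h1
    rw [e0, e1]
    exact hE _

/-- On both sides trajectories are the critical points, as both amount to `DiscreteEquation`; the
bijection is then that of the isomorphic critical problems. -/
theorem bijOn_trajectories (h : T.IsEquivQQ T' g) :
    BijOn T.basePoints {p | T.IsTrajectory 𝓘(ℝ, E) ![p.1, p.2]}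
      {r | T'.IsTrajectory ![r.1, r.2.1, r.2.2]} := by
  have h1 : {p : M × M | T.IsTrajectory 𝓘(ℝ, E) ![p.1, p.2]} =
      T.criticalProblem.criticalPoints (𝓘(ℝ, E).prod 𝓘(ℝ, E)) := by
    ext p
    constructor
    · intro hp
      obtain ⟨hc, he⟩ := h.isTrajectory_iff.1 hp
      exact (h.isIso.mem_criticalPoints_iff hc).2
        ((DiscreteSystemQQ.mem_criticalPoints_iff h.pair.isOpen_target).2 ⟨h.isIso.mapsTo hc, he⟩)
    · intro hp
      have hc := (CriticalProblem.mem_criticalPoints_iff.1 hp).1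
      exact h.isTrajectory_iff.2 ⟨hc, ((DiscreteSystemQQ.mem_criticalPoints_iff
        h.pair.isOpen_target).1 ((h.isIso.mem_criticalPoints_iff hc).1 hp)).2⟩
  have h2 : {r : Q × Q × Q | T'.IsTrajectory ![r.1, r.2.1, r.2.2]} =
      T'.criticalProblem.criticalPoints (𝓘(ℝ, E).prod 𝓘(ℝ, E)) := by
    ext r
    exact DiscreteSystemQQ.isTrajectory_iff.trans
      (DiscreteSystemQQ.mem_criticalPoints_iff h.pair.isOpen_target).symm
  rw [h1, h2]
  exact h.isIso.bijOn_criticalPoints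

end IsEquivQQ

end DiscreteSystem

/-! ### Critical problems of families -/

section TimeDependent

variable {E : Type*} [NormedAddCommGroup E] [NormedSpace ℝ E]
  {Q : Type*} [TopologicalSpace Q] [ChartedSpace E Q]
  {F : Type*} [NormedAddCommGroup F] [NormedSpace ℝ F]
  {H : Type*} [TopologicalSpace H] {I : ModelWithCorners ℝ F H}
  {M : Type*} [TopologicalSpace M] [ChartedSpace H M]

theorem hasMFDerivAt_time_fst (p : ℝ × M × M) : HasMFDerivAt (𝓘(ℝ, ℝ).prod (I.prod I))
    (𝓘(ℝ, ℝ).prod I) (fun s : ℝ × M × M => (s.1, s.2.1)) p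
    ((ContinuousLinearMap.fst ℝ ℝ (F × F)).prod ((ContinuousLinearMap.fst ℝ F F).comp
      (ContinuousLinearMap.snd ℝ ℝ (F × F)))) :=
  (hasMFDerivAt_fst p).prodMk ((hasMFDerivAt_fst p.2).comp p (hasMFDerivAt_snd p))

theorem hasMFDerivAt_time_snd (p : ℝ × M × M) : HasMFDerivAt (𝓘(ℝ, ℝ).prod (I.prod I))
    (𝓘(ℝ, ℝ).prod I) (fun s : ℝ × M × M => (s.1, s.2.2)) p
    ((ContinuousLinearMap.fst ℝ ℝ (F × F)).prod ((ContinuousLinearMap.snd ℝ F F).comp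
      (ContinuousLinearMap.snd ℝ ℝ (F × F)))) :=
  (hasMFDerivAt_fst p).prodMk ((hasMFDerivAt_snd p.2).comp p (hasMFDerivAt_snd p))

/-- A vector with zero time component only sees the derivative at fixed time step, which reduces
computations on the family to the slice. -/
theorem mfderiv_time_fst {k : ℝ × M → Q} {p : ℝ × M × M}
    (hk : MDifferentiableAt (𝓘(ℝ, ℝ).prod I) 𝓘(ℝ, E) k (p.1, p.2.1)) {ξ : ℝ × F × F}
    (hξ : ξ.1 = 0) :
    (mfderiv (𝓘(ℝ, ℝ).prod (I.prod I)) 𝓘(ℝ, E) (fun x : ℝ × M × M => k (x.1, x.2.1)) p ξ : E) =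
      mfderiv I 𝓘(ℝ, E) (fun w => k (p.1, w)) p.2.1 ξ.2.1 := by
  refine (congrArg (fun L : ℝ × F × F →L[ℝ] E => L ξ)
    (hk.hasMFDerivAt.comp p (hasMFDerivAt_time_fst p)).mfderiv).trans ?_
  refine Eq.trans ?_ (mfderiv_slice hk ξ.2.1).symm
  exact congrArg (fun t : ℝ => mfderiv (𝓘(ℝ, ℝ).prod I) 𝓘(ℝ, E) k (p.1, p.2.1)
    ((t, ξ.2.1) : ℝ × F)) hξ

theorem mfderiv_time_snd {k : ℝ × M → Q} {p : ℝ × M × M}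
    (hk : MDifferentiableAt (𝓘(ℝ, ℝ).prod I) 𝓘(ℝ, E) k (p.1, p.2.2)) {ξ : ℝ × F × F}
    (hξ : ξ.1 = 0) :
    (mfderiv (𝓘(ℝ, ℝ).prod (I.prod I)) 𝓘(ℝ, E) (fun x : ℝ × M × M => k (x.1, x.2.2)) p ξ : E) =
      mfderiv I 𝓘(ℝ, E) (fun w => k (p.1, w)) p.2.2 ξ.2.2 := by
  refine (congrArg (fun L : ℝ × F × F →L[ℝ] E => L ξ)
    (hk.hasMFDerivAt.comp p (hasMFDerivAt_time_snd p)).mfderiv).trans ?_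
  refine Eq.trans ?_ (mfderiv_slice hk ξ.2.2).symm
  exact congrArg (fun t : ℝ => mfderiv (𝓘(ℝ, ℝ).prod I) 𝓘(ℝ, E) k (p.1, p.2.2)
    ((t, ξ.2.2) : ℝ × F)) hξ

theorem hasMFDerivAt_time_first (p : ℝ × Q × Q × Q) :
    HasMFDerivAt (𝓘(ℝ, ℝ).prod (𝓘(ℝ, E).prod (𝓘(ℝ, E).prod 𝓘(ℝ, E))))
      (𝓘(ℝ, ℝ).prod (𝓘(ℝ, E).prod 𝓘(ℝ, E)))
      (fun s : ℝ × Q × Q × Q => (s.1, (s.2.1, s.2.2.1))) p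
      ((ContinuousLinearMap.fst ℝ ℝ (E × E × E)).prod (((ContinuousLinearMap.fst ℝ E (E × E)).prod
        ((ContinuousLinearMap.fst ℝ E E).comp (ContinuousLinearMap.snd ℝ E (E × E)))).comp
        (ContinuousLinearMap.snd ℝ ℝ (E × E × E)))) :=
  (hasMFDerivAt_fst p).prodMk
    ((DiscreteSystemQQ.hasMFDerivAt_fst_mid p.2).comp p (hasMFDerivAt_snd p))

theorem hasMFDerivAt_time_second (p : ℝ × Q × Q × Q) :
    HasMFDerivAt (𝓘(ℝ, ℝ).prod (𝓘(ℝ, E).prod (𝓘(ℝ, E).prod 𝓘(ℝ, E))))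
      (𝓘(ℝ, ℝ).prod (𝓘(ℝ, E).prod 𝓘(ℝ, E)))
      (fun s : ℝ × Q × Q × Q => (s.1, (s.2.2.1, s.2.2.2))) p
      ((ContinuousLinearMap.fst ℝ ℝ (E × E × E)).prod ((ContinuousLinearMap.snd ℝ E (E × E)).comp
        (ContinuousLinearMap.snd ℝ ℝ (E × E × E)))) :=
  (hasMFDerivAt_fst p).prodMk ((hasMFDerivAt_snd p.2).comp p (hasMFDerivAt_snd p))

theorem hasMFDerivAt_time_ends (p : ℝ × Q × Q × Q) :
    HasMFDerivAt (𝓘(ℝ, ℝ).prod (𝓘(ℝ, E).prod (𝓘(ℝ, E).prod 𝓘(ℝ, E))))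
      (𝓘(ℝ, ℝ).prod (𝓘(ℝ, E).prod 𝓘(ℝ, E)))
      (fun s : ℝ × Q × Q × Q => (s.1, s.2.1, s.2.2.2)) p
      ((ContinuousLinearMap.fst ℝ ℝ (E × E × E)).prod (((ContinuousLinearMap.fst ℝ E (E × E)).prod
        ((ContinuousLinearMap.snd ℝ E E).comp (ContinuousLinearMap.snd ℝ E (E × E)))).comp
        (ContinuousLinearMap.snd ℝ ℝ (E × E × E)))) :=
  (hasMFDerivAt_fst p).prodMk
    ((DiscreteSystemQQ.hasMFDerivAt_fst_last p.2).comp p (hasMFDerivAt_snd p))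

theorem timeForm_apply (α : ℝ → OneForm I M) (p : ℝ × M) (ξ : ℝ × F) :
    timeForm I α p ξ = α p.1 p.2 ξ.2 :=
  congrArg (fun L : ℝ × F →L[ℝ] F => α p.1 p.2 (L ξ))
    (hasMFDerivAt_snd (I := 𝓘(ℝ, ℝ)) (I' := I) p).mfderiv

section QQ

variable {W : Set (ℝ × Q × Q)} {Δ' : ℝ → LagForce (𝓘(ℝ, E).prod 𝓘(ℝ, E)) (Q × Q)}

theorem criticalProblemQQ_form (p : ℝ × Q × Q × Q) (ξ : ℝ × E × E × E) :
    (criticalProblemQQ W Δ').form p ξ = (Δ' p.1).mu (p.2.1, p.2.2.1) ((ξ.2.1, ξ.2.2.1) : E × E) +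
      (Δ' p.1).mu (p.2.2.1, p.2.2.2) ((ξ.2.2.1, ξ.2.2.2) : E × E) := by
  refine (congrArg₂ (fun L L' : ℝ × E × E × E →L[ℝ] ℝ × E × E =>
    timeForm (𝓘(ℝ, E).prod 𝓘(ℝ, E)) (fun h => (Δ' h).mu) (p.1, (p.2.1, p.2.2.1)) (L ξ) +
    timeForm (𝓘(ℝ, E).prod 𝓘(ℝ, E)) (fun h => (Δ' h).mu) (p.1, (p.2.2.1, p.2.2.2)) (L' ξ))
    (hasMFDerivAt_time_first p).mfderiv (hasMFDerivAt_time_second p).mfderiv).trans ?_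
  exact congrArg₂ (· + ·)
    (timeForm_apply _ (p.1, (p.2.1, p.2.2.1)) (ξ.1, (ξ.2.1, ξ.2.2.1)))
    (timeForm_apply _ (p.1, (p.2.2.1, p.2.2.2)) (ξ.1, (ξ.2.2.1, ξ.2.2.2)))

theorem criticalProblemQQ_mfderiv_map (p : ℝ × Q × Q × Q) (ξ : ℝ × E × E × E) :
    (mfderiv (𝓘(ℝ, ℝ).prod (𝓘(ℝ, E).prod (𝓘(ℝ, E).prod 𝓘(ℝ, E))))
      (𝓘(ℝ, ℝ).prod (𝓘(ℝ, E).prod 𝓘(ℝ, E))) (criticalProblemQQ W Δ').map p ξ : ℝ × E × E) =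
      (ξ.1, ξ.2.1, ξ.2.2.2) :=
  congrArg (fun L : ℝ × E × E × E →L[ℝ] ℝ × E × E => L ξ) (hasMFDerivAt_time_ends p).mfderiv

theorem isOpen_carrier_criticalProblemQQ (hW : IsOpen {p ∈ W | p.1 ≠ 0}) :
    IsOpen (criticalProblemQQ W Δ').carrier := by
  have h := (hW.preimage (by fun_prop : Continuous fun p : ℝ × Q × Q × Q =>
    (p.1, (p.2.1, p.2.2.1)))).inter (hW.preimage (by fun_prop :
      Continuous fun p : ℝ × Q × Q × Q => (p.1, (p.2.2.1, p.2.2.2))))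
  convert h using 1
  ext p
  exact ⟨fun hp => ⟨⟨hp.2.1, hp.1⟩, hp.2.2, hp.1⟩, fun hp => ⟨hp.1.2, hp.1.1, hp.2.1⟩⟩

variable [IsManifold 𝓘(ℝ, E) ∞ Q]

/-- The form ignores the time component, and vectors in the kernel of the map have zero end
components. Only the middle variation remains, so the condition is that of the system at the fixed
step `p.1`. -/
theorem mem_criticalPoints_criticalProblemQQ_iff (hW : IsOpen {p ∈ W | p.1 ≠ 0})
    {p : ℝ × Q × Q × Q} : p ∈ (criticalProblemQQ W Δ').criticalPoints
      (𝓘(ℝ, ℝ).prod (𝓘(ℝ, E).prod 𝓘(ℝ, E))) ↔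
      p ∈ (criticalProblemQQ W Δ').carrier ∧ DiscreteEquation (Δ' p.1) p.2 := by
  rw [CriticalProblem.mem_criticalPoints_iff_of_isOpen (isOpen_carrier_criticalProblemQQ hW)]
  refine and_congr_right fun _ => ⟨fun h η => ?_, fun h (ξ : ℝ × E × E × E) hξ => ?_⟩
  · refine (criticalProblemQQ_form (W := W) p (0, 0, η, 0)).symm.trans (h _ ?_)
    exact criticalProblemQQ_mfderiv_map p (0, 0, η, 0)
  · have h1 : ((ξ.1, ξ.2.1, ξ.2.2.2) : ℝ × E × E) = 0 :=
      (criticalProblemQQ_mfderiv_map p ξ).symm.trans hξ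
    have h2 : ξ.2.1 = 0 := congrArg (fun x : ℝ × E × E => x.2.1) h1
    have h3 : ξ.2.2.2 = 0 := congrArg (fun x : ℝ × E × E => x.2.2) h1
    refine (criticalProblemQQ_form p ξ).trans ?_
    rw [h2, h3]
    exact h ξ.2.2.1

theorem isCriticalProblem_criticalProblemQQ (hW : IsOpen {p ∈ W | p.1 ≠ 0})
    (hmu : SmoothFormFamilyOn (𝓘(ℝ, E).prod 𝓘(ℝ, E)) (fun h => (Δ' h).mu) {p ∈ W | p.1 ≠ 0}) :
    (criticalProblemQQ W Δ').IsCriticalProblem (𝓘(ℝ, ℝ).prod (𝓘(ℝ, E).prod 𝓘(ℝ, E))) := by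
  have ho := isOpen_carrier_criticalProblemQQ (Δ' := Δ') hW
  refine CriticalProblem.isCriticalProblem_of_isOpen ho ?_ fun p _ => ⟨?_, fun η => ?_⟩
  · refine (hmu.timeForm.pullback ho ?_ fun p hp => ⟨hp.2.1, hp.1⟩).add
      (hmu.timeForm.pullback ho ?_ fun p hp => ⟨hp.2.2, hp.1⟩)
    · exact (contMDiff_fst.prodMk ((contMDiff_fst.comp contMDiff_snd).prodMk
        (contMDiff_fst.comp (contMDiff_snd.comp contMDiff_snd)))).contMDiffOn
    · exact (contMDiff_fst.prodMk (contMDiff_snd.comp contMDiff_snd)).contMDiffOn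
  · exact (contMDiff_fst.prodMk ((contMDiff_fst.comp contMDiff_snd).prodMk
      (contMDiff_snd.comp (contMDiff_snd.comp contMDiff_snd)))).contMDiffAt
  · exact ⟨((η : ℝ × E × E).1, (η : ℝ × E × E).2.1, 0, (η : ℝ × E × E).2.2),
      criticalProblemQQ_mfderiv_map p _⟩

end QQ

end TimeDependent

/-! ### Families on the tangent bundle and their isomorphism with families on pairs -/

section Families

variable {E : Type*} [NormedAddCommGroup E] [NormedSpace ℝ E]
  {Q : Type*} [TopologicalSpace Q] [ChartedSpace E Q] [IsManifold 𝓘(ℝ, E) ∞ Q]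

namespace ForcedMechanicalSystem

variable {S : ForcedMechanicalSystem E Q} {B : BoundaryTimes}
  {U : Set (ℝ × TangentBundle 𝓘(ℝ, E) Q)} {W : Set (ℝ × Q × Q)}
  {Δ : ℝ → LagForce 𝓘(ℝ, E).tangent (TangentBundle 𝓘(ℝ, E) Q)}
  {Δ' : ℝ → LagForce (𝓘(ℝ, E).prod 𝓘(ℝ, E)) (Q × Q)}

theorem criticalProblemTQ_form (p : ℝ × TangentBundle 𝓘(ℝ, E) Q × TangentBundle 𝓘(ℝ, E) Q)
    (ξ : ℝ × (E × E) × (E × E)) : (S.criticalProblemTQ B U Δ).form p ξ =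
      (Δ p.1).mu p.2.1 ξ.2.1 + (Δ p.1).mu p.2.2 ξ.2.2 := by
  refine (congrArg₂ (fun L L' : ℝ × (E × E) × (E × E) →L[ℝ] ℝ × (E × E) =>
    timeForm 𝓘(ℝ, E).tangent (fun h => (Δ h).mu) (p.1, p.2.1) (L ξ) +
    timeForm 𝓘(ℝ, E).tangent (fun h => (Δ h).mu) (p.1, p.2.2) (L' ξ))
    (hasMFDerivAt_time_fst (I := 𝓘(ℝ, E).tangent) p).mfderiv
    (hasMFDerivAt_time_snd (I := 𝓘(ℝ, E).tangent) p).mfderiv).trans ?_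
  exact congrArg₂ (· + ·) (timeForm_apply _ (p.1, p.2.1) (ξ.1, ξ.2.1))
    (timeForm_apply _ (p.1, p.2.2) (ξ.1, ξ.2.2))

/-- The base points of a discrete path with its time step. -/
def basePointsTQ (S : ForcedMechanicalSystem E Q) (B : BoundaryTimes)
    (p : ℝ × TangentBundle 𝓘(ℝ, E) Q × TangentBundle 𝓘(ℝ, E) Q) : ℝ × Q × Q × Q :=
  (p.1, S.dMinus B p.1 p.2.1, S.dPlus B p.1 p.2.1, S.dPlus B p.1 p.2.2)

namespace IsInverseFamily

variable {γ : ℝ → Q × Q → TangentBundle 𝓘(ℝ, E) Q}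

theorem isEquivQQ (hγ : S.IsInverseFamily B U W γ) (hΔ : S.IsDiscretization U Δ)
    (hc : S.Corresponds B U Δ Δ') {h : ℝ} (h0 : h ≠ 0) {Q₀ : Set Q} (hQ₀ : IsOpen Q₀) :
    (S.systemTQ B U Q₀ h (Δ h)).IsEquivQQ (systemQQ W Q₀ h (Δ' h)) (γ h) :=
  ⟨hγ.slice_restrict h0 hQ₀, fun v hv => hc h h0 v hv.1,
    (hγ.smoothOn_slice hΔ hc h0).mono fun _ hr => hr.1⟩

theorem contMDiffAt_dMinus (hγ : S.IsInverseFamily B U W γ)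
    {x : ℝ × TangentBundle 𝓘(ℝ, E) Q} (hx : x ∈ U) (h0 : x.1 ≠ 0) :
    ContMDiffAt (𝓘(ℝ, ℝ).prod 𝓘(ℝ, E).tangent) 𝓘(ℝ, E) ∞
      (fun x : ℝ × TangentBundle 𝓘(ℝ, E) Q => S.dMinus B x.1 x.2) x :=
  contMDiffAt_fst.comp x (contMDiffAt_snd.comp x (hγ.contMDiffAt ⟨hx, h0⟩))

theorem contMDiffAt_dPlus (hγ : S.IsInverseFamily B U W γ)
    {x : ℝ × TangentBundle 𝓘(ℝ, E) Q} (hx : x ∈ U) (h0 : x.1 ≠ 0) :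
    ContMDiffAt (𝓘(ℝ, ℝ).prod 𝓘(ℝ, E).tangent) 𝓘(ℝ, E) ∞
      (fun x : ℝ × TangentBundle 𝓘(ℝ, E) Q => S.dPlus B x.1 x.2) x :=
  contMDiffAt_snd.comp x (contMDiffAt_snd.comp x (hγ.contMDiffAt ⟨hx, h0⟩))

/-- Over `Q₀ = univ` the base points are unrestricted, so the fixed-step results apply at every
point of the family's carrier. -/
theorem mem_carrier_slice {p : ℝ × TangentBundle 𝓘(ℝ, E) Q × TangentBundle 𝓘(ℝ, E) Q}
    (hp : p ∈ (S.criticalProblemTQ B U Δ).carrier) :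
    p.2 ∈ (S.systemTQ B U univ p.1 (Δ p.1)).criticalProblem.carrier :=
  ⟨⟨hp.2.1, trivial, trivial⟩, ⟨hp.2.2.1, trivial, trivial⟩, hp.2.2.2⟩

section Point

variable {p : ℝ × TangentBundle 𝓘(ℝ, E) Q × TangentBundle 𝓘(ℝ, E) Q}

theorem contMDiffAt_minus_fst (hγ : S.IsInverseFamily B U W γ) (h0 : p.1 ≠ 0)
    (hp : (p.1, p.2.1) ∈ U) :
    ContMDiffAt (𝓘(ℝ, ℝ).prod (𝓘(ℝ, E).tangent.prod 𝓘(ℝ, E).tangent)) 𝓘(ℝ, E) ∞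
      (fun x : ℝ × TangentBundle 𝓘(ℝ, E) Q × TangentBundle 𝓘(ℝ, E) Q => S.dMinus B x.1 x.2.1) p :=
  ContMDiffAt.comp (g := fun x : ℝ × TangentBundle 𝓘(ℝ, E) Q => S.dMinus B x.1 x.2) p
    (hγ.contMDiffAt_dMinus hp h0)
    (contMDiffAt_fst.prodMk (contMDiffAt_fst.comp p contMDiffAt_snd))

theorem contMDiffAt_plus_fst (hγ : S.IsInverseFamily B U W γ) (h0 : p.1 ≠ 0)
    (hp : (p.1, p.2.1) ∈ U) :
    ContMDiffAt (𝓘(ℝ, ℝ).prod (𝓘(ℝ, E).tangent.prod 𝓘(ℝ, E).tangent)) 𝓘(ℝ, E) ∞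
      (fun x : ℝ × TangentBundle 𝓘(ℝ, E) Q × TangentBundle 𝓘(ℝ, E) Q => S.dPlus B x.1 x.2.1) p :=
  ContMDiffAt.comp (g := fun x : ℝ × TangentBundle 𝓘(ℝ, E) Q => S.dPlus B x.1 x.2) p
    (hγ.contMDiffAt_dPlus hp h0)
    (contMDiffAt_fst.prodMk (contMDiffAt_fst.comp p contMDiffAt_snd))

theorem contMDiffAt_minus_snd (hγ : S.IsInverseFamily B U W γ) (h0 : p.1 ≠ 0)
    (hp : (p.1, p.2.2) ∈ U) :
    ContMDiffAt (𝓘(ℝ, ℝ).prod (𝓘(ℝ, E).tangent.prod 𝓘(ℝ, E).tangent)) 𝓘(ℝ, E) ∞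
      (fun x : ℝ × TangentBundle 𝓘(ℝ, E) Q × TangentBundle 𝓘(ℝ, E) Q => S.dMinus B x.1 x.2.2) p :=
  ContMDiffAt.comp (g := fun x : ℝ × TangentBundle 𝓘(ℝ, E) Q => S.dMinus B x.1 x.2) p
    (hγ.contMDiffAt_dMinus hp h0)
    (contMDiffAt_fst.prodMk (contMDiffAt_snd.comp p contMDiffAt_snd))

theorem contMDiffAt_plus_snd (hγ : S.IsInverseFamily B U W γ) (h0 : p.1 ≠ 0)
    (hp : (p.1, p.2.2) ∈ U) :
    ContMDiffAt (𝓘(ℝ, ℝ).prod (𝓘(ℝ, E).tangent.prod 𝓘(ℝ, E).tangent)) 𝓘(ℝ, E) ∞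
      (fun x : ℝ × TangentBundle 𝓘(ℝ, E) Q × TangentBundle 𝓘(ℝ, E) Q => S.dPlus B x.1 x.2.2) p :=
  ContMDiffAt.comp (g := fun x : ℝ × TangentBundle 𝓘(ℝ, E) Q => S.dPlus B x.1 x.2) p
    (hγ.contMDiffAt_dPlus hp h0)
    (contMDiffAt_fst.prodMk (contMDiffAt_snd.comp p contMDiffAt_snd))

theorem mfderiv_basePointsTQ (hγ : S.IsInverseFamily B U W γ)
    (hp : p ∈ (S.criticalProblemTQ B U Δ).carrier) {ξ : ℝ × (E × E) × (E × E)} (hξ : ξ.1 = 0) :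
    (mfderiv (𝓘(ℝ, ℝ).prod (𝓘(ℝ, E).tangent.prod 𝓘(ℝ, E).tangent))
      (𝓘(ℝ, ℝ).prod (𝓘(ℝ, E).prod (𝓘(ℝ, E).prod 𝓘(ℝ, E)))) (S.basePointsTQ B) p ξ
        : ℝ × E × E × E) =
      (0, mfderiv 𝓘(ℝ, E).tangent 𝓘(ℝ, E) (S.dMinus B p.1) p.2.1 ξ.2.1,
        mfderiv 𝓘(ℝ, E).tangent 𝓘(ℝ, E) (S.dPlus B p.1) p.2.1 ξ.2.1,
        mfderiv 𝓘(ℝ, E).tangent 𝓘(ℝ, E) (S.dPlus B p.1) p.2.2 ξ.2.2) := by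
  obtain ⟨h0, hp1, hp2, -⟩ := hp
  have d1 := ((hγ.contMDiffAt_minus_fst h0 hp1).mdifferentiableAt (by simp)).hasMFDerivAt
  have d2 := ((hγ.contMDiffAt_plus_fst h0 hp1).mdifferentiableAt (by simp)).hasMFDerivAt
  have d3 := ((hγ.contMDiffAt_plus_snd h0 hp2).mdifferentiableAt (by simp)).hasMFDerivAt
  have d := (hasMFDerivAt_fst p).prodMk (d1.prodMk (d2.prodMk d3))
  have e := congrArg (fun L : ℝ × (E × E) × (E × E) →L[ℝ] ℝ × E × E × E => L ξ) d.mfderiv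
  refine e.trans (Prod.ext hξ (Prod.ext ?_ (Prod.ext ?_ ?_)))
  · exact mfderiv_time_fst (k := fun x : ℝ × TangentBundle 𝓘(ℝ, E) Q => S.dMinus B x.1 x.2)
      ((hγ.contMDiffAt_dMinus hp1 h0).mdifferentiableAt (by simp)) hξ
  · exact mfderiv_time_fst (k := fun x : ℝ × TangentBundle 𝓘(ℝ, E) Q => S.dPlus B x.1 x.2)
      ((hγ.contMDiffAt_dPlus hp1 h0).mdifferentiableAt (by simp)) hξ
  · exact mfderiv_time_snd (k := fun x : ℝ × TangentBundle 𝓘(ℝ, E) Q => S.dPlus B x.1 x.2)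
      ((hγ.contMDiffAt_dPlus hp2 h0).mdifferentiableAt (by simp)) hξ

theorem criticalProblemTQ_form_eq (hγ : S.IsInverseFamily B U W γ) (hΔ : S.IsDiscretization U Δ)
    (hc : S.Corresponds B U Δ Δ') (hp : p ∈ (S.criticalProblemTQ B U Δ).carrier)
    {ξ : ℝ × (E × E) × (E × E)}
    (hξ : ξ ∈ tangentSet (𝓘(ℝ, ℝ).prod (𝓘(ℝ, E).tangent.prod 𝓘(ℝ, E).tangent))
      (S.criticalProblemTQ B U Δ).carrier p) (hξ0 : ξ.1 = 0) :
    (S.criticalProblemTQ B U Δ).form p ξ = (criticalProblemQQ W Δ').form (S.basePointsTQ B p)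
      (mfderiv (𝓘(ℝ, ℝ).prod (𝓘(ℝ, E).tangent.prod 𝓘(ℝ, E).tangent))
        (𝓘(ℝ, ℝ).prod (𝓘(ℝ, E).prod (𝓘(ℝ, E).prod 𝓘(ℝ, E)))) (S.basePointsTQ B) p ξ) := by
  have heq := hγ.isEquivQQ hΔ hc hp.1 isOpen_univ
  have hmid := mfderiv_eq_of_mem_tangentSet
    (f := fun x : ℝ × TangentBundle 𝓘(ℝ, E) Q × TangentBundle 𝓘(ℝ, E) Q => S.dPlus B x.1 x.2.1)
    (g := fun x : ℝ × TangentBundle 𝓘(ℝ, E) Q × TangentBundle 𝓘(ℝ, E) Q => S.dMinus B x.1 x.2.2)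
    ((hγ.contMDiffAt_plus_fst hp.1 hp.2.1).mdifferentiableAt (by simp))
    ((hγ.contMDiffAt_minus_snd hp.1 hp.2.2.1).mdifferentiableAt (by simp))
    (fun x hx => hx.2.2.2) hξ
  have hmid' : (mfderiv 𝓘(ℝ, E).tangent 𝓘(ℝ, E) (S.dPlus B p.1) p.2.1 ξ.2.1 : E) =
      mfderiv 𝓘(ℝ, E).tangent 𝓘(ℝ, E) (S.dMinus B p.1) p.2.2 ξ.2.2 :=
    (mfderiv_time_fst (k := fun x : ℝ × TangentBundle 𝓘(ℝ, E) Q => S.dPlus B x.1 x.2)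
      ((hγ.contMDiffAt_dPlus hp.2.1 hp.1).mdifferentiableAt (by simp)) hξ0).symm.trans
    (hmid.trans (mfderiv_time_snd (k := fun x : ℝ × TangentBundle 𝓘(ℝ, E) Q => S.dMinus B x.1 x.2)
      ((hγ.contMDiffAt_dMinus hp.2.2.1 hp.1).mdifferentiableAt (by simp)) hξ0))
  refine (criticalProblemTQ_form p ξ).trans
    ((heq.mu_add_mu (mem_carrier_slice hp) ξ.2.1 ξ.2.2 hmid').trans ?_)
  refine ((systemQQ W univ p.1 (Δ' p.1)).criticalProblem_form _ _).trans ?_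
  refine (criticalProblemQQ_form (W := W) (S.basePointsTQ B p) (0, _, _, _)).symm.trans ?_
  exact (congrArg ((criticalProblemQQ W Δ').form (S.basePointsTQ B p))
    (hγ.mfderiv_basePointsTQ hp hξ0)).symm

end Point

/-- The inverse relations are those of the fixed-step systems over `univ`, one step at a time; joint
smoothness in `h` comes from the inverse family. -/
theorem isIso (hγ : S.IsInverseFamily B U W γ) (hΔ : S.IsDiscretization U Δ)
    (hc : S.Corresponds B U Δ Δ') :
    CriticalProblem.IsIso (𝓘(ℝ, ℝ).prod (𝓘(ℝ, E).prod 𝓘(ℝ, E))) (S.criticalProblemTQ B U Δ)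
      (criticalProblemQQ W Δ') (S.basePointsTQ B)
      (fun r => (r.1, γ r.1 (r.2.1, r.2.2.1), γ r.1 (r.2.2.1, r.2.2.2))) where
  mapsTo := fun p hp => by
    have h := (hγ.isEquivQQ hΔ hc hp.1 isOpen_univ).isIso.mapsTo (mem_carrier_slice hp)
    exact ⟨hp.1, h.1.1, h.2.1⟩
  mapsTo_symm := fun r hr => by
    have h := (hγ.isEquivQQ hΔ hc hr.1 isOpen_univ).isIso.mapsTo_symm (x := r.2)
      ⟨⟨hr.2.1, trivial, trivial⟩, ⟨hr.2.2, trivial, trivial⟩⟩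
    exact ⟨hr.1, h.1.1, h.2.1.1, h.2.2⟩
  left_inv := fun p hp => congrArg (Prod.mk p.1)
    ((hγ.isEquivQQ hΔ hc hp.1 isOpen_univ).isIso.left_inv p.2 (mem_carrier_slice hp))
  right_inv := fun r hr => congrArg (Prod.mk r.1)
    ((hγ.isEquivQQ hΔ hc hr.1 isOpen_univ).isIso.right_inv r.2
      ⟨⟨hr.2.1, trivial, trivial⟩, ⟨hr.2.2, trivial, trivial⟩⟩)
  smooth := fun p hp => contMDiffAt_fst.prodMk ((hγ.contMDiffAt_minus_fst hp.1 hp.2.1).prodMk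
    ((hγ.contMDiffAt_plus_fst hp.1 hp.2.1).prodMk (hγ.contMDiffAt_plus_snd hp.1 hp.2.2.1)))
  smooth_symm := fun r hr => by
    have hg : ∀ x : ℝ × Q × Q, x ∈ W → x.1 ≠ 0 →
        ContMDiffAt (𝓘(ℝ, ℝ).prod (𝓘(ℝ, E).prod 𝓘(ℝ, E))) 𝓘(ℝ, E).tangent ∞
          (fun x : ℝ × Q × Q => γ x.1 x.2) x := fun x hx h0 =>
      contMDiffAt_snd.comp x (hγ.symm.contMDiffAt ⟨hx, h0⟩)
    refine contMDiffAt_fst.prodMk (ContMDiffAt.prodMk ?_ ?_)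
    · exact ContMDiffAt.comp (g := fun x : ℝ × Q × Q => γ x.1 x.2) r (hg _ hr.2.1 hr.1)
        (contMDiff_fst.prodMk ((contMDiff_fst.comp contMDiff_snd).prodMk
          (contMDiff_fst.comp (contMDiff_snd.comp contMDiff_snd)))).contMDiffAt
    · exact ContMDiffAt.comp (g := fun x : ℝ × Q × Q => γ x.1 x.2) r (hg _ hr.2.2 hr.1)
        (contMDiff_fst.prodMk (contMDiff_snd.comp contMDiff_snd)).contMDiffAt
  smooth_map := fun r _ => (contMDiff_fst.prodMk ((contMDiff_fst.comp contMDiff_snd).prodMk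
    (contMDiff_snd.comp (contMDiff_snd.comp contMDiff_snd)))).contMDiffAt
  map_eq := rfl
  form_eq := fun p hp ξ hξ => by
    -- The target map records `h`, so vectors of the distribution have zero time component. For
    -- other vectors the differential of the base point map would also involve `h`-derivatives of
    -- the boundary maps, which the form on `TQ` does not see.
    have h0 : (ξ : ℝ × (E × E) × (E × E)).1 = 0 := by
      have d1 := ((hγ.contMDiffAt_minus_fst hp.1 hp.2.1).mdifferentiableAt (by simp)).hasMFDerivAt
      have d3 := ((hγ.contMDiffAt_plus_snd hp.1 hp.2.2.1).mdifferentiableAt (by simp)).hasMFDerivAt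
      have e := congrArg (fun L : ℝ × (E × E) × (E × E) →L[ℝ] ℝ × E × E => L ξ)
        ((hasMFDerivAt_fst p).prodMk (d1.prodMk d3)).mfderiv
      exact congrArg (fun x : ℝ × E × E => x.1) (e.symm.trans hξ.2)
    exact hγ.criticalProblemTQ_form_eq hΔ hc hp hξ.1 h0

theorem isEmbeddedSubmanifold_carrier [FiniteDimensional ℝ E] (hγ : S.IsInverseFamily B U W γ)
    (hΔ : S.IsDiscretization U Δ) (hc : S.Corresponds B U Δ Δ') :
    IsEmbeddedSubmanifold (𝓘(ℝ, ℝ).prod (𝓘(ℝ, E).tangent.prod 𝓘(ℝ, E).tangent))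
      (S.criticalProblemTQ B U Δ).carrier := by
  have hO : IsOpen {p : ℝ × TangentBundle 𝓘(ℝ, E) Q × TangentBundle 𝓘(ℝ, E) Q |
      (p.1, p.2.1) ∈ {x ∈ U | x.1 ≠ 0} ∧ (p.1, p.2.2) ∈ {x ∈ U | x.1 ≠ 0}} :=
    (hγ.isOpen_source.preimage (by fun_prop : Continuous
      fun p : ℝ × TangentBundle 𝓘(ℝ, E) Q × TangentBundle 𝓘(ℝ, E) Q => (p.1, p.2.1))).inter
    (hγ.isOpen_source.preimage (by fun_prop : Continuous
      fun p : ℝ × TangentBundle 𝓘(ℝ, E) Q × TangentBundle 𝓘(ℝ, E) Q => (p.1, p.2.2)))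
  have hcar : (S.criticalProblemTQ B U Δ).carrier = {p | p ∈ {p : ℝ × TangentBundle 𝓘(ℝ, E) Q ×
      TangentBundle 𝓘(ℝ, E) Q | (p.1, p.2.1) ∈ {x ∈ U | x.1 ≠ 0} ∧
      (p.1, p.2.2) ∈ {x ∈ U | x.1 ≠ 0}} ∧ S.dPlus B p.1 p.2.1 = S.dMinus B p.1 p.2.2} := by
    ext p
    exact ⟨fun hp => ⟨⟨⟨hp.2.1, hp.1⟩, hp.2.2.1, hp.1⟩, hp.2.2.2⟩,
      fun hp => ⟨hp.1.1.2, hp.1.1.1, hp.1.2.1, hp.2⟩⟩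
  rw [hcar]
  refine isEmbeddedSubmanifold_eqLocus
    (f := fun x : ℝ × TangentBundle 𝓘(ℝ, E) Q × TangentBundle 𝓘(ℝ, E) Q => S.dPlus B x.1 x.2.1)
    (g := fun x : ℝ × TangentBundle 𝓘(ℝ, E) Q × TangentBundle 𝓘(ℝ, E) Q => S.dMinus B x.1 x.2.2)
    hO (fun p hp => (hγ.contMDiffAt_plus_fst hp.1.2 hp.1.1).contMDiffWithinAt)
    (fun p hp => (hγ.contMDiffAt_minus_snd hp.1.2 hp.2.1).contMDiffWithinAt) fun p hp η => ?_
  obtain ⟨ξ, -, hξ⟩ := (hγ.isEquivQQ hΔ hc hp.1.2 isOpen_univ).exists_mfderiv_eq (v := p.2.1)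
    ⟨hp.1.1, trivial, trivial⟩ 0 η
  refine ⟨((0, ξ, 0) : ℝ × (E × E) × (E × E)), ?_, ?_⟩
  · exact (mfderiv_time_fst (k := fun x : ℝ × TangentBundle 𝓘(ℝ, E) Q => S.dPlus B x.1 x.2)
      ((hγ.contMDiffAt_dPlus hp.1.1 hp.1.2).mdifferentiableAt (by simp)) rfl).trans hξ
  · exact (mfderiv_time_snd (k := fun x : ℝ × TangentBundle 𝓘(ℝ, E) Q => S.dMinus B x.1 x.2)
      ((hγ.contMDiffAt_dMinus hp.2.1 hp.1.2).mdifferentiableAt (by simp)) rfl).trans (map_zero _)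

theorem isCriticalProblem [FiniteDimensional ℝ E] (hγ : S.IsInverseFamily B U W γ)
    (hU : IsOpen U) (hΔ : S.IsDiscretization U Δ) (hc : S.Corresponds B U Δ Δ') :
    (S.criticalProblemTQ B U Δ).IsCriticalProblem (𝓘(ℝ, ℝ).prod (𝓘(ℝ, E).prod 𝓘(ℝ, E))) := by
  have hmu := (hΔ.smoothFormFamilyOn_mu hU).timeForm
  have hO : IsOpen {p : ℝ × TangentBundle 𝓘(ℝ, E) Q × TangentBundle 𝓘(ℝ, E) Q |
      (p.1, p.2.1) ∈ U ∧ (p.1, p.2.2) ∈ U} :=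
    (hU.preimage (by fun_prop : Continuous
      fun p : ℝ × TangentBundle 𝓘(ℝ, E) Q × TangentBundle 𝓘(ℝ, E) Q => (p.1, p.2.1))).inter
    (hU.preimage (by fun_prop : Continuous
      fun p : ℝ × TangentBundle 𝓘(ℝ, E) Q × TangentBundle 𝓘(ℝ, E) Q => (p.1, p.2.2)))
  refine (hγ.isIso hΔ hc).isCriticalProblem (isCriticalProblem_criticalProblemQQ
    hγ.isOpen_target (hγ.smoothFormFamilyOn_mu hΔ hc)) (hγ.isEmbeddedSubmanifold_carrier hΔ hc)
    ⟨_, hO, fun p hp => ⟨hp.2.1, hp.2.2.1⟩, SmoothFormOn.add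
      (hmu.pullback hO ?_ fun p hp => hp.1) (hmu.pullback hO ?_ fun p hp => hp.2)⟩
  · exact (contMDiff_fst.prodMk (contMDiff_fst.comp contMDiff_snd)).contMDiffOn
  · exact (contMDiff_fst.prodMk (contMDiff_snd.comp contMDiff_snd)).contMDiffOn

/-- The exact discrete tangent bundle of `Q₀` at time step `h`. -/
theorem isDiscreteTangentBundle [FiniteDimensional ℝ E] (hγ : S.IsInverseFamily B U W γ) {h : ℝ}
    (h0 : h ≠ 0) {Q₀ : Set Q} (hQ₀ : IsOpen Q₀) (hdiag : ∀ q ∈ Q₀, (h, q, q) ∈ W)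
    (D : LagForce 𝓘(ℝ, E).tangent (TangentBundle 𝓘(ℝ, E) Q)) :
    (S.systemTQ B U Q₀ h D).IsDiscreteTangentBundle 𝓘(ℝ, E) := by
  have hp := hγ.slice_restrict h0 hQ₀
  have hfst : ∀ v ∈ S.bundleAt B U Q₀ h, ∀ ξ : E × E,
      (mfderiv 𝓘(ℝ, E).tangent 𝓘(ℝ, E) (S.dMinus B h) v ξ : E) =
        (mfderiv 𝓘(ℝ, E).tangent (𝓘(ℝ, E).prod 𝓘(ℝ, E)) (S.dPair B h) v ξ : E × E).1 :=
    fun v hv ξ => mfderiv_fst_comp (hp.mdifferentiableAt hv) ξ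
  have hsnd : ∀ v ∈ S.bundleAt B U Q₀ h, ∀ ξ : E × E,
      (mfderiv 𝓘(ℝ, E).tangent 𝓘(ℝ, E) (S.dPlus B h) v ξ : E) =
        (mfderiv 𝓘(ℝ, E).tangent (𝓘(ℝ, E).prod 𝓘(ℝ, E)) (S.dPair B h) v ξ : E × E).2 :=
    fun v hv ξ => mfderiv_snd_comp (hp.mdifferentiableAt hv) ξ
  refine ⟨hQ₀, hp.isOpen_source, ?_, fun v hv => hv.2.2, fun v hv => hv.2.1,
    contMDiff_snd.comp_contMDiffOn hp.smooth, contMDiff_fst.comp_contMDiffOn hp.smooth,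
    fun v hv => ⟨fun η => ?_, fun η => ?_, fun ξ h1 h2 => ?_⟩, fun q hq => ?_⟩
  · rw [Module.finrank_prod, two_mul]
  · obtain ⟨ξ, hξ⟩ := hp.surjective_mfderiv hv ((0, η) : E × E)
    exact ⟨ξ, (hsnd v hv ξ).trans (congrArg (fun x : E × E => x.2) hξ)⟩
  · obtain ⟨ξ, hξ⟩ := hp.surjective_mfderiv hv ((η, 0) : E × E)
    exact ⟨ξ, (hfst v hv ξ).trans (congrArg (fun x : E × E => x.1) hξ)⟩
  · exact hp.eq_zero_of_mfderiv_eq_zero hv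
      (Prod.ext ((hfst v hv ξ).symm.trans h2) ((hsnd v hv ξ).symm.trans h1))
  · have hmem : (q, q) ∈ domainAt W Q₀ h := ⟨hdiag q hq, hq, hq⟩
    have hr := hp.right_inv _ hmem
    refine ⟨γ h (q, q), ⟨hp.mapsTo_symm hmem, congrArg Prod.snd hr, congrArg Prod.fst hr⟩, ?_⟩
    rintro v ⟨hv, hv1, hv2⟩
    have hvq : S.dPair B h v = (q, q) := Prod.ext hv2 hv1
    rw [← hvq, hp.left_inv v hv]

end IsInverseFamily

end ForcedMechanicalSystem

end Families

/-! ### Critical points at a fixed time step -/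

namespace ForcedMechanicalSystem

variable {E : Type*} [NormedAddCommGroup E] [NormedSpace ℝ E]
  {Q : Type*} [TopologicalSpace Q] [ChartedSpace E Q] [IsManifold 𝓘(ℝ, E) ∞ Q]
  {S : ForcedMechanicalSystem E Q} {B : BoundaryTimes}
  {U : Set (ℝ × TangentBundle 𝓘(ℝ, E) Q)} {W : Set (ℝ × Q × Q)}
  {Δ : ℝ → LagForce 𝓘(ℝ, E).tangent (TangentBundle 𝓘(ℝ, E) Q)}
  {Δ' : ℝ → LagForce (𝓘(ℝ, E).prod 𝓘(ℝ, E)) (Q × Q)}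

namespace IsInverseFamily

variable {γ : ℝ → Q × Q → TangentBundle 𝓘(ℝ, E) Q} {h : ℝ} {Q₀ : Set Q}

theorem isFDMS_systemTQ_iff [FiniteDimensional ℝ E] (hγ : S.IsInverseFamily B U W γ) (h0 : h ≠ 0)
    (hQ₀ : IsOpen Q₀) (hdiag : ∀ q ∈ Q₀, (h, q, q) ∈ W)
    (D : LagForce 𝓘(ℝ, E).tangent (TangentBundle 𝓘(ℝ, E) Q)) :
    (S.systemTQ B U Q₀ h D).IsFDMS 𝓘(ℝ, E) ↔ D.SmoothOn (S.bundleAt B U Q₀ h) :=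
  ⟨fun hD => hD.2, fun hD => ⟨hγ.isDiscreteTangentBundle h0 hQ₀ hdiag D, hD⟩⟩

theorem isFDMS_systemQQ_iff (hγ : S.IsInverseFamily B U W γ) (h0 : h ≠ 0)
    (hQ₀ : IsOpen Q₀) (hdiag : ∀ q ∈ Q₀, (h, q, q) ∈ W)
    (D : LagForce (𝓘(ℝ, E).prod 𝓘(ℝ, E)) (Q × Q)) :
    (systemQQ W Q₀ h D).IsFDMS ↔ D.SmoothOn (domainAt W Q₀ h) :=
  ⟨fun hD => hD.2.2.2.2, fun hD => ⟨hQ₀, (hγ.slice_restrict h0 hQ₀).isOpen_target, fun _ hr => hr.2,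
    fun q hq => ⟨hdiag q hq, hq, hq⟩, hD⟩⟩

/-- Criticality for the family on `Q × Q` is criticality at each fixed time step. -/
theorem mem_criticalPoints_slice_iff (hγ : S.IsInverseFamily B U W γ) (hQ₀ : IsOpen Q₀)
    (h0 : h ≠ 0) (r : Q × Q × Q) :
    ((h, r) ∈ (criticalProblemQQ W Δ').criticalPoints (𝓘(ℝ, ℝ).prod (𝓘(ℝ, E).prod 𝓘(ℝ, E))) ∧
      (r.1, r.2.1) ∈ domainAt W Q₀ h ∧ (r.2.1, r.2.2) ∈ domainAt W Q₀ h) ↔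
    r ∈ (systemQQ W Q₀ h (Δ' h)).criticalProblem.criticalPoints (𝓘(ℝ, E).prod 𝓘(ℝ, E)) := by
  rw [mem_criticalPoints_criticalProblemQQ_iff hγ.isOpen_target,
    DiscreteSystemQQ.mem_criticalPoints_iff (hγ.slice_restrict h0 hQ₀).isOpen_target]
  exact ⟨fun hr => ⟨hr.2, hr.1.2⟩, fun hr => ⟨⟨⟨h0, hr.1.1.1, hr.1.2.1⟩, hr.2⟩, hr.1⟩⟩

theorem bijOn_slice_criticalProblemQQ (hγ : S.IsInverseFamily B U W γ) (hQ₀ : IsOpen Q₀)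
    (h0 : h ≠ 0) : BijOn (fun p : ℝ × Q × Q × Q => p.2)
      {p ∈ (criticalProblemQQ W Δ').criticalPoints (𝓘(ℝ, ℝ).prod (𝓘(ℝ, E).prod 𝓘(ℝ, E))) |
        p.1 = h ∧ (p.2.1, p.2.2.1) ∈ domainAt W Q₀ h ∧ (p.2.2.1, p.2.2.2) ∈ domainAt W Q₀ h}
      ((systemQQ W Q₀ h (Δ' h)).criticalProblem.criticalPoints (𝓘(ℝ, E).prod 𝓘(ℝ, E))) := by
  refine ⟨?_, ?_, fun r hr => ?_⟩
  · rintro ⟨_, r⟩ ⟨hp, rfl, hr⟩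
    exact (hγ.mem_criticalPoints_slice_iff hQ₀ h0 r).1 ⟨hp, hr⟩
  · rintro ⟨_, r⟩ ⟨-, rfl, -⟩ ⟨_, r'⟩ ⟨-, rfl, -⟩ hrr
    exact congrArg (Prod.mk _) hrr
  · obtain ⟨h1, h2⟩ := (hγ.mem_criticalPoints_slice_iff hQ₀ h0 r).2 hr
    exact ⟨(h, r), ⟨h1, rfl, h2⟩, rfl⟩

/-- The base point map identifies the paths in `{h} × 𝒞` on both sides. -/
theorem mem_bundleAt_iff (hγ : S.IsInverseFamily B U W γ) (h0 : h ≠ 0)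
    {p : TangentBundle 𝓘(ℝ, E) Q × TangentBundle 𝓘(ℝ, E) Q} (h1 : (h, p.1) ∈ U)
    (h2 : (h, p.2) ∈ U) (heq : S.dPlus B h p.1 = S.dMinus B h p.2) :
    (p.1 ∈ S.bundleAt B U Q₀ h ∧ p.2 ∈ S.bundleAt B U Q₀ h) ↔
      ((S.dMinus B h p.1, S.dPlus B h p.1) ∈ domainAt W Q₀ h ∧
        (S.dPlus B h p.1, S.dPlus B h p.2) ∈ domainAt W Q₀ h) := by
  rw [heq]
  have e1 := (hγ.slice h0).mapsTo h1
  have e2 := (hγ.slice h0).mapsTo h2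
  rw [← heq]
  constructor
  · rintro ⟨hv, hw⟩
    refine ⟨⟨e1, hv.2⟩, ?_⟩
    rw [heq]
    exact ⟨e2, hw.2⟩
  · rintro ⟨hv, hw⟩
    rw [heq] at hw
    exact ⟨⟨h1, hv.2⟩, h2, hw.2⟩

/-- The comparison goes through `Q × Q`: there the family and the fixed-step system have the same
equation, and the isomorphism for the family and the one for the fixed step bring this back to `TQ`.
-/
theorem mem_criticalPoints_slice_TQ_iff (hγ : S.IsInverseFamily B U W γ)
    (hΔ : S.IsDiscretization U Δ) (hc : S.Corresponds B U Δ Δ') (hQ₀ : IsOpen Q₀) (h0 : h ≠ 0)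
    (p : TangentBundle 𝓘(ℝ, E) Q × TangentBundle 𝓘(ℝ, E) Q) :
    ((h, p) ∈ (S.criticalProblemTQ B U Δ).criticalPoints (𝓘(ℝ, ℝ).prod (𝓘(ℝ, E).prod 𝓘(ℝ, E))) ∧
      p.1 ∈ S.bundleAt B U Q₀ h ∧ p.2 ∈ S.bundleAt B U Q₀ h) ↔
    p ∈ (S.systemTQ B U Q₀ h (Δ h)).criticalProblem.criticalPoints (𝓘(ℝ, E).prod 𝓘(ℝ, E)) := by
  have hfix := hγ.isEquivQQ hΔ hc h0 hQ₀
  constructor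
  · rintro ⟨hp, hv, hw⟩
    have hcar := (CriticalProblem.mem_criticalPoints_iff.1 hp).1
    have hr := ((hγ.isIso hΔ hc).mem_criticalPoints_iff hcar).1 hp
    exact (hfix.isIso.mem_criticalPoints_iff (m := p) ⟨hv, hw, hcar.2.2.2⟩).2
      ((hγ.mem_criticalPoints_slice_iff hQ₀ h0 _).1
        ⟨hr, (hγ.mem_bundleAt_iff h0 hcar.2.1 hcar.2.2.1 hcar.2.2.2).1 ⟨hv, hw⟩⟩)
  · intro hp
    have hcar := (CriticalProblem.mem_criticalPoints_iff.1 hp).1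
    have hr := (hfix.isIso.mem_criticalPoints_iff hcar).1 hp
    refine ⟨((hγ.isIso hΔ hc).mem_criticalPoints_iff (m := (h, p))
      ⟨h0, hcar.1.1, hcar.2.1.1, hcar.2.2⟩).2 ?_, hcar.1, hcar.2.1⟩
    exact ((hγ.mem_criticalPoints_slice_iff hQ₀ h0 _).2 hr).1

theorem bijOn_slice_criticalProblemTQ (hγ : S.IsInverseFamily B U W γ)
    (hΔ : S.IsDiscretization U Δ) (hc : S.Corresponds B U Δ Δ') (hQ₀ : IsOpen Q₀) (h0 : h ≠ 0) :
    BijOn (fun p : ℝ × TangentBundle 𝓘(ℝ, E) Q × TangentBundle 𝓘(ℝ, E) Q => p.2)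
      {p ∈ (S.criticalProblemTQ B U Δ).criticalPoints
        (𝓘(ℝ, ℝ).prod (𝓘(ℝ, E).prod 𝓘(ℝ, E))) |
        p.1 = h ∧ p.2.1 ∈ S.bundleAt B U Q₀ h ∧ p.2.2 ∈ S.bundleAt B U Q₀ h}
      ((S.systemTQ B U Q₀ h (Δ h)).criticalProblem.criticalPoints (𝓘(ℝ, E).prod 𝓘(ℝ, E))) := by
  refine ⟨?_, ?_, fun r hr => ?_⟩
  · rintro ⟨_, r⟩ ⟨hp, rfl, hr⟩
    exact (hγ.mem_criticalPoints_slice_TQ_iff hΔ hc hQ₀ h0 r).1 ⟨hp, hr⟩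
  · rintro ⟨_, r⟩ ⟨-, rfl, -⟩ ⟨_, r'⟩ ⟨-, rfl, -⟩ hrr
    exact congrArg (Prod.mk _) hrr
  · obtain ⟨h1, h2⟩ := (hγ.mem_criticalPoints_slice_TQ_iff hΔ hc hQ₀ h0 r).2 hr
    exact ⟨(h, r), ⟨h1, rfl, h2⟩, rfl⟩

theorem bijOn_slice_basePointsTQ (hγ : S.IsInverseFamily B U W γ)
    (hΔ : S.IsDiscretization U Δ) (hc : S.Corresponds B U Δ Δ') (h0 : h ≠ 0) :
    BijOn (S.basePointsTQ B)
      {p ∈ (S.criticalProblemTQ B U Δ).criticalPoints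
        (𝓘(ℝ, ℝ).prod (𝓘(ℝ, E).prod 𝓘(ℝ, E))) |
        p.1 = h ∧ p.2.1 ∈ S.bundleAt B U Q₀ h ∧ p.2.2 ∈ S.bundleAt B U Q₀ h}
      {p ∈ (criticalProblemQQ W Δ').criticalPoints (𝓘(ℝ, ℝ).prod (𝓘(ℝ, E).prod 𝓘(ℝ, E))) |
        p.1 = h ∧ (p.2.1, p.2.2.1) ∈ domainAt W Q₀ h ∧
          (p.2.2.1, p.2.2.2) ∈ domainAt W Q₀ h} := by
  have hb := (hγ.isIso hΔ hc).bijOn_criticalPoints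
  have hiff : ∀ p ∈ (S.criticalProblemTQ B U Δ).criticalPoints
      (𝓘(ℝ, ℝ).prod (𝓘(ℝ, E).prod 𝓘(ℝ, E))), p.1 = h →
      ((p.2.1 ∈ S.bundleAt B U Q₀ h ∧ p.2.2 ∈ S.bundleAt B U Q₀ h) ↔
        ((S.dMinus B h p.2.1, S.dPlus B h p.2.1) ∈ domainAt W Q₀ h ∧
          (S.dPlus B h p.2.1, S.dPlus B h p.2.2) ∈ domainAt W Q₀ h)) := by
    rintro ⟨_, p⟩ hp rfl
    have hcar := (CriticalProblem.mem_criticalPoints_iff.1 hp).1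
    exact hγ.mem_bundleAt_iff h0 hcar.2.1 hcar.2.2.1 hcar.2.2.2
  refine ⟨?_, hb.injOn.mono fun p hp => hp.1, ?_⟩
  · rintro ⟨_, p⟩ ⟨hp, rfl, hm⟩
    exact ⟨hb.mapsTo hp, rfl, (hiff _ hp rfl).1 hm⟩
  · rintro r ⟨hr, hrh, hm⟩
    obtain ⟨⟨_, p⟩, hp, rfl⟩ := hb.surjOn hr
    obtain rfl := hrh
    exact ⟨_, ⟨hp, rfl, (hiff _ hp rfl).2 hm⟩, rfl⟩

end IsInverseFamily

end ForcedMechanicalSystem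

end ForcedDiscrete

end

/-! ### The main theorem -/

open ForcedDiscrete in
theorem mainTheorem9
    {E : Type*} [NormedAddCommGroup E] [NormedSpace ℝ E] [FiniteDimensional ℝ E]
    {Q : Type*} [TopologicalSpace Q] [ChartedSpace E Q] [IsManifold 𝓘(ℝ, E) ∞ Q]
    [T2Space Q] [SecondCountableTopology Q]
    (S : ForcedMechanicalSystem E Q) (hS : S.IsRegular) (B : BoundaryTimes) :
    -- the sets `𝒰` and `𝒲` exist
    (∃ U W, S.IsAdaptedPair B U W) ∧
    ∀ U W, S.IsAdaptedPair B U W →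
      -- discretizations on `TQ` and on `Q × Q` correspond via the exact boundary maps
      IsCorrespondence (S.IsDiscretization U) (S.IsDiscretizationQQ B U)
        (fun Δ₁ Δ₂ => ∀ h, LagForce.EqOn {v | (h, v) ∈ U} (Δ₁ h) (Δ₂ h))
        (fun Δ₁ Δ₂ => ∀ h, h ≠ 0 → LagForce.EqOn {r | (h, r) ∈ W} (Δ₁ h) (Δ₂ h))
        (S.Corresponds B U) ∧
      ∀ Q₀ : Set Q, IsOpen Q₀ → IsCompact (closure Q₀) →
        -- the bound `a` on the time step exists
        (∃ a > 0, ∀ h : ℝ, |h| < a → ∀ q ∈ Q₀, (h, q, q) ∈ W) ∧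
        ∀ a > 0, (∀ h : ℝ, |h| < a → ∀ q ∈ Q₀, (h, q, q) ∈ W) →
        ∀ h : ℝ, h ≠ 0 → |h| < a →
          -- the correspondence of systems at fixed time step
          IsDiffeoOn 𝓘(ℝ, E).tangent (𝓘(ℝ, E).prod 𝓘(ℝ, E)) (S.dPair B h)
            (S.bundleAt B U Q₀ h) (domainAt W Q₀ h) ∧
          IsCorrespondence
            (fun D => (S.systemTQ B U Q₀ h D).IsFDMS 𝓘(ℝ, E))
            (fun D' => (systemQQ W Q₀ h D').IsFDMS)
            (LagForce.EqOn (S.bundleAt B U Q₀ h)) (LagForce.EqOn (domainAt W Q₀ h))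
            (fun D D' => LagForce.EqOn (S.bundleAt B U Q₀ h) D
              (D'.comap 𝓘(ℝ, E).tangent (𝓘(ℝ, E).prod 𝓘(ℝ, E)) (S.dPair B h))) ∧
          ∀ Δ Δ', S.IsDiscretization U Δ → S.IsDiscretizationQQ B U Δ' →
            S.Corresponds B U Δ Δ' →
            -- the systems obtained from corresponding discretizations correspond
            (S.systemTQ B U Q₀ h (Δ h)).IsFDMS 𝓘(ℝ, E) ∧
            (systemQQ W Q₀ h (Δ' h)).IsFDMS ∧
            LagForce.EqOn (S.bundleAt B U Q₀ h) (Δ h)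
              ((Δ' h).comap 𝓘(ℝ, E).tangent (𝓘(ℝ, E).prod 𝓘(ℝ, E)) (S.dPair B h)) ∧
            -- the four problems are critical problems
            (S.criticalProblemTQ B U Δ).IsCriticalProblem
              (𝓘(ℝ, ℝ).prod (𝓘(ℝ, E).prod 𝓘(ℝ, E))) ∧
            (criticalProblemQQ W Δ').IsCriticalProblem
              (𝓘(ℝ, ℝ).prod (𝓘(ℝ, E).prod 𝓘(ℝ, E))) ∧
            (S.systemTQ B U Q₀ h (Δ h)).criticalProblem.IsCriticalProblem
              (𝓘(ℝ, E).prod 𝓘(ℝ, E)) ∧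
            (systemQQ W Q₀ h (Δ' h)).criticalProblem.IsCriticalProblem
              (𝓘(ℝ, E).prod 𝓘(ℝ, E)) ∧
            -- critical points of the discretization on `TQ` and of its fixed-`h` system
            BijOn (fun p : ℝ × TangentBundle 𝓘(ℝ, E) Q × TangentBundle 𝓘(ℝ, E) Q => p.2)
              {p ∈ (S.criticalProblemTQ B U Δ).criticalPoints
                (𝓘(ℝ, ℝ).prod (𝓘(ℝ, E).prod 𝓘(ℝ, E))) |
                p.1 = h ∧ p.2.1 ∈ S.bundleAt B U Q₀ h ∧ p.2.2 ∈ S.bundleAt B U Q₀ h}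
              ((S.systemTQ B U Q₀ h (Δ h)).criticalProblem.criticalPoints
                (𝓘(ℝ, E).prod 𝓘(ℝ, E))) ∧
            -- critical points of the discretization on `Q × Q` and of its fixed-`h` system
            BijOn (fun p : ℝ × Q × Q × Q => p.2)
              {p ∈ (criticalProblemQQ W Δ').criticalPoints
                (𝓘(ℝ, ℝ).prod (𝓘(ℝ, E).prod 𝓘(ℝ, E))) |
                p.1 = h ∧ (p.2.1, p.2.2.1) ∈ domainAt W Q₀ h ∧
                  (p.2.2.1, p.2.2.2) ∈ domainAt W Q₀ h}
              ((systemQQ W Q₀ h (Δ' h)).criticalProblem.criticalPoints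
                (𝓘(ℝ, E).prod 𝓘(ℝ, E))) ∧
            -- critical points of the two discretizations
            BijOn (fun p : ℝ × TangentBundle 𝓘(ℝ, E) Q × TangentBundle 𝓘(ℝ, E) Q =>
                (p.1, S.dMinus B p.1 p.2.1, S.dPlus B p.1 p.2.1, S.dPlus B p.1 p.2.2))
              ((S.criticalProblemTQ B U Δ).criticalPoints
                (𝓘(ℝ, ℝ).prod (𝓘(ℝ, E).prod 𝓘(ℝ, E))))
              ((criticalProblemQQ W Δ').criticalPoints
                (𝓘(ℝ, ℝ).prod (𝓘(ℝ, E).prod 𝓘(ℝ, E)))) ∧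
            BijOn (fun p : ℝ × TangentBundle 𝓘(ℝ, E) Q × TangentBundle 𝓘(ℝ, E) Q =>
                (p.1, S.dMinus B p.1 p.2.1, S.dPlus B p.1 p.2.1, S.dPlus B p.1 p.2.2))
              {p ∈ (S.criticalProblemTQ B U Δ).criticalPoints
                (𝓘(ℝ, ℝ).prod (𝓘(ℝ, E).prod 𝓘(ℝ, E))) |
                p.1 = h ∧ p.2.1 ∈ S.bundleAt B U Q₀ h ∧ p.2.2 ∈ S.bundleAt B U Q₀ h}
              {p ∈ (criticalProblemQQ W Δ').criticalPoints
                (𝓘(ℝ, ℝ).prod (𝓘(ℝ, E).prod 𝓘(ℝ, E))) |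
                p.1 = h ∧ (p.2.1, p.2.2.1) ∈ domainAt W Q₀ h ∧
                  (p.2.2.1, p.2.2.2) ∈ domainAt W Q₀ h} ∧
            -- critical points of the two fixed-`h` systems
            BijOn (fun p : TangentBundle 𝓘(ℝ, E) Q × TangentBundle 𝓘(ℝ, E) Q =>
                (S.dMinus B h p.1, S.dPlus B h p.1, S.dPlus B h p.2))
              ((S.systemTQ B U Q₀ h (Δ h)).criticalProblem.criticalPoints
                (𝓘(ℝ, E).prod 𝓘(ℝ, E)))
              ((systemQQ W Q₀ h (Δ' h)).criticalProblem.criticalPoints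
                (𝓘(ℝ, E).prod 𝓘(ℝ, E))) ∧
            -- trajectories of the two fixed-`h` systems
            BijOn (fun p : TangentBundle 𝓘(ℝ, E) Q × TangentBundle 𝓘(ℝ, E) Q =>
                (S.dMinus B h p.1, S.dPlus B h p.1, S.dPlus B h p.2))
              {p | (S.systemTQ B U Q₀ h (Δ h)).IsTrajectory 𝓘(ℝ, E) ![p.1, p.2]}
              {r | (systemQQ W Q₀ h (Δ' h)).IsTrajectory ![r.1, r.2.1, r.2.2]} := by

  refine ⟨hS.exists_isAdaptedPair B, fun U W hUW => ?_⟩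
  obtain ⟨γ, hγ⟩ := hUW.exists_isInverseFamily
  refine ⟨hγ.isCorrespondence, fun Q₀ hQ₀ hQ₀c => ⟨hS.exists_diagonal_bound hUW hQ₀c, ?_⟩⟩
  intro a _ hdiag h h0 hha
  -- The bound on the time step enters only here: it puts the diagonal of `Q₀` inside the domain, so
  -- that `(q, q)` has a preimage.
  have hd := hdiag h hha
  refine ⟨(hγ.slice_restrict h0 hQ₀).isDiffeoOn, (hγ.slice_restrict h0 hQ₀).isCorrespondence
    (hγ.isFDMS_systemTQ_iff h0 hQ₀ hd) (hγ.isFDMS_systemQQ_iff h0 hQ₀ hd), ?_⟩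
  intro Δ Δ' hΔ _ hc
  have hfix := hγ.isEquivQQ hΔ hc h0 hQ₀
  exact ⟨(hγ.isFDMS_systemTQ_iff h0 hQ₀ hd _).2 hfix.smoothOn_data,
    (hγ.isFDMS_systemQQ_iff h0 hQ₀ hd _).2 hfix.smooth_data, hfix.data_eq,
    hγ.isCriticalProblem hUW.1 hΔ hc,
    isCriticalProblem_criticalProblemQQ hγ.isOpen_target (hγ.smoothFormFamilyOn_mu hΔ hc),
    hfix.isCriticalProblem,
    DiscreteSystemQQ.isCriticalProblem hfix.pair.isOpen_target hfix.smooth_data,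
    hγ.bijOn_slice_criticalProblemTQ hΔ hc hQ₀ h0, hγ.bijOn_slice_criticalProblemQQ hQ₀ h0,
    (hγ.isIso hΔ hc).bijOn_criticalPoints, hγ.bijOn_slice_basePointsTQ hΔ hc h0,
    hfix.isIso.bijOn_criticalPoints, hfix.bijOn_trajectories⟩
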